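/- Let $d\ge 1$, $\Omega=\mathbb T^d=\mathbb R^d/\mathbb Z^d$, let $\phi,\psi\in C^1(\Omega)$, $g\in C^2(\Omega)$ with $\phi<\psi$ and $\phi\le g\le\psi$ on $\Omega$. For $\varepsilon>0$ write $|p|_\varepsilon=\sqrt{\varepsilon^2+|p|^2}$, $V_\varepsilon(s)=\frac1\varepsilon(\phi-s)_+^4+\frac1\varepsilon(s-\psi)_+^4$, and for $v\in W^{1,\infty}(\Omega)$ $$E_\varepsilon(v)=\int_\Omega |\nabla v|_\varepsilon+V_\varepsilon(v)\,dx,\qquad E(v)=\int_\Omega|\nabla v|\,dx\ \text{ if }\phi\le v\le\psi\text{ on }\Omega,\quad E(v)=+\infty\ \text{ otherwise.}$$ Let $\varepsilon_k>0$, $\varepsilon_k\to0$, and let $u_{\varepsilon_k}$ be a classical solution ($C^{2,1}$ on $\Omega\times(0,\infty)$, continuous on $\Omega\times[0,\infty)$) of $$\partial_t u_\varepsilon=\sum_{i,j}\Big(\delta_{ij}-\frac{\partial_{x_i}u_\varepsilon\,\partial_{x_j}u_\varepsilon}{|\nabla u_\varepsilon|_\varepsilon^2}\Big)\partial_{x_ix_j}u_\varepsilon-|\nabla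 u_\varepsilon|_\varepsilon V_\varepsilon'(u_\varepsilon)\ \text{ in }\Omega\times(0,\infty),\qquad u_\varepsilon(\cdot,0)=g,$$ with $\varepsilon=\varepsilon_k$. A viscosity solution of the level set mean curvature flow with obstacles $\phi,\psi$ and initial datum $g$ is a bounded continuous $u$ on $\Omega\times[0,\infty)$ with $u(\cdot,0)=g$ and $\phi\le u\le\psi$ such that, for every $\eta\in C^\infty(\mathbb R^d\times\mathbb R)$ and $(x_0,t_0)\in\mathbb R^d\times(0,\infty)$ ($u$ being extended periodically): if $u-\eta$ has a local maximum at $(x_0,t_0)$ and $u(x_0,t_0)>\phi(x_0)$, then at $(x_0,t_0)$ one has $\partial_t\eta\le\sum_{i,j}(\delta_{ij}-\zeta_i\zeta_j)\partial_{x_ix_j}\eta$ with $\zeta=\nabla\eta/|\nabla\eta|$ if $\nabla\eta\ne0$, and with some $|\zeta|\le1$ if $\nabla\eta=0$; and the same with $\ge$ if $u-\eta$ has a local minimum at $(x_0,t_0)$ and $u(x_0,t_0)<\psi(x_0)$. Then there is a unique viscosity solution $u$ with initial datum $g$; it satisfies $\phi\le u\le\psi$ on $\Omega\times[0,\infty)$,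 $u\in W^{1,\infty}(\Omega\times(0,T))$ for every $T>0$, and $u(\cdot,t)\in W^{1,\infty}(\Omega)$ for every $t\ge0$. Moreover there is a subsequence of $(\varepsilon_k)$ (not relabelled) along which, for every $T>0$, $$u_{\varepsilon_k}\to u\ \text{ uniformly on }\Omega\times[0,T],\qquad \nabla u_{\varepsilon_k}\rightharpoonup\nabla u\ \text{ weakly-}*\text{ in }L^\infty(\Omega\times(0,T);\mathbb R^d).$$ Along it $E_{\varepsilon_k}$ $\Gamma$-converges to $E$ on $W^{1,\infty}(\Omega)$ with respect to uniform convergence. If in addition the initial datum satisfies $$\sup_{\varepsilon\in(0,1)}\int_\Omega\Big|\operatorname{div}\frac{\nabla g}{|\nabla g|_\varepsilon}-V_\varepsilon'(g)\Big|\,dx<\infty,$$ then along the same subsequence $$\lim_{k\to\infty}E_{\varepsilon_k}(u_{\varepsilon_k}(\cdot,t))=E(u(\cdot,t))\qquad\text{for every }t\ge0,$$ so that for every $t\ge0$ the functions $u_{\varepsilon_k}(\cdot,t)\in W^{1,\infty}(\Omega)$ form a recovery sequence for $u(\cdot,t)$: they converge uniformly to $u(\cdot,t)$ and $\limsup_k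 E_{\varepsilon_k}(u_{\varepsilon_k}(\cdot,t))\le E(u(\cdot,t))$. -/

import Mathlib

open MeasureTheory Filter Set
open scoped ContDiff ENNReal Topology Gradient

namespace ObstacleMCF

noncomputable section

/-! Functions on the flat torus `𝕋^d = ℝ^d / ℤ^d` are represented by `ℤ^d`-periodic functions on
`ℝ^d`; integrals over the torus are integrals over the unit cube `[0,1)^d`. -/

/-- `ℤ^d`-periodicity. -/
def IsPeriodic {d : ℕ} {α : Type*} (f : EuclideanSpace ℝ (Fin d) → α) : Prop :=
  ∀ (x : EuclideanSpace ℝ (Fin d)) (k : Fin d → ℤ),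
    f (x + WithLp.toLp 2 (fun i => (k i : ℝ))) = f x

/-- The fundamental domain `[0,1)^d` of the torus. -/
def cube (d : ℕ) : Set (EuclideanSpace ℝ (Fin d)) := {x | ∀ i, x i ∈ Set.Ico (0 : ℝ) 1}

/-- The space-time cylinder `Ω × (0,T)`. -/
def cylinder (d : ℕ) (T : ℝ) : Set (EuclideanSpace ℝ (Fin d) × ℝ) := cube d ×ˢ Set.Ioo 0 T

/-- The classical partial derivative `∂_{x_i} v (x)`. -/
def pderiv {d : ℕ} (i : Fin d) (v : EuclideanSpace ℝ (Fin d) → ℝ)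
    (x : EuclideanSpace ℝ (Fin d)) : ℝ :=
  fderiv ℝ v x (EuclideanSpace.single i 1)

/-- `(δ_{ij} - q_i q_j / s) ∂_{x_i x_j} v (x)`, summed over `i` and `j`. -/
def projectedHessianTrace {d : ℕ} (q : EuclideanSpace ℝ (Fin d)) (s : ℝ)
    (v : EuclideanSpace ℝ (Fin d) → ℝ) (x : EuclideanSpace ℝ (Fin d)) : ℝ :=
  ∑ i, ∑ j, ((if i = j then 1 else 0) - q i * q j / s) * pderiv i (pderiv j v) x

/-- The regularised length `|p|_ε = √(ε² + |p|²)`. -/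
def regNorm {d : ℕ} (ε : ℝ) (p : EuclideanSpace ℝ (Fin d)) : ℝ := √(ε ^ 2 + ‖p‖ ^ 2)

/-- The penalty `V_ε(s) = ε⁻¹ (φ(x) - s)_+^4 + ε⁻¹ (s - ψ(x))_+^4` at the point `x`. -/
def penalty {d : ℕ} (ε : ℝ) (φ ψ : EuclideanSpace ℝ (Fin d) → ℝ)
    (x : EuclideanSpace ℝ (Fin d)) (s : ℝ) : ℝ :=
  1 / ε * (max (φ x - s) 0) ^ 4 + 1 / ε * (max (s - ψ x) 0) ^ 4

/-- The force `f_ε = - V_ε'(s)` at the point `x`. -/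
def force {d : ℕ} (ε : ℝ) (φ ψ : EuclideanSpace ℝ (Fin d) → ℝ)
    (x : EuclideanSpace ℝ (Fin d)) (s : ℝ) : ℝ :=
  4 / ε * (max (φ x - s) 0) ^ 3 - 4 / ε * (max (s - ψ x) 0) ^ 3

/-- `H_ε = - div (∇v / |∇v|_ε)`. -/
def regCurvature {d : ℕ} (ε : ℝ) (v : EuclideanSpace ℝ (Fin d) → ℝ)
    (x : EuclideanSpace ℝ (Fin d)) : ℝ :=
  - ∑ i, pderiv i (fun y => (∇ v y) i / regNorm ε (∇ v y)) x

/-- `u` is a classical solution (of class `C^{2,1}` for positive times, continuous up to the initial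
time) on `𝕋^d × [0,∞)` of
`∂_t u = (δ_{ij} - ∂_i u ∂_j u / |∇u|_ε²) ∂_{ij} u + |∇u|_ε f_ε`, `u(·,0) = g`. -/
structure IsClassicalSolution {d : ℕ} (ε : ℝ) (φ ψ g : EuclideanSpace ℝ (Fin d) → ℝ)
    (u : EuclideanSpace ℝ (Fin d) → ℝ → ℝ) : Prop where
  periodic : ∀ t, 0 ≤ t → IsPeriodic (fun x => u x t)
  continuousOn : ContinuousOn (fun p : EuclideanSpace ℝ (Fin d) × ℝ => u p.1 p.2)
    (univ ×ˢ Ici 0)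
  contDiff_space : ∀ t, 0 < t → ContDiff ℝ 2 (fun x => u x t)
  differentiableAt_time : ∀ x t, 0 < t → DifferentiableAt ℝ (u x) t
  continuousOn_pderiv : ∀ i, ContinuousOn
    (fun p : EuclideanSpace ℝ (Fin d) × ℝ => pderiv i (fun y => u y p.2) p.1) (univ ×ˢ Ioi 0)
  continuousOn_pderiv₂ : ∀ i j, ContinuousOn
    (fun p : EuclideanSpace ℝ (Fin d) × ℝ => pderiv i (pderiv j (fun y => u y p.2)) p.1)
    (univ ×ˢ Ioi 0)
  continuousOn_deriv : ContinuousOn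
    (fun p : EuclideanSpace ℝ (Fin d) × ℝ => deriv (u p.1) p.2) (univ ×ˢ Ioi 0)
  equation : ∀ x t, 0 < t →
    deriv (u x) t =
      projectedHessianTrace (∇ (fun y => u y t) x) (regNorm ε (∇ (fun y => u y t) x) ^ 2)
          (fun y => u y t) x
        + regNorm ε (∇ (fun y => u y t) x) * force ε φ ψ x (u x t)
  initial : ∀ x, u x 0 = g x

/-- Bounded continuous functions on `𝕋^d × [0,∞)` that respect the obstacles. -/
structure IsAdmissible {d : ℕ} (φ ψ : EuclideanSpace ℝ (Fin d) → ℝ)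
    (u : EuclideanSpace ℝ (Fin d) → ℝ → ℝ) : Prop where
  periodic : ∀ t, 0 ≤ t → IsPeriodic (fun x => u x t)
  continuousOn : ContinuousOn (fun p : EuclideanSpace ℝ (Fin d) × ℝ => u p.1 p.2)
    (univ ×ˢ Ici 0)
  bounded : ∃ M : ℝ, ∀ x t, 0 ≤ t → |u x t| ≤ M
  obstacles : ∀ x t, 0 ≤ t → φ x ≤ u x t ∧ u x t ≤ ψ x

/-- Viscosity subsolutions of the level set mean curvature flow with obstacles `φ` and `ψ`. -/
def IsViscositySubsolution {d : ℕ} (φ ψ : EuclideanSpace ℝ (Fin d) → ℝ)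
    (u : EuclideanSpace ℝ (Fin d) → ℝ → ℝ) : Prop :=
  IsAdmissible φ ψ u ∧
  ∀ η : EuclideanSpace ℝ (Fin d) × ℝ → ℝ, ContDiff ℝ ∞ η →
    ∀ (x₀ : EuclideanSpace ℝ (Fin d)) (t₀ : ℝ), 0 < t₀ →
      IsLocalMax (fun p : EuclideanSpace ℝ (Fin d) × ℝ => u p.1 p.2 - η p) (x₀, t₀) →
      φ x₀ < u x₀ t₀ →
      (∇ (fun y => η (y, t₀)) x₀ ≠ 0 →
        deriv (fun s => η (x₀, s)) t₀ ≤
          projectedHessianTrace (∇ (fun y => η (y, t₀)) x₀) (‖∇ (fun y => η (y, t₀)) x₀‖ ^ 2)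
            (fun y => η (y, t₀)) x₀) ∧
      (∇ (fun y => η (y, t₀)) x₀ = 0 →
        ∃ ζ : EuclideanSpace ℝ (Fin d), ‖ζ‖ ≤ 1 ∧
          deriv (fun s => η (x₀, s)) t₀ ≤
            projectedHessianTrace ζ 1 (fun y => η (y, t₀)) x₀)

/-- Viscosity supersolutions of the level set mean curvature flow with obstacles `φ` and `ψ`. -/
def IsViscositySupersolution {d : ℕ} (φ ψ : EuclideanSpace ℝ (Fin d) → ℝ)
    (u : EuclideanSpace ℝ (Fin d) → ℝ → ℝ) : Prop :=
  IsAdmissible φ ψ u ∧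
  ∀ η : EuclideanSpace ℝ (Fin d) × ℝ → ℝ, ContDiff ℝ ∞ η →
    ∀ (x₀ : EuclideanSpace ℝ (Fin d)) (t₀ : ℝ), 0 < t₀ →
      IsLocalMin (fun p : EuclideanSpace ℝ (Fin d) × ℝ => u p.1 p.2 - η p) (x₀, t₀) →
      u x₀ t₀ < ψ x₀ →
      (∇ (fun y => η (y, t₀)) x₀ ≠ 0 →
        projectedHessianTrace (∇ (fun y => η (y, t₀)) x₀) (‖∇ (fun y => η (y, t₀)) x₀‖ ^ 2)
            (fun y => η (y, t₀)) x₀ ≤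
          deriv (fun s => η (x₀, s)) t₀) ∧
      (∇ (fun y => η (y, t₀)) x₀ = 0 →
        ∃ ζ : EuclideanSpace ℝ (Fin d), ‖ζ‖ ≤ 1 ∧
          projectedHessianTrace ζ 1 (fun y => η (y, t₀)) x₀ ≤
            deriv (fun s => η (x₀, s)) t₀)

/-- Viscosity solutions with initial datum `g`. -/
def IsViscositySolution {d : ℕ} (φ ψ g : EuclideanSpace ℝ (Fin d) → ℝ)
    (u : EuclideanSpace ℝ (Fin d) → ℝ → ℝ) : Prop :=
  IsViscositySubsolution φ ψ u ∧ IsViscositySupersolution φ ψ u ∧ ∀ x, u x 0 = g x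

/-- `G ∈ L^∞(𝕋^d; ℝ^d)` is the weak gradient of `v ∈ L^∞(𝕋^d)`. -/
structure IsWeakGradient {d : ℕ} (v : EuclideanSpace ℝ (Fin d) → ℝ)
    (G : EuclideanSpace ℝ (Fin d) → EuclideanSpace ℝ (Fin d)) : Prop where
  memLp_fun : MemLp v ⊤ (volume.restrict (cube d))
  memLp_grad : MemLp G ⊤ (volume.restrict (cube d))
  parts : ∀ ζ : EuclideanSpace ℝ (Fin d) → ℝ, ContDiff ℝ ∞ ζ → IsPeriodic ζ → ∀ i,
    ∫ x in cube d, v x * pderiv i ζ x = - ∫ x in cube d, G x i * ζ x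

/-- `v ∈ W^{1,∞}(𝕋^d)` (continuous representative). -/
def MemW1Infty {d : ℕ} (v : EuclideanSpace ℝ (Fin d) → ℝ) : Prop :=
  IsPeriodic v ∧ Continuous v ∧ ∃ G, IsWeakGradient v G

open Classical in
/-- The weak gradient of `v`, unique up to null sets of the cube (`0` if there is none). -/
def weakGradient {d : ℕ} (v : EuclideanSpace ℝ (Fin d) → ℝ) :
    EuclideanSpace ℝ (Fin d) → EuclideanSpace ℝ (Fin d) :=
  if h : ∃ G, IsWeakGradient v G then h.choose else 0

/-- `E_ε(v) = ∫_Ω |∇v|_ε + V_ε(v) dx`, for `v ∈ W^{1,∞}`. -/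
def regEnergy {d : ℕ} (ε : ℝ) (φ ψ : EuclideanSpace ℝ (Fin d) → ℝ)
    (v : EuclideanSpace ℝ (Fin d) → ℝ) : ℝ≥0∞ :=
  ∫⁻ x in cube d, ENNReal.ofReal (regNorm ε (weakGradient v x) + penalty ε φ ψ x (v x))

open Classical in
/-- The limit energy: `E(v) = ∫_Ω |∇v| dx` if `φ ≤ v ≤ ψ`, and `+∞` otherwise, for
`v ∈ W^{1,∞}`. -/
def limitEnergy {d : ℕ} (φ ψ : EuclideanSpace ℝ (Fin d) → ℝ)
    (v : EuclideanSpace ℝ (Fin d) → ℝ) : ℝ≥0∞ :=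
  if ∀ x, φ x ≤ v x ∧ v x ≤ ψ x then ∫⁻ x in cube d, ‖weakGradient v x‖ₑ else ⊤

/-- `w i` is a recovery sequence for `w`: functions in `W^{1,∞}(𝕋^d)` that converge uniformly to `w`
and satisfy `limsup F_i(w_i) ≤ F(w)`. -/
def IsRecoverySequence {d : ℕ} (F : ℕ → (EuclideanSpace ℝ (Fin d) → ℝ) → ℝ≥0∞)
    (F₀ : (EuclideanSpace ℝ (Fin d) → ℝ) → ℝ≥0∞)
    (w : ℕ → EuclideanSpace ℝ (Fin d) → ℝ) (w₀ : EuclideanSpace ℝ (Fin d) → ℝ) : Prop :=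
  (∀ i, MemW1Infty (w i)) ∧ TendstoUniformly w w₀ atTop ∧
    limsup (fun i => F i (w i)) atTop ≤ F₀ w₀

/-- `Γ`-convergence on `W^{1,∞}(𝕋^d)` with respect to uniform convergence. -/
def GammaConverges {d : ℕ} (F : ℕ → (EuclideanSpace ℝ (Fin d) → ℝ) → ℝ≥0∞)
    (F₀ : (EuclideanSpace ℝ (Fin d) → ℝ) → ℝ≥0∞) : Prop :=
  (∀ (w : ℕ → EuclideanSpace ℝ (Fin d) → ℝ) (w₀ : EuclideanSpace ℝ (Fin d) → ℝ),
    (∀ i, MemW1Infty (w i)) → MemW1Infty w₀ → TendstoUniformly w w₀ atTop →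
      F₀ w₀ ≤ liminf (fun i => F i (w i)) atTop) ∧
  ∀ w₀ : EuclideanSpace ℝ (Fin d) → ℝ, MemW1Infty w₀ → ∃ w, IsRecoverySequence F F₀ w w₀

/-- Smooth test functions on `𝕋^d × (0,T)` with compact support. -/
def IsTestFunction {d : ℕ} (T : ℝ) (ζ : EuclideanSpace ℝ (Fin d) × ℝ → ℝ) : Prop :=
  ContDiff ℝ ∞ ζ ∧ (∀ t, IsPeriodic (fun x => ζ (x, t))) ∧
    ∃ a b : ℝ, 0 < a ∧ b < T ∧ ∀ x t, t ∉ Set.Icc a b → ζ (x, t) = 0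

/-- `G` is the weak spatial gradient and `h` the weak time derivative of `u` on `𝕋^d × (0,T)`, and
`u`, `G`, `h` belong to `L^∞`; that is, `u ∈ W^{1,∞}(𝕋^d × (0,T))` with these derivatives. -/
structure HasWeakDerivatives {d : ℕ} (T : ℝ) (u : EuclideanSpace ℝ (Fin d) → ℝ → ℝ)
    (G : EuclideanSpace ℝ (Fin d) × ℝ → EuclideanSpace ℝ (Fin d))
    (h : EuclideanSpace ℝ (Fin d) × ℝ → ℝ) : Prop where
  memLp_fun : MemLp (fun p : EuclideanSpace ℝ (Fin d) × ℝ => u p.1 p.2) ⊤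
    (volume.restrict (cylinder d T))
  memLp_grad : MemLp G ⊤ (volume.restrict (cylinder d T))
  memLp_time : MemLp h ⊤ (volume.restrict (cylinder d T))
  parts_space : ∀ ζ, IsTestFunction T ζ → ∀ i,
    ∫ p in cylinder d T, u p.1 p.2 * pderiv i (fun y => ζ (y, p.2)) p.1
      = - ∫ p in cylinder d T, G p i * ζ p
  parts_time : ∀ ζ, IsTestFunction T ζ →
    ∫ p in cylinder d T, u p.1 p.2 * deriv (fun s => ζ (p.1, s)) p.2
      = - ∫ p in cylinder d T, h p * ζ p

/-- Weak-`*` convergence in `L^∞(𝕋^d × (0,T); ℝ^d)`, tested with `L^1`. -/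
def WeakStarTendsto {d : ℕ} (T : ℝ)
    (G : ℕ → EuclideanSpace ℝ (Fin d) × ℝ → EuclideanSpace ℝ (Fin d))
    (G₀ : EuclideanSpace ℝ (Fin d) × ℝ → EuclideanSpace ℝ (Fin d)) : Prop :=
  (∀ k, MemLp (G k) ⊤ (volume.restrict (cylinder d T))) ∧
  MemLp G₀ ⊤ (volume.restrict (cylinder d T)) ∧
  ∀ η : EuclideanSpace ℝ (Fin d) × ℝ → EuclideanSpace ℝ (Fin d),
    Integrable η (volume.restrict (cylinder d T)) →
      Tendsto (fun k => ∫ p in cylinder d T, inner ℝ (G k p) (η p)) atTop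
        (𝓝 (∫ p in cylinder d T, inner ℝ (G₀ p) (η p)))

end

end ObstacleMCF

open ObstacleMCF

/-! The proof has three largely independent mechanisms.

Limit and uniqueness. The equation is invariant under translations except through the obstacles, and
the force is nonincreasing in the value. Comparing a classical solution with its own space and time
translates (`IsClassicalSolution.shift_le`) and with barriers such as `g + C t`
(`IsClassicalSolution.le_barrier`) gives sup and Lipschitz bounds that do not depend on `ε`, hence a
uniform limit along a subsequence. A quartic barrier below `φ` shows that the penalised solutions
leave the obstacles by an arbitrarily small amount (`exists_lower_obstacle_bound`), and perturbed
test functions show that the limit is a viscosity solution (`isViscositySubsolution_of_tendsto`).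
Uniqueness never compares two viscosity solutions with each other. A subsolution starting from `g`
lies below every classical approximation up to an error vanishing with `ε`
(`exists_subsolution_le`). This is a doubling of variables in which one function is smooth, so its
own Taylor polynomial serves as test function and no theorem on sums is needed. The doubling uses a
fourth power because its Hessian vanishes wherever its gradient does, which tames the singularity of
the operator at zero gradient. Reflection `u ↦ -u` exchanges the obstacles and gives the opposite
inequality, so every viscosity solution equals the limit.

`Γ`-convergence. The lower bound is duality with smooth periodic fields of length at most one when
the limit respects the obstacles, and blow-up of the penalty when it does not. Constant sequences
are recovery sequences.

Energies along the flow. Write `speed = -H_ε + f_ε`. Convexity of `|·|_ε` and of the penalty, with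
the limit as competitor, bounds the energy of `u_ε(t)` by that of `u(t)` plus `ε` plus the uniform
distance times the `L¹` norm of the speed (`regEnergy_le_of_speed`). So it suffices that this norm
does not exceed its value at `g` (`IsClassicalSolution.integral_abs_speed_le`). Formally this is the
`L¹` contraction of an accretive operator. With `V = ∂_t u` and `A = 1 / |∇u|_ε` the equation says
`A V = speed`, and testing the time derivative with `sign V` should give `d/dt ∫ A |V| ≤ 0`. Neither
`A` nor `V` is known to be differentiable in time, so the computation is done on difference
quotients, with `A` replaced by its time mean. Strong monotonicity of `p ↦ p / |p|_ε` makes the time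
oscillation of `A` quadratically small (`WeightedFlow.timeOsc_le`), which controls all errors. A
separate comparison with the stationary profile `g` supplies the value at time zero, where the
solution is only continuous. These last estimates use constants that blow up as `ε → 0`, but at
fixed `ε` they disappear in the limit of small time steps and smoothing parameters. -/

namespace ObstacleMCF

variable {d : ℕ}

/-- The ambient space `ℝ^d` of the periodic functions. -/
abbrev Space (d : ℕ) : Type := EuclideanSpace ℝ (Fin d)

/-! ### Partial derivatives and the Hessian quadratic form -/

theorem gradient_apply_eq_pderiv (v : Space d → ℝ) (x : Space d) (i : Fin d) :
    (∇ v x) i = pderiv i v x := by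
  have h := inner_gradient_left (𝕜 := ℝ) (f := v) (x := x) (y := EuclideanSpace.single i (1 : ℝ))
  rw [EuclideanSpace.inner_single_right] at h
  simpa [pderiv] using h

theorem sum_smul_single (ξ : Space d) : ∑ i, ξ i • EuclideanSpace.single i (1 : ℝ) = ξ := by
  ext j
  simp [Finset.sum_apply, Pi.single_apply]

theorem fderiv_apply_eq_sum (v : Space d → ℝ) (x ξ : Space d) :
    fderiv ℝ v x ξ = ∑ i, ξ i * pderiv i v x := by
  conv_lhs => rw [← sum_smul_single ξ]
  simp [map_sum, pderiv]

theorem contDiff_pderiv {v : Space d → ℝ} {n m : WithTop ℕ∞} (hv : ContDiff ℝ n v) (h : m + 1 ≤ n)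
    (i : Fin d) : ContDiff ℝ m (pderiv i v) :=
  (hv.fderiv_right h).clm_apply contDiff_const

theorem contDiff_one_pderiv {v : Space d → ℝ} (hv : ContDiff ℝ 2 v) (i : Fin d) :
    ContDiff ℝ 1 (pderiv i v) :=
  contDiff_pderiv hv (by norm_num) i

theorem contDiff_pderiv_infty {v : Space d → ℝ} (hv : ContDiff ℝ ∞ v) (i : Fin d) :
    ContDiff ℝ ∞ (pderiv i v) :=
  contDiff_pderiv hv (by norm_num) i

theorem pderiv_sub {v w : Space d → ℝ} {x : Space d} (hv : DifferentiableAt ℝ v x)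
    (hw : DifferentiableAt ℝ w x) (i : Fin d) :
    pderiv i (fun y => v y - w y) x = pderiv i v x - pderiv i w x := by
  simp only [pderiv]
  rw [fderiv_fun_sub hv hw]; rfl

theorem pderiv_add {v w : Space d → ℝ} {x : Space d} (hv : DifferentiableAt ℝ v x)
    (hw : DifferentiableAt ℝ w x) (i : Fin d) :
    pderiv i (fun y => v y + w y) x = pderiv i v x + pderiv i w x := by
  simp only [pderiv]
  rw [fderiv_fun_add hv hw]; rfl

theorem pderiv_mul {v w : Space d → ℝ} {x : Space d} (hv : DifferentiableAt ℝ v x)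
    (hw : DifferentiableAt ℝ w x) (i : Fin d) :
    pderiv i (fun y => v y * w y) x = v x * pderiv i w x + w x * pderiv i v x := by
  simp only [pderiv]
  rw [fderiv_fun_mul hv hw]; rfl

theorem pderiv_neg (v : Space d → ℝ) (x : Space d) (i : Fin d) :
    pderiv i (fun y => - v y) x = - pderiv i v x := by
  simp only [pderiv]
  rw [fderiv_fun_neg]; rfl

theorem pderiv_comp_add (v : Space d → ℝ) (h x : Space d) (i : Fin d) :
    pderiv i (fun y => v (y + h)) x = pderiv i v (x + h) := by
  simp only [pderiv]
  rw [fderiv_comp_add_right]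

theorem gradient_eq_of_pderiv {v w : Space d → ℝ} {x y : Space d}
    (h : ∀ i, pderiv i v x = pderiv i w y) : ∇ v x = ∇ w y := by
  ext i
  rw [gradient_apply_eq_pderiv, gradient_apply_eq_pderiv, h]

theorem gradient_comp_add (v : Space d → ℝ) (h x : Space d) :
    ∇ (fun y => v (y + h)) x = ∇ v (x + h) :=
  gradient_eq_of_pderiv fun i => pderiv_comp_add v h x i

theorem gradient_neg' (v : Space d → ℝ) (x : Space d) :
    ∇ (fun y => - v y) x = - ∇ v x := by
  ext i
  rw [gradient_apply_eq_pderiv, pderiv_neg, PiLp.neg_apply, gradient_apply_eq_pderiv]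

theorem continuous_gradient {v : Space d → ℝ} (hv : ContDiff ℝ 1 v) : Continuous (fun x => ∇ v x) :=
  (InnerProductSpace.toDual ℝ (Space d)).symm.continuous.comp (hv.continuous_fderiv one_ne_zero)

/-- The quadratic form of the matrix of second partial derivatives. -/
noncomputable def hessForm (v : Space d → ℝ) (x ξ : Space d) : ℝ :=
  ∑ i, ∑ j, ξ i * ξ j * pderiv i (pderiv j v) x

theorem hasDerivAt_line {v : Space d → ℝ} (hv : Differentiable ℝ v) (x ξ : Space d) (h : ℝ) :
    HasDerivAt (fun h : ℝ => v (x + h • ξ)) (∑ i, ξ i * pderiv i v (x + h • ξ)) h := by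
  have h1 : HasDerivAt (fun h : ℝ => x + h • ξ) ξ h := by
    simpa using ((hasDerivAt_id h).smul_const ξ).const_add x
  have h2 := (hv (x + h • ξ)).hasFDerivAt.comp_hasDerivAt h h1
  rwa [fderiv_apply_eq_sum] at h2

theorem hasDerivAt_line₂ {v : Space d → ℝ} (hv : ContDiff ℝ 2 v) (x ξ : Space d) (h : ℝ) :
    HasDerivAt (fun h : ℝ => ∑ i, ξ i * pderiv i v (x + h • ξ)) (hessForm v (x + h • ξ) ξ) h := by
  have : hessForm v (x + h • ξ) ξ
      = ∑ j, ξ j * ∑ i, ξ i * pderiv i (pderiv j v) (x + h • ξ) := by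
    rw [hessForm, Finset.sum_comm]
    refine Finset.sum_congr rfl fun j _ => ?_
    rw [Finset.mul_sum]
    exact Finset.sum_congr rfl fun i _ => by ring
  rw [this]
  refine HasDerivAt.fun_sum fun j _ => ?_
  exact (hasDerivAt_line ((contDiff_one_pderiv hv j).differentiable one_ne_zero) x ξ h).const_mul _

/-- The necessary second order condition at a local maximum. -/
theorem nonpos_second_deriv_of_isLocalMax {f f' : ℝ → ℝ} {c a : ℝ} (hf : ∀ h, HasDerivAt f (f' h) h)
    (hf' : HasDerivAt f' c a) (hmax : IsLocalMax f a) : c ≤ 0 := by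
  by_contra! hc
  have hd : deriv f = f' := funext fun h => (hf h).deriv
  -- If the second derivative were positive, the point would also be a local minimum, so the
  -- function would be locally constant and its second derivative zero.
  have hmin : IsLocalMin f a :=
    isLocalMin_of_deriv_deriv_pos (by rw [hd, hf'.deriv]; exact hc) hmax.deriv_eq_zero
      (hf a).continuousAt
  have hconst : f =ᶠ[𝓝 a] fun _ => f a := by
    filter_upwards [hmax, hmin] with x h1 h2 using le_antisymm h1 h2
  have h0 : deriv f =ᶠ[𝓝 a] fun _ => 0 := by
    have := hconst.deriv
    simpa using this
  rw [hd] at h0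
  have := (h0.deriv_eq (x := a)).symm.trans hf'.deriv
  simp at this
  exact hc.ne this

theorem isLocalMax_comp_line {v : Space d → ℝ} {x : Space d} (h : IsLocalMax v x) (ξ : Space d) :
    IsLocalMax (fun s : ℝ => v (x + s • ξ)) 0 := by
  have hc : Tendsto (fun s : ℝ => x + s • ξ) (𝓝 0) (𝓝 x) := by
    have : Continuous (fun s : ℝ => x + s • ξ) := by fun_prop
    simpa using this.tendsto 0
  have := hc.eventually h
  simpa [IsLocalMax, IsMaxFilter] using this

theorem hessForm_nonpos_of_isLocalMax {v : Space d → ℝ} (hv : ContDiff ℝ 2 v) {x : Space d}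
    (hmax : IsLocalMax v x) (ξ : Space d) : hessForm v x ξ ≤ 0 := by
  have := nonpos_second_deriv_of_isLocalMax (hasDerivAt_line (hv.differentiable two_ne_zero) x ξ)
    (hasDerivAt_line₂ hv x ξ 0) (isLocalMax_comp_line hmax ξ)
  simpa using this

theorem hessForm_sub {v w : Space d → ℝ} (hv : ContDiff ℝ 2 v) (hw : ContDiff ℝ 2 w)
    (x ξ : Space d) : hessForm (fun y => v y - w y) x ξ = hessForm v x ξ - hessForm w x ξ := by
  have key : ∀ j, pderiv j (fun y => v y - w y) = fun y => pderiv j v y - pderiv j w y :=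
    fun j => funext fun y => pderiv_sub (hv.differentiable two_ne_zero y)
      (hw.differentiable two_ne_zero y) j
  simp only [hessForm, key, ← Finset.sum_sub_distrib]
  refine Finset.sum_congr rfl fun i _ => Finset.sum_congr rfl fun j _ => ?_
  rw [pderiv_sub ((contDiff_one_pderiv hv j).differentiable one_ne_zero x)
    ((contDiff_one_pderiv hw j).differentiable one_ne_zero x)]
  ring

theorem sum_sq_eq_norm_sq (q : Space d) : ∑ i, q i * q i = ‖q‖ ^ 2 := by
  rw [EuclideanSpace.real_norm_sq_eq]
  exact Finset.sum_congr rfl fun i _ => by ring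

/-- The coefficient `λ` for which `(I - λ q qᵀ)² = I - q qᵀ / s`. -/
theorem exists_projection_root {N s : ℝ} (hs : 0 < s) (hN : N ≤ s) :
    ∃ l : ℝ, 2 * l - l ^ 2 * N = 1 / s := by
  have hr : 0 ≤ s * (s - N) := mul_nonneg hs.le (by linarith)
  have hsq : √(s * (s - N)) ^ 2 = s * (s - N) := Real.sq_sqrt hr
  set r := √(s * (s - N))
  have hr0 : 0 ≤ r := Real.sqrt_nonneg _
  -- The smaller root of `N l² - 2 l + 1/s = 0`, rationalised so that it still makes sense when `N =
  -- 0`.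
  refine ⟨1 / (s + r), ?_⟩
  have : s + r ≠ 0 := by positivity
  field_simp
  nlinarith

/-- `I - q qᵀ / s` is the square of the symmetric matrix `I - l q qᵀ`, so the trace is the sum of
the Hessian form over the rows of the root. This turns inequalities between quadratic forms into
inequalities between curvature operators. -/
theorem projectedHessianTrace_eq_sum_hessForm {q : Space d} {s l : ℝ}
    (hl : 2 * l - l ^ 2 * ‖q‖ ^ 2 = 1 / s) (v : Space d → ℝ) (x : Space d) :
    projectedHessianTrace q s v x
      = ∑ k, hessForm v x (WithLp.toLp 2 fun i => (if k = i then 1 else 0) - l * (q k * q i)) := by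
  simp only [projectedHessianTrace, hessForm]
  rw [Finset.sum_comm (s := Finset.univ (α := Fin d))]
  conv_rhs => rw [Finset.sum_comm]
  rw [Finset.sum_comm]
  refine Finset.sum_congr rfl fun i _ => ?_
  conv_rhs => rw [Finset.sum_comm]
  refine Finset.sum_congr rfl fun j _ => ?_
  rw [← Finset.sum_mul]
  congr 1
  have h1 : ∀ k : Fin d, ((if k = i then (1 : ℝ) else 0) - l * (q k * q i))
      * ((if k = j then 1 else 0) - l * (q k * q j))
      = (if k = i then (if i = j then (1 : ℝ) else 0) else 0)
        - (if k = i then l * (q i * q j) else 0) - (if k = j then l * (q i * q j) else 0)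
        + l ^ 2 * (q i * q j) * (q k * q k) := by
    intro k
    by_cases hki : k = i
    · subst hki
      by_cases hkj : k = j <;> simp [hkj] <;> ring
    · by_cases hkj : k = j
      · subst hkj; simp [hki]; ring
      · simp [hki, hkj]; ring
  simp only [h1]
  rw [Finset.sum_add_distrib, Finset.sum_sub_distrib, Finset.sum_sub_distrib, ← Finset.mul_sum,
    sum_sq_eq_norm_sq]
  simp only [Finset.sum_ite_eq', Finset.mem_univ, if_true]
  have : q i * q j / s = q i * q j * (1 / s) := by ring
  rw [this, ← hl]; ring

/-- Degenerate ellipticity. The condition `‖q‖² ≤ s` is what makes the coefficient matrix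
nonnegative; it covers both the regularised operator and a general direction in the unit ball. -/
theorem projectedHessianTrace_le {q : Space d} {s : ℝ} (hs : 0 < s) (hq : ‖q‖ ^ 2 ≤ s)
    {v w : Space d → ℝ} {x y : Space d} (h : ∀ ξ, hessForm v x ξ ≤ hessForm w y ξ) :
    projectedHessianTrace q s v x ≤ projectedHessianTrace q s w y := by
  obtain ⟨l, hl⟩ := exists_projection_root hs hq
  rw [projectedHessianTrace_eq_sum_hessForm hl, projectedHessianTrace_eq_sum_hessForm hl]
  exact Finset.sum_le_sum fun k _ => h _

/-- First and second order conditions at a local maximum of a difference. -/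
theorem isLocalMax_sub_conditions {v w : Space d → ℝ} (hv : ContDiff ℝ 2 v) (hw : ContDiff ℝ 2 w)
    {x : Space d} (hmax : IsLocalMax (fun y => v y - w y) x) :
    ∇ v x = ∇ w x ∧ ∀ ξ, hessForm v x ξ ≤ hessForm w x ξ := by
  constructor
  · refine gradient_eq_of_pderiv fun i => ?_
    have h := hmax.fderiv_eq_zero
    have h2 := pderiv_sub (hv.differentiable two_ne_zero x) (hw.differentiable two_ne_zero x) i
    rw [pderiv, h] at h2
    simp at h2
    linarith
  · intro ξ
    have := hessForm_nonpos_of_isLocalMax (hv.sub hw) hmax ξ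
    have h2 := hessForm_sub hv hw x ξ
    have h3 : hessForm (v - w) x ξ = hessForm (fun y => v y - w y) x ξ := rfl
    linarith

theorem projectedHessianTrace_comp_add (q : Space d) (s : ℝ) (v : Space d → ℝ) (h x : Space d) :
    projectedHessianTrace q s (fun y => v (y + h)) x = projectedHessianTrace q s v (x + h) := by
  have key : ∀ j, pderiv j (fun y => v (y + h)) = fun y => pderiv j v (y + h) :=
    fun j => funext fun y => pderiv_comp_add v h y j
  simp only [projectedHessianTrace, key, pderiv_comp_add]

theorem pderiv_pderiv_neg (v : Space d → ℝ) (x : Space d) (i j : Fin d) :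
    pderiv i (pderiv j fun y => - v y) x = - pderiv i (pderiv j v) x := by
  have key : pderiv j (fun y => - v y) = fun y => - pderiv j v y :=
    funext fun y => pderiv_neg v y j
  rw [key, pderiv_neg]

theorem projectedHessianTrace_neg (q : Space d) (s : ℝ) (v : Space d → ℝ) (x : Space d) :
    projectedHessianTrace q s (fun y => - v y) x = - projectedHessianTrace q s v x := by
  simp only [projectedHessianTrace, pderiv_pderiv_neg, ← Finset.sum_neg_distrib]
  exact Finset.sum_congr rfl fun i _ => Finset.sum_congr rfl fun j _ => by ring

theorem projectedHessianTrace_neg_left (q : Space d) (s : ℝ) (v : Space d → ℝ) (x : Space d) :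
    projectedHessianTrace (-q) s v x = projectedHessianTrace q s v x := by
  simp [projectedHessianTrace]

theorem projectedHessianTrace_eq_trace_sub (q : Space d) (s : ℝ) (v : Space d → ℝ) (x : Space d) :
    projectedHessianTrace q s v x = ∑ i, pderiv i (pderiv i v) x - hessForm v x q / s := by
  simp only [projectedHessianTrace, hessForm, sub_mul, Finset.sum_sub_distrib, Finset.sum_div]
  congr 1
  · simp
  · exact Finset.sum_congr rfl fun i _ => Finset.sum_congr rfl fun j _ => by ring

theorem hessForm_smul (c : ℝ) (v : Space d → ℝ) (x ξ : Space d) :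
    hessForm v x (c • ξ) = c ^ 2 * hessForm v x ξ := by
  simp only [hessForm, Finset.mul_sum]
  exact Finset.sum_congr rfl fun i _ => Finset.sum_congr rfl fun j _ => by simp; ring

/-! ### The regularised norm -/

theorem regNorm_pos {ε : ℝ} (hε : 0 < ε) (p : Space d) : 0 < regNorm ε p :=
  Real.sqrt_pos.2 (by positivity)

theorem regNorm_sq (ε : ℝ) (p : Space d) : regNorm ε p ^ 2 = ε ^ 2 + ‖p‖ ^ 2 :=
  Real.sq_sqrt (by positivity)

theorem norm_le_regNorm (ε : ℝ) (p : Space d) : ‖p‖ ≤ regNorm ε p :=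
  Real.le_sqrt_of_sq_le (by nlinarith [sq_nonneg ε])

theorem le_regNorm (ε : ℝ) (p : Space d) : ε ≤ regNorm ε p :=
  Real.le_sqrt_of_sq_le (by nlinarith [sq_nonneg ‖p‖])

theorem regNorm_le_add {ε : ℝ} (hε : 0 ≤ ε) (p : Space d) : regNorm ε p ≤ ε + ‖p‖ :=
  Real.sqrt_le_iff.2 ⟨by positivity, by nlinarith [norm_nonneg p]⟩

theorem norm_sq_le_regNorm_sq (ε : ℝ) (p : Space d) : ‖p‖ ^ 2 ≤ regNorm ε p ^ 2 := by
  rw [regNorm_sq]; nlinarith [sq_nonneg ε]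

theorem regNorm_neg (ε : ℝ) (p : Space d) : regNorm ε (-p) = regNorm ε p := by
  simp [regNorm]

theorem contDiff_regNorm {ε : ℝ} (hε : 0 < ε) {n : WithTop ℕ∞} :
    ContDiff ℝ n (regNorm (d := d) ε) := by
  unfold regNorm
  exact (contDiff_const.add (contDiff_norm_sq ℝ)).sqrt fun x => by positivity

theorem continuous_regNorm (ε : ℝ) : Continuous (regNorm (d := d) ε) := by
  unfold regNorm; fun_prop

/-! ### Second order Taylor bound -/

theorem abs_apply_le_norm (ξ : Space d) (i : Fin d) : |ξ i| ≤ ‖ξ‖ := by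
  simpa using PiLp.norm_apply_le ξ i

theorem hessForm_le_of_abs_sub_le {v w : Space d → ℝ} {x y : Space d} {δ : ℝ}
    (h : ∀ i j, |pderiv i (pderiv j v) x - pderiv i (pderiv j w) y| ≤ δ) (ξ : Space d) :
    hessForm v x ξ ≤ hessForm w y ξ + d ^ 2 * δ * ‖ξ‖ ^ 2 := by
  have key : hessForm v x ξ - hessForm w y ξ ≤ ∑ _i : Fin d, ∑ _j : Fin d, δ * ‖ξ‖ ^ 2 := by
    simp only [hessForm, ← Finset.sum_sub_distrib]
    refine Finset.sum_le_sum fun i _ => Finset.sum_le_sum fun j _ => ?_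
    rw [← mul_sub]
    calc ξ i * ξ j * (pderiv i (pderiv j v) x - pderiv i (pderiv j w) y)
        ≤ |ξ i * ξ j * (pderiv i (pderiv j v) x - pderiv i (pderiv j w) y)| := le_abs_self _
      _ = |ξ i| * |ξ j| * |pderiv i (pderiv j v) x - pderiv i (pderiv j w) y| := by
          rw [abs_mul, abs_mul]
      _ ≤ ‖ξ‖ * ‖ξ‖ * δ := by
          have := abs_apply_le_norm ξ i
          have := abs_apply_le_norm ξ j
          have := h i j
          gcongr
      _ = δ * ‖ξ‖ ^ 2 := by ring
  simp only [Finset.sum_const, Finset.card_univ, Fintype.card_fin, nsmul_eq_mul] at key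
  nlinarith [key]

/-- Two successive monotonicity arguments replace integration, so that the second derivative need
not be integrable. -/
theorem le_taylor_of_second_deriv_le {f f' f'' : ℝ → ℝ} {M : ℝ} (hf : ∀ h, HasDerivAt f (f' h) h)
    (hf' : ∀ h, HasDerivAt f' (f'' h) h) (hM : ∀ h ∈ Icc (0 : ℝ) 1, f'' h ≤ M) :
    f 1 ≤ f 0 + f' 0 + M / 2 := by
  have h1 : AntitoneOn (fun h => f' h - M * h) (Icc 0 1) := by
    have hd : ∀ h, HasDerivAt (fun h => f' h - M * h) (f'' h - M) h := fun h => by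
      simpa using (hf' h).fun_sub ((hasDerivAt_id' h).const_mul M)
    refine antitoneOn_of_deriv_nonpos (convex_Icc 0 1)
      (fun h _ => (hd h).continuousAt.continuousWithinAt)
      (fun h _ => (hd h).differentiableAt.differentiableWithinAt) fun h hh => ?_
    rw [(hd h).deriv]
    linarith [hM h (interior_subset hh)]
  have h2 : AntitoneOn (fun h => f h - f' 0 * h - M * h ^ 2 / 2) (Icc 0 1) := by
    have hd : ∀ h, HasDerivAt (fun h => f h - f' 0 * h - M * h ^ 2 / 2) (f' h - f' 0 - M * h) h := by
      intro h
      have := ((hf h).sub ((hasDerivAt_id h).const_mul (f' 0))).sub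
        ((((hasDerivAt_id h).pow 2).const_mul M).div_const 2)
      refine this.congr_deriv ?_
      simp; ring
    refine antitoneOn_of_deriv_nonpos (convex_Icc 0 1)
      (fun h _ => (hd h).continuousAt.continuousWithinAt)
      (fun h _ => (hd h).differentiableAt.differentiableWithinAt) fun h hh => ?_
    rw [(hd h).deriv]
    have := h1 (left_mem_Icc.2 zero_le_one) (interior_subset hh) (interior_subset hh).1
    simp at this
    linarith
  have := h2 (left_mem_Icc.2 zero_le_one) (right_mem_Icc.2 zero_le_one) zero_le_one
  simp at this
  linarith

/-- A one-sided expansion with a quadratic error instead of a little-o, so that the right-hand side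
is a polynomial in `ξ` and can be used as a smooth test function. -/
theorem eventually_le_taylor {v : Space d → ℝ} (hv : ContDiff ℝ 2 v) (x : Space d) {κ : ℝ}
    (hκ : 0 < κ) :
    ∀ᶠ ξ in 𝓝 (0 : Space d), v (x + ξ) ≤ v x + ∑ i, ξ i * pderiv i v x
      + (hessForm v x ξ + κ * ‖ξ‖ ^ 2) / 2 := by
  -- Each of the `d²` Hessian entries contributes at most `δ ‖ξ‖²`; the `+ 1` keeps the denominator
  -- positive.
  set δ := κ / (d ^ 2 + 1) with hδ
  have hδ0 : 0 < δ := by positivity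
  have hcont : ∀ i j, ∀ᶠ y in 𝓝 x,
      |pderiv i (pderiv j v) y - pderiv i (pderiv j v) x| ≤ δ := fun i j => by
    have hc : Continuous (pderiv i (pderiv j v)) :=
      (contDiff_pderiv (m := 0) (contDiff_one_pderiv hv j) (by norm_num) i).continuous
    have := Metric.tendsto_nhds.1 (hc.tendsto x) δ hδ0
    filter_upwards [this] with y hy using le_of_lt (by simpa [Real.dist_eq] using hy)
  have hall : ∀ᶠ y in 𝓝 x, ∀ i j, |pderiv i (pderiv j v) y - pderiv i (pderiv j v) x| ≤ δ :=
    eventually_all.2 fun i => eventually_all.2 fun j => hcont i j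
  obtain ⟨r, hr, hball⟩ := Metric.eventually_nhds_iff.1 hall
  filter_upwards [Metric.ball_mem_nhds (0 : Space d) hr] with ξ hξ
  rw [Metric.mem_ball, dist_zero_right] at hξ
  have := le_taylor_of_second_deriv_le (M := hessForm v x ξ + κ * ‖ξ‖ ^ 2)
    (hasDerivAt_line (hv.differentiable two_ne_zero) x ξ) (hasDerivAt_line₂ hv x ξ) ?_
  · simpa using this
  · intro h hh
    have hd : dist (x + h • ξ) x < r := by
      rw [dist_eq_norm, add_sub_cancel_left, norm_smul, Real.norm_of_nonneg hh.1]
      nlinarith [hh.1, hh.2, norm_nonneg ξ]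
    refine (hessForm_le_of_abs_sub_le (hball hd) ξ).trans ?_
    have : (d : ℝ) ^ 2 * δ ≤ κ := by
      rw [hδ, mul_div_assoc', div_le_iff₀ (by positivity)]; nlinarith
    gcongr

/-! ### The mean curvature operator -/

theorem contDiff_gradient {v : Space d → ℝ} (hv : ContDiff ℝ 2 v) :
    ContDiff ℝ 1 (fun x => ∇ v x) := by
  refine (InnerProductSpace.toDual ℝ (Space d)).symm.contDiff.comp (hv.fderiv_right ?_)
  norm_num

/-- The vector field `∇v / |∇v|_ε`. -/
noncomputable def regNormal (ε : ℝ) (p : Space d) : Space d := (regNorm ε p)⁻¹ • p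

theorem regNormal_apply (ε : ℝ) (p : Space d) (i : Fin d) :
    regNormal ε p i = p i / regNorm ε p := by
  simp [regNormal, div_eq_inv_mul]

theorem contDiff_regNormal_gradient {ε : ℝ} (hε : 0 < ε) {v : Space d → ℝ} (hv : ContDiff ℝ 2 v)
    (i : Fin d) : ContDiff ℝ 1 (fun x => (∇ v x) i / regNorm ε (∇ v x)) := by
  have h1 : ContDiff ℝ 1 (fun x => (∇ v x) i) := by
    simp_rw [gradient_apply_eq_pderiv]; exact contDiff_one_pderiv hv i
  exact h1.div ((contDiff_regNorm hε).comp (contDiff_gradient hv)) fun x => (regNorm_pos hε _).ne'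

/-- Passage from the divergence form, needed for integration by parts, to the nondivergence form of
the equation, needed for the maximum principle. -/
theorem regNorm_mul_regCurvature {ε : ℝ} (hε : 0 < ε) {v : Space d → ℝ} (hv : ContDiff ℝ 2 v)
    (x : Space d) :
    regNorm ε (∇ v x) * -regCurvature ε v x
      = projectedHessianTrace (∇ v x) (regNorm ε (∇ v x) ^ 2) v x := by
  set P : Space d → ℝ := fun y => regNorm ε (∇ v y) with hP
  have hPpos : ∀ y, 0 < P y := fun y => regNorm_pos hε _
  have hPd : Differentiable ℝ P :=
    ((contDiff_regNorm hε).comp (contDiff_gradient hv)).differentiable one_ne_zero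
  have hvd : ∀ j, Differentiable ℝ (pderiv j v) := fun j =>
    (contDiff_one_pderiv hv j).differentiable one_ne_zero
  have hsq : (fun y => P y * P y) = fun y => ε ^ 2 + ∑ j, pderiv j v y * pderiv j v y := by
    funext y
    rw [← sq, hP]
    simp only
    rw [regNorm_sq, ← sum_sq_eq_norm_sq]
    simp_rw [gradient_apply_eq_pderiv]
  -- Differentiating `P²` instead of `P` avoids the derivative of the square root; below, `(∂_i v /
  -- P) · P = ∂_i v` avoids the quotient rule in the same way.
  have hPi : ∀ i, P x * pderiv i P x = ∑ j, pderiv j v x * pderiv i (pderiv j v) x := by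
    intro i
    have h1 := pderiv_mul (hPd x) (hPd x) i
    rw [hsq] at h1
    have h2 : pderiv i (fun y => ε ^ 2 + ∑ j, pderiv j v y * pderiv j v y) x
        = ∑ j, 2 * (pderiv j v x * pderiv i (pderiv j v) x) := by
      have h3 : HasFDerivAt (fun y => ε ^ 2 + ∑ j, pderiv j v y * pderiv j v y)
          (∑ j, (pderiv j v x • fderiv ℝ (pderiv j v) x + pderiv j v x • fderiv ℝ (pderiv j v) x))
          x :=
        (HasFDerivAt.fun_sum fun j _ =>
          (hvd j x).hasFDerivAt.mul (hvd j x).hasFDerivAt).const_add _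
      rw [pderiv, h3.fderiv, sum_apply]
      refine Finset.sum_congr rfl fun j _ => ?_
      simp only [add_apply, smul_apply, smul_eq_mul]
      rw [← two_mul]; rfl
    rw [h2, ← Finset.mul_sum] at h1
    linarith
  have hν : ∀ i, P x * pderiv i (fun y => (∇ v y) i / P y) x
      = pderiv i (pderiv i v) x - pderiv i v x / P x ^ 2 * (P x * pderiv i P x) := by
    intro i
    have hd : DifferentiableAt ℝ (fun y => (∇ v y) i / P y) x :=
      (contDiff_regNormal_gradient hε hv i).differentiable one_ne_zero x
    have h1 := pderiv_mul hd (hPd x) i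
    have h2 : (fun y => (∇ v y) i / P y * P y) = pderiv i v := by
      funext y
      rw [div_mul_cancel₀ _ (hPpos y).ne', gradient_apply_eq_pderiv]
    rw [h2, gradient_apply_eq_pderiv] at h1
    have := (hPpos x).ne'
    rw [h1]
    field_simp
    ring
  rw [regCurvature, neg_neg, Finset.mul_sum]
  simp only [projectedHessianTrace]
  refine Finset.sum_congr rfl fun i _ => ?_
  rw [hν i, hPi i]
  simp only [sub_mul, Finset.sum_sub_distrib, ite_mul, one_mul, zero_mul, Finset.sum_ite_eq,
    Finset.mem_univ, if_true]
  congr 1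
  rw [Finset.mul_sum]
  refine Finset.sum_congr rfl fun j _ => ?_
  rw [gradient_apply_eq_pderiv, gradient_apply_eq_pderiv]
  ring

/-! ### Periodic functions -/

theorem exists_int_shift_mem_Icc (x : Space d) :
    ∃ k : Fin d → ℤ, x + WithLp.toLp 2 (fun i => (k i : ℝ)) ∈ cube d := by
  refine ⟨fun i => -⌊x i⌋, fun i => ?_⟩
  simp only [PiLp.add_apply, Int.cast_neg]
  exact ⟨by linarith [Int.floor_le (x i)], by linarith [Int.lt_floor_add_one (x i)]⟩

theorem isBounded_cube : Bornology.IsBounded (cube d) := by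
  refine (Metric.isBounded_iff_subset_closedBall 0).2 ⟨∑ _i : Fin d, 1, fun x hx => ?_⟩
  rw [mem_closedBall_zero_iff, ← sum_smul_single x]
  refine (norm_sum_le _ _).trans (Finset.sum_le_sum fun i _ => ?_)
  rw [norm_smul, PiLp.norm_single, norm_one, mul_one, Real.norm_eq_abs,
    abs_of_nonneg (hx i).1]
  exact (hx i).2.le

theorem isCompact_closure_cube : IsCompact (closure (cube d)) :=
  isBounded_cube.isCompact_closure

theorem IsPeriodic.exists_mem_closure_cube {α : Type*} {f : Space d → α} (hf : IsPeriodic f)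
    (x : Space d) : ∃ y ∈ closure (cube d), f y = f x := by
  obtain ⟨k, hk⟩ := exists_int_shift_mem_Icc x
  exact ⟨_, subset_closure hk, hf x k⟩

theorem IsPeriodic.exists_bound {f : Space d → ℝ} (hf : IsPeriodic f) (hc : Continuous f) :
    ∃ M, ∀ x, |f x| ≤ M := by
  obtain ⟨M, hM⟩ := isCompact_closure_cube.exists_bound_of_continuousOn hc.continuousOn
  refine ⟨M, fun x => ?_⟩
  obtain ⟨y, hy, hyx⟩ := hf.exists_mem_closure_cube x
  rw [← hyx]; exact hM y hy

theorem IsPeriodic.pderivative {v : Space d → ℝ} (hv : IsPeriodic v) (i : Fin d) :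
    IsPeriodic (pderiv i v) := fun x k => by
  rw [← pderiv_comp_add]
  congr 1
  funext y
  exact hv y k

theorem IsPeriodic.grad {v : Space d → ℝ} (hv : IsPeriodic v) :
    IsPeriodic (fun x => ∇ v x) := fun x k => gradient_eq_of_pderiv fun i => hv.pderivative i x k

theorem IsPeriodic.comp_add {α : Type*} {f : Space d → α} (hf : IsPeriodic f) (h : Space d) :
    IsPeriodic (fun x => f (x + h)) := fun x k => by
  have := hf (x + h) k
  rwa [add_right_comm] at this

theorem IsPeriodic.exists_lipschitz {v : Space d → ℝ} (hv : IsPeriodic v) (hc : ContDiff ℝ 1 v) :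
    ∃ L : ℝ, 0 ≤ L ∧ ∀ x y, |v x - v y| ≤ L * ‖x - y‖ := by
  obtain ⟨M, hM⟩ := isCompact_closure_cube.exists_bound_of_continuousOn
    (hc.continuous_fderiv one_ne_zero).continuousOn
  have hper : IsPeriodic (fun x => fderiv ℝ v x) := fun x k => by
    simp only
    rw [← fderiv_comp_add_right]
    congr 1
    funext y
    exact hv y k
  have hb : ∀ x, ‖fderiv ℝ v x‖ ≤ M := fun x => by
    obtain ⟨y, hy, hyx⟩ := hper.exists_mem_closure_cube x
    rw [← hyx]; exact hM y hy
  refine ⟨M, (norm_nonneg _).trans (hb 0), fun x y => ?_⟩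
  have := Convex.norm_image_sub_le_of_norm_fderiv_le (𝕜 := ℝ) (f := v) (s := univ) (C := M)
    (fun z _ => hc.differentiable one_ne_zero z) (fun z _ => hb z) convex_univ (mem_univ y)
    (mem_univ x)
  simpa using this

theorem IsPeriodic.exists_abs_hess_le {v : Space d → ℝ} (hv : IsPeriodic v) (hc : ContDiff ℝ 2 v) :
    ∃ M : ℝ, 0 ≤ M ∧ ∀ i j x, |pderiv i (pderiv j v) x| ≤ M := by
  have h : ∀ i j, ∃ M, ∀ x, |pderiv i (pderiv j v) x| ≤ M := fun i j =>
    ((hv.pderivative j).pderivative i).exists_bound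
      (contDiff_pderiv (m := 0) (contDiff_one_pderiv hc j) (by norm_num) i).continuous
  choose M hM using h
  refine ⟨∑ i, ∑ j, |M i j|, by positivity, fun i j x => ?_⟩
  calc _ ≤ M i j := hM i j x
    _ ≤ |M i j| := le_abs_self _
    _ ≤ ∑ j, |M i j| := Finset.single_le_sum (f := fun j => |M i j|) (fun j _ => abs_nonneg _)
      (Finset.mem_univ j)
    _ ≤ _ := Finset.single_le_sum (f := fun i => ∑ j, |M i j|)
      (fun i _ => Finset.sum_nonneg fun j _ => abs_nonneg _) (Finset.mem_univ i)

theorem abs_projectedHessianTrace_le {v : Space d → ℝ} {x : Space d} {M : ℝ}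
    (h : ∀ i j, |pderiv i (pderiv j v) x| ≤ M) {q : Space d} {s : ℝ} (hs : 0 < s)
    (hq : ‖q‖ ^ 2 ≤ s) : |projectedHessianTrace q s v x| ≤ d ^ 2 * (2 * M) := by
  rw [projectedHessianTrace]
  refine (Finset.abs_sum_le_sum_abs _ _).trans ?_
  have : ∀ i ∈ (Finset.univ : Finset (Fin d)), |∑ j, ((if i = j then 1 else 0) - q i * q j / s)
      * pderiv i (pderiv j v) x| ≤ ∑ _j : Fin d, 2 * M := fun i _ => by
    refine (Finset.abs_sum_le_sum_abs _ _).trans (Finset.sum_le_sum fun j _ => ?_)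
    rw [abs_mul]
    have h1 : |q i * q j / s| ≤ 1 := by
      rw [abs_div, abs_of_pos hs, div_le_one hs, abs_mul]
      have := abs_apply_le_norm q i
      have := abs_apply_le_norm q j
      calc |q i| * |q j| ≤ ‖q‖ * ‖q‖ := by gcongr
        _ ≤ s := by rw [← sq]; exact hq
    have h2 : |(if i = j then (1 : ℝ) else 0) - q i * q j / s| ≤ 2 := by
      refine (abs_sub _ _).trans ?_
      split_ifs <;> norm_num <;> linarith
    exact mul_le_mul h2 (h i j) (abs_nonneg _) (by norm_num)
  refine (Finset.sum_le_sum this).trans ?_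
  simp; ring_nf; rfl

/-! ### A parabolic maximum principle -/

theorem nonneg_deriv_of_le_left {f : ℝ → ℝ} {c a t : ℝ} (hat : a < t) (hf : HasDerivAt f c t)
    (h : ∀ s ∈ Ioo a t, f s ≤ f t) : 0 ≤ c := by
  have h1 : Tendsto (slope f t) (𝓝[<] t) (𝓝 c) := by
    have := (hasDerivAt_iff_tendsto_slope.1 hf)
    exact this.mono_left (nhdsWithin_mono _ fun s hs => ne_of_lt hs)
  refine ge_of_tendsto h1 ?_
  filter_upwards [Ioo_mem_nhdsLT hat] with s hs
  rw [slope_def_field]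
  exact div_nonneg_of_nonpos (by linarith [h s hs]) (by linarith [hs.2])

/-- Tilting by `δ t` makes the time derivative of `w` at least `δ` at the maximum, which contradicts
`hmax`. The hypothesis `hcpt` allows two ways of reaching a compact set: periodicity, or decay of a
barrier that is not periodic. -/
theorem nonpos_of_parabolic {w : Space d → ℝ → ℝ} {K : Set (Space d)} (hK : IsCompact K)
    (hc : ContinuousOn (fun p : Space d × ℝ => w p.1 p.2) (univ ×ˢ Ici 0))
    (hdiff : ∀ x t, 0 < t → DifferentiableAt ℝ (w x) t) (h0 : ∀ x, w x 0 ≤ 0)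
    (hcpt : ∀ x t, 0 ≤ t → 0 < w x t → ∃ x' ∈ K, w x t ≤ w x' t)
    (hmax : ∀ x t, 0 < t → 0 < w x t → (∀ y, w y t ≤ w x t) → deriv (w x) t ≤ 0) :
    ∀ x t, 0 ≤ t → w x t ≤ 0 := by
  intro x t ht
  by_contra! hpos
  obtain ⟨x₁, hx₁, hle⟩ := hcpt x t ht hpos
  have ht0 : 0 < t := lt_of_le_of_ne ht fun h => by
    rw [← h] at hpos; linarith [h0 x]
  -- The tilt costs half of the positive value, so the maximum of the tilted function stays
  -- positive.
  set δ := w x t / (2 * t) with hδ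
  have hδ0 : 0 < δ := by positivity
  have hδt : δ * t = w x t / 2 := by rw [hδ]; field_simp
  have hcF : ContinuousOn (fun p : Space d × ℝ => w p.1 p.2 - δ * p.2) (K ×ˢ Icc 0 t) :=
    (hc.mono (prod_mono (subset_univ _) fun s hs => hs.1)).sub (by fun_prop)
  obtain ⟨⟨x₀, t₀⟩, ⟨hx₀, ht₀⟩, hm⟩ := (hK.prod isCompact_Icc).exists_isMaxOn
    ⟨(x₁, t), hx₁, right_mem_Icc.2 ht⟩ hcF
  simp only at hx₀ ht₀
  have hge : ∀ y ∈ K, ∀ s ∈ Icc 0 t, w y s - δ * s ≤ w x₀ t₀ - δ * t₀ := fun y hy s hs =>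
    hm (a := (y, s)) ⟨hy, hs⟩
  have hw0 : 0 < w x₀ t₀ := by
    have := hge x₁ hx₁ t (right_mem_Icc.2 ht)
    nlinarith [ht₀.1]
  have ht₀pos : 0 < t₀ := lt_of_le_of_ne ht₀.1 fun h => by
    rw [← h] at hw0; linarith [h0 x₀]
  have hspace : ∀ y, w y t₀ ≤ w x₀ t₀ := by
    intro y
    by_cases hy : 0 < w y t₀
    · obtain ⟨y', hy', hyle⟩ := hcpt y t₀ ht₀.1 hy
      linarith [hge y' hy' t₀ ht₀]
    · linarith
  have h1 := hmax x₀ t₀ ht₀pos hw0 hspace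
  have h2 : HasDerivAt (fun s => w x₀ s - δ * s) (deriv (w x₀) t₀ - δ) t₀ := by
    simpa using (hdiff x₀ t₀ ht₀pos).hasDerivAt.fun_sub ((hasDerivAt_id' t₀).const_mul δ)
  have h3 := nonneg_deriv_of_le_left ht₀pos h2 fun s hs =>
    hge x₀ hx₀ s ⟨hs.1.le, hs.2.le.trans ht₀.2⟩
  linarith

/-! ### Monotonicity of the force -/

/-- The force is nonincreasing in the value. Two base points are allowed because translates of a
solution see translated obstacles. -/
theorem force_le_force {ε : ℝ} (hε : 0 < ε) {φ ψ : Space d → ℝ} {x y : Space d} {s r : ℝ}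
    (h1 : φ x - s ≤ φ y - r) (h2 : r - ψ y ≤ s - ψ x) : force ε φ ψ x s ≤ force ε φ ψ y r := by
  unfold force
  have a1 : max (φ x - s) 0 ≤ max (φ y - r) 0 := max_le_max_right 0 h1
  have a2 : max (r - ψ y) 0 ≤ max (s - ψ x) 0 := max_le_max_right 0 h2
  have b1 : max (φ x - s) 0 ^ 3 ≤ max (φ y - r) 0 ^ 3 := by gcongr
  have b2 : max (r - ψ y) 0 ^ 3 ≤ max (s - ψ x) 0 ^ 3 := by gcongr
  have c : 0 ≤ 4 / ε := by positivity
  nlinarith [mul_le_mul_of_nonneg_left b1 c, mul_le_mul_of_nonneg_left b2 c]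

theorem force_nonpos {ε : ℝ} (hε : 0 < ε) {φ ψ : Space d → ℝ} {x : Space d} {s : ℝ}
    (h : φ x ≤ s) : force ε φ ψ x s ≤ 0 := by
  unfold force
  rw [max_eq_right (by linarith : φ x - s ≤ 0)]
  have : 0 ≤ 4 / ε * max (s - ψ x) 0 ^ 3 := by positivity
  norm_num
  exact this

theorem force_nonneg {ε : ℝ} (hε : 0 < ε) {φ ψ : Space d → ℝ} {x : Space d} {s : ℝ}
    (h : s ≤ ψ x) : 0 ≤ force ε φ ψ x s := by
  unfold force
  rw [max_eq_right (by linarith : s - ψ x ≤ 0)]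
  have : 0 ≤ 4 / ε * max (φ x - s) 0 ^ 3 := by positivity
  norm_num
  exact this

theorem force_neg (ε : ℝ) (φ ψ : Space d → ℝ) (x : Space d) (s : ℝ) :
    force ε (fun y => - ψ y) (fun y => - φ y) x (-s) = - force ε φ ψ x s := by
  unfold force
  have h1 : -ψ x - -s = s - ψ x := by ring
  have h2 : -s - -φ x = φ x - s := by ring
  rw [h1, h2]; ring

/-- Reflection exchanges the roles of the obstacles, so every one-sided estimate for classical
solutions yields its counterpart. -/
theorem IsClassicalSolution.neg {ε : ℝ} {φ ψ g : Space d → ℝ} {u : Space d → ℝ → ℝ}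
    (hu : IsClassicalSolution ε φ ψ g u) :
    IsClassicalSolution ε (fun x => - ψ x) (fun x => - φ x) (fun x => - g x)
      (fun x t => - u x t) where
  periodic t ht x k := by
    have := hu.periodic t ht x k
    simp only at this ⊢
    rw [this]
  continuousOn := hu.continuousOn.neg
  contDiff_space t ht := (hu.contDiff_space t ht).neg
  differentiableAt_time x t ht := (hu.differentiableAt_time x t ht).neg
  continuousOn_pderiv i := by
    simp_rw [pderiv_neg]
    exact (hu.continuousOn_pderiv i).neg
  continuousOn_pderiv₂ i j := by
    simp_rw [pderiv_pderiv_neg]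
    exact (hu.continuousOn_pderiv₂ i j).neg
  continuousOn_deriv := by
    have : ∀ p : Space d × ℝ, deriv (fun t => - u p.1 t) p.2 = - deriv (u p.1) p.2 :=
      fun p => deriv.fun_neg
    simp_rw [this]
    exact hu.continuousOn_deriv.neg
  equation x t ht := by
    have h1 : deriv (fun t => - u x t) t = - deriv (u x) t := deriv.fun_neg
    rw [h1, hu.equation x t ht, gradient_neg', regNorm_neg, projectedHessianTrace_neg_left,
      projectedHessianTrace_neg, force_neg]
    ring
  initial x := by rw [hu.initial]

/-! ### A priori estimates for classical solutions -/

section APriori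

variable {ε : ℝ} {φ ψ g : Space d → ℝ} {u : Space d → ℝ → ℝ}

theorem rate_le_of_isLocalMax (hε : 0 < ε) {v w : Space d → ℝ} (hv : ContDiff ℝ 2 v)
    (hw : ContDiff ℝ 2 w) {x : Space d} (hmax : IsLocalMax (fun y => v y - w y) x) :
    ∇ v x = ∇ w x ∧
      projectedHessianTrace (∇ v x) (regNorm ε (∇ v x) ^ 2) v x
        ≤ projectedHessianTrace (∇ w x) (regNorm ε (∇ w x) ^ 2) w x := by
  obtain ⟨h1, h2⟩ := isLocalMax_sub_conditions hv hw hmax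
  refine ⟨h1, ?_⟩
  rw [← h1]
  exact projectedHessianTrace_le (pow_pos (regNorm_pos hε _) 2) (norm_sq_le_regNorm_sq _ _) h2

/-- At a spatial maximum of `u - B` the gradients agree and the Hessians are ordered, so `∂_t u ≤ c`
there. The sign of the force matters only where `u` is above the barrier. -/
theorem IsClassicalSolution.le_barrier (hε : 0 < ε) (hu : IsClassicalSolution ε φ ψ g u)
    {B : Space d → ℝ} (hB : ContDiff ℝ 2 B) (hBper : IsPeriodic B) {c : ℝ}
    (hg : ∀ x, g x ≤ B x)
    (hforce : ∀ x t, 0 < t → B x + c * t < u x t → force ε φ ψ x (u x t) ≤ 0)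
    (hrate : ∀ x, projectedHessianTrace (∇ B x) (regNorm ε (∇ B x) ^ 2) B x ≤ c) :
    ∀ x t, 0 ≤ t → u x t ≤ B x + c * t := by
  suffices h : ∀ x t, 0 ≤ t → u x t - (B x + c * t) ≤ 0 from fun x t ht => by
    linarith [h x t ht]
  refine nonpos_of_parabolic isCompact_closure_cube ?_ ?_ ?_ ?_ ?_
  · exact hu.continuousOn.sub (Continuous.continuousOn (by have := hB.continuous; fun_prop))
  · intro x t ht
    exact (hu.differentiableAt_time x t ht).sub (by fun_prop)
  · intro x
    rw [hu.initial]; linarith [hg x]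
  · intro x t ht _
    have hper : IsPeriodic (fun x => u x t - (B x + c * t)) := fun y k => by
      have h1 := hu.periodic t ht y k
      have h2 := hBper y k
      simp only at h1 ⊢
      rw [h1, h2]
    obtain ⟨y, hy, hyx⟩ := hper.exists_mem_closure_cube x
    exact ⟨y, hy, hyx.ge⟩
  · intro x t ht hpos hmax
    have hloc : IsLocalMax (fun y => u y t - B y) x := by
      refine Eventually.of_forall fun y => ?_
      have := hmax y
      simp only; linarith
    obtain ⟨h1, h2⟩ := rate_le_of_isLocalMax hε (hu.contDiff_space t ht) hB hloc
    have hd : deriv (fun s => u x s - (B x + c * s)) t = deriv (u x) t - c := by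
      have : HasDerivAt (fun s => u x s - (B x + c * s)) (deriv (u x) t - c) t := by
        simpa using (hu.differentiableAt_time x t ht).hasDerivAt.fun_sub
          (((hasDerivAt_id' t).const_mul c).const_add (B x))
      exact this.deriv
    rw [hd, hu.equation x t ht]
    have h3 := hforce x t ht (by linarith)
    have h4 := mul_nonpos_of_nonneg_of_nonpos (regNorm_pos hε (∇ (fun y => u y t) x)).le h3
    linarith [hrate x]

/-- The translate solves the equation with translated obstacles. Where it exceeds `u + c`, the
bounds on the obstacles order the two forces the right way. With `s = 0` this gives the spatial
Lipschitz bound, with `h = 0` the temporal one. -/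
theorem IsClassicalSolution.shift_le (hε : 0 < ε) (hu : IsClassicalSolution ε φ ψ g u)
    {h : Space d} {s c : ℝ} (hs : 0 ≤ s) (hφ : ∀ x, φ (x + h) ≤ φ x + c)
    (hψ : ∀ x, ψ (x + h) ≤ ψ x + c) (h0 : ∀ x, u (x + h) s ≤ g x + c) :
    ∀ x t, 0 ≤ t → u (x + h) (t + s) ≤ u x t + c := by
  suffices H : ∀ x t, 0 ≤ t → u (x + h) (t + s) - u x t - c ≤ 0 from fun x t ht => by
    linarith [H x t ht]
  refine nonpos_of_parabolic isCompact_closure_cube ?_ ?_ ?_ ?_ ?_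
  · refine (ContinuousOn.sub ?_ hu.continuousOn).sub continuousOn_const
    refine hu.continuousOn.comp (f := fun p : Space d × ℝ => (p.1 + h, p.2 + s))
      (by fun_prop) fun p hp => ⟨mem_univ _, ?_⟩
    have : 0 ≤ p.2 := hp.2
    simp only [mem_Ici]; linarith
  · intro x t ht
    refine (DifferentiableAt.sub ?_ (hu.differentiableAt_time x t ht)).sub_const c
    exact (hu.differentiableAt_time (x + h) (t + s) (by linarith)).comp t (by fun_prop)
  · intro x
    rw [hu.initial, zero_add]; linarith [h0 x]
  · intro x t ht _
    have hper : IsPeriodic (fun x => u (x + h) (t + s) - u x t - c) := fun y k => by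
      have h1 := hu.periodic t ht y k
      have h2 := (hu.periodic (t + s) (by linarith)).comp_add h y k
      simp only at h1 h2 ⊢
      rw [h1, h2]
    obtain ⟨y, hy, hyx⟩ := hper.exists_mem_closure_cube x
    exact ⟨y, hy, hyx.ge⟩
  · intro x t ht hpos hmax
    have hts : 0 < t + s := by linarith
    have hloc : IsLocalMax (fun y => u (y + h) (t + s) - u y t) x := by
      refine Eventually.of_forall fun y => ?_
      have := hmax y
      simp only; linarith
    have hC2 : ContDiff ℝ 2 (fun y => u (y + h) (t + s)) :=
      (hu.contDiff_space (t + s) hts).comp (contDiff_id.add contDiff_const)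
    obtain ⟨h1, h2⟩ := rate_le_of_isLocalMax hε hC2 (hu.contDiff_space t ht) hloc
    have hg1 := gradient_comp_add (fun y => u y (t + s)) h x
    have hp1 := projectedHessianTrace_comp_add (∇ (fun y => u y (t + s)) (x + h))
      (regNorm ε (∇ (fun y => u y (t + s)) (x + h)) ^ 2) (fun y => u y (t + s)) h x
    have hd : deriv (fun r => u (x + h) (r + s) - u x r - c) t
        = deriv (u (x + h)) (t + s) - deriv (u x) t := by
      have h5 : HasDerivAt (fun r => u (x + h) (r + s)) (deriv (u (x + h)) (t + s)) t :=
        (hu.differentiableAt_time (x + h) (t + s) hts).hasDerivAt.comp_add_const t s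
      exact ((h5.sub (hu.differentiableAt_time x t ht).hasDerivAt).sub_const c).deriv
    rw [hd, hu.equation x t ht, hu.equation (x + h) (t + s) hts]
    rw [hg1] at h1 h2
    rw [hp1] at h2
    have h6 : force ε φ ψ (x + h) (u (x + h) (t + s)) ≤ force ε φ ψ x (u x t) :=
      force_le_force hε (by linarith [hφ x]) (by linarith [hψ x])
    have h7 := mul_le_mul_of_nonneg_left h6 (regNorm_pos hε (∇ (fun y => u y t) x)).le
    rw [h1] at h2 ⊢
    linarith

end APriori

/-! ### Estimates independent of the regularisation parameter. -/

/-- Bounds that are uniform in `ε` for all classical solutions with given obstacles and initial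
datum. -/
structure UniformBounds (φ ψ g : Space d → ℝ) (L C M : ℝ) : Prop where
  L_nonneg : 0 ≤ L
  C_nonneg : 0 ≤ C
  lip_lower : ∀ x y, |φ x - φ y| ≤ L * ‖x - y‖
  lip_upper : ∀ x y, |ψ x - ψ y| ≤ L * ‖x - y‖
  lip_initial : ∀ x y, |g x - g y| ≤ L * ‖x - y‖
  abs_lower : ∀ x, |φ x| ≤ M
  abs_upper : ∀ x, |ψ x| ≤ M
  hess_initial : ∀ ε, 0 < ε → ∀ x,
    |projectedHessianTrace (∇ g x) (regNorm ε (∇ g x) ^ 2) g x| ≤ C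

theorem exists_uniformBounds {φ ψ g : Space d → ℝ} (hφ : ContDiff ℝ 1 φ) (hψ : ContDiff ℝ 1 ψ)
    (hg : ContDiff ℝ 2 g) (hφper : IsPeriodic φ) (hψper : IsPeriodic ψ) (hgper : IsPeriodic g) :
    ∃ L C M, UniformBounds φ ψ g L C M := by
  obtain ⟨L₁, hL₁, h₁⟩ := hφper.exists_lipschitz hφ
  obtain ⟨L₂, hL₂, h₂⟩ := hψper.exists_lipschitz hψ
  obtain ⟨L₃, hL₃, h₃⟩ := hgper.exists_lipschitz (hg.of_le one_le_two)
  obtain ⟨M₁, hM₁⟩ := hφper.exists_bound hφ.continuous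
  obtain ⟨M₂, hM₂⟩ := hψper.exists_bound hψ.continuous
  obtain ⟨H, hH0, hH⟩ := hgper.exists_abs_hess_le hg
  refine ⟨L₁ + L₂ + L₃, d ^ 2 * (2 * H), max M₁ M₂, ⟨by positivity, by positivity, ?_, ?_, ?_,
    fun x => (hM₁ x).trans (le_max_left _ _), fun x => (hM₂ x).trans (le_max_right _ _), ?_⟩⟩
  · exact fun x y => (h₁ x y).trans (by gcongr; linarith)
  · exact fun x y => (h₂ x y).trans (by gcongr; linarith)
  · exact fun x y => (h₃ x y).trans (by gcongr; linarith)
  · exact fun ε hε x => abs_projectedHessianTrace_le (fun i j => hH i j x)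
      (pow_pos (regNorm_pos hε _) 2) (norm_sq_le_regNorm_sq _ _)

theorem UniformBounds.neg {φ ψ g : Space d → ℝ} {L C M : ℝ} (h : UniformBounds φ ψ g L C M) :
    UniformBounds (fun x => - ψ x) (fun x => - φ x) (fun x => - g x) L C M where
  L_nonneg := h.L_nonneg
  C_nonneg := h.C_nonneg
  lip_lower x y := by
    rw [neg_sub_neg, abs_sub_comm]; exact h.lip_upper x y
  lip_upper x y := by
    rw [neg_sub_neg, abs_sub_comm]; exact h.lip_lower x y
  lip_initial x y := by
    rw [neg_sub_neg, abs_sub_comm]; exact h.lip_initial x y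
  abs_lower x := by rw [abs_neg]; exact h.abs_upper x
  abs_upper x := by rw [abs_neg]; exact h.abs_lower x
  hess_initial ε hε x := by
    rw [gradient_neg', regNorm_neg, projectedHessianTrace_neg_left, projectedHessianTrace_neg,
      abs_neg]
    exact h.hess_initial ε hε x

section Uniform

variable {ε : ℝ} {φ ψ g : Space d → ℝ} {u : Space d → ℝ → ℝ} {L C M : ℝ}

theorem pderiv_const (c : ℝ) (i : Fin d) (x : Space d) : pderiv i (fun _ => c) x = 0 := by
  simp [pderiv]

theorem projectedHessianTrace_const (q : Space d) (s c : ℝ) (x : Space d) :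
    projectedHessianTrace q s (fun _ => c) x = 0 := by
  have : ∀ j : Fin d, pderiv j (fun _ : Space d => c) = fun _ => 0 :=
    fun j => funext fun y => pderiv_const c j y
  simp [projectedHessianTrace, this, pderiv_const]

theorem IsClassicalSolution.le_bound (hB : UniformBounds φ ψ g L C M) (hε : 0 < ε)
    (hφψ : ∀ x, φ x < ψ x) (hgψ : ∀ x, g x ≤ ψ x)
    (hu : IsClassicalSolution ε φ ψ g u) : ∀ x t, 0 ≤ t → u x t ≤ M := by
  intro x t ht
  have hM : ∀ x, ψ x ≤ M := fun x => (le_abs_self _).trans (hB.abs_upper x)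
  have := hu.le_barrier hε (B := fun _ => M) (c := 0) contDiff_const (fun _ _ => rfl)
    (fun x => (hgψ x).trans (hM x)) (fun x t _ h => force_nonpos hε (by
      linarith [hM x, hφψ x])) (fun x => by rw [projectedHessianTrace_const]) x t ht
  linarith

/-- The barrier `g + C t` stays above `φ`, so above it the lower obstacle exerts no force and only
the curvature of `g`, bounded by `C`, can push upwards. -/
theorem IsClassicalSolution.le_initial_add (hB : UniformBounds φ ψ g L C M) (hε : 0 < ε)
    (hg : ContDiff ℝ 2 g) (hgper : IsPeriodic g) (hφg : ∀ x, φ x ≤ g x)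
    (hu : IsClassicalSolution ε φ ψ g u) : ∀ x t, 0 ≤ t → u x t ≤ g x + C * t :=
  hu.le_barrier hε hg hgper (fun _ => le_rfl)
    (fun x t ht h => force_nonpos hε (by
      nlinarith [hφg x, mul_nonneg hB.C_nonneg ht.le]))
    (fun x => (le_abs_self _).trans (hB.hess_initial ε hε x))

theorem neg_contDiff {n : WithTop ℕ∞} {f : Space d → ℝ} (hf : ContDiff ℝ n f) :
    ContDiff ℝ n (fun x => - f x) := hf.neg

theorem IsPeriodic.neg {f : Space d → ℝ} (hf : IsPeriodic f) : IsPeriodic (fun x => - f x) :=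
  fun x k => congrArg Neg.neg (hf x k)

theorem IsClassicalSolution.abs_le_bound (hB : UniformBounds φ ψ g L C M) (hε : 0 < ε)
    (hφψ : ∀ x, φ x < ψ x) (hφg : ∀ x, φ x ≤ g x) (hgψ : ∀ x, g x ≤ ψ x)
    (hu : IsClassicalSolution ε φ ψ g u) : ∀ x t, 0 ≤ t → |u x t| ≤ M := by
  intro x t ht
  refine abs_le.2 ⟨?_, hu.le_bound hB hε hφψ hgψ x t ht⟩
  have := hu.neg.le_bound hB.neg hε (fun x => neg_lt_neg (hφψ x)) (fun x => neg_le_neg (hφg x))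
    x t ht
  linarith

theorem IsClassicalSolution.abs_sub_initial_le (hB : UniformBounds φ ψ g L C M) (hε : 0 < ε)
    (hg : ContDiff ℝ 2 g) (hgper : IsPeriodic g) (hφg : ∀ x, φ x ≤ g x) (hgψ : ∀ x, g x ≤ ψ x)
    (hu : IsClassicalSolution ε φ ψ g u) : ∀ x t, 0 ≤ t → |u x t - g x| ≤ C * t := by
  intro x t ht
  have h1 := hu.le_initial_add hB hε hg hgper hφg x t ht
  have h2 := hu.neg.le_initial_add hB.neg hε (neg_contDiff hg) hgper.neg
    (fun x => neg_le_neg (hgψ x)) x t ht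
  exact abs_le.2 ⟨by linarith, by linarith⟩

theorem IsClassicalSolution.lipschitz_space (hB : UniformBounds φ ψ g L C M) (hε : 0 < ε)
    (hu : IsClassicalSolution ε φ ψ g u) :
    ∀ x y t, 0 ≤ t → |u x t - u y t| ≤ L * ‖x - y‖ := by
  have key : ∀ x y t, 0 ≤ t → u x t - u y t ≤ L * ‖x - y‖ := by
    intro x y t ht
    have hL : ∀ f : Space d → ℝ, (∀ x y, |f x - f y| ≤ L * ‖x - y‖) →
        ∀ z, f (z + (x - y)) ≤ f z + L * ‖x - y‖ := fun f hf z => by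
      have := (le_abs_self _).trans (hf (z + (x - y)) z)
      rw [add_sub_cancel_left] at this
      linarith
    have := hu.shift_le hε (h := x - y) (s := 0) le_rfl (hL φ hB.lip_lower) (hL ψ hB.lip_upper)
      (fun z => by rw [hu.initial]; exact hL g hB.lip_initial z) y t ht
    rw [add_sub_cancel, add_zero] at this
    linarith
  intro x y t ht
  refine abs_le.2 ⟨?_, key x y t ht⟩
  have := key y x t ht
  rw [norm_sub_rev] at this
  linarith

/-- The distance from `g` after time `s` is at most `C s`, and comparison with the time translate
carries this bound on increments to all later times. -/
theorem IsClassicalSolution.lipschitz_time (hB : UniformBounds φ ψ g L C M) (hε : 0 < ε)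
    (hg : ContDiff ℝ 2 g) (hgper : IsPeriodic g) (hφg : ∀ x, φ x ≤ g x) (hgψ : ∀ x, g x ≤ ψ x)
    (hu : IsClassicalSolution ε φ ψ g u) :
    ∀ x t s, 0 ≤ t → 0 ≤ s → |u x t - u x s| ≤ C * |t - s| := by
  have half : ∀ {φ ψ g : Space d → ℝ} {u : Space d → ℝ → ℝ}, UniformBounds φ ψ g L C M →
      ContDiff ℝ 2 g → IsPeriodic g → (∀ x, φ x ≤ g x) → (∀ x, g x ≤ ψ x) →
      IsClassicalSolution ε φ ψ g u → ∀ x t s, 0 ≤ t → 0 ≤ s → u x (t + s) ≤ u x t + C * s := by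
    intro φ ψ g u hB hg hgper hφg hgψ hu x t s ht hs
    have hCs := mul_nonneg hB.C_nonneg hs
    have := hu.shift_le hε (h := 0) (c := C * s) hs (fun z => by rw [add_zero]; linarith)
      (fun z => by rw [add_zero]; linarith) (fun z => by
        rw [add_zero]; exact hu.le_initial_add hB hε hg hgper hφg z s hs) x t ht
    rwa [add_zero] at this
  have key : ∀ x t s, 0 ≤ s → s ≤ t → |u x t - u x s| ≤ C * |t - s| := by
    intro x t s hs hst
    have h1 := half hB hg hgper hφg hgψ hu x s (t - s) hs (by linarith)
    have h2 := half hB.neg (neg_contDiff hg) hgper.neg (fun x => neg_le_neg (hgψ x))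
      (fun x => neg_le_neg (hφg x)) hu.neg x s (t - s) hs (by linarith)
    rw [add_sub_cancel] at h1 h2
    rw [abs_of_nonneg (by linarith : 0 ≤ t - s)]
    exact abs_le.2 ⟨by linarith, by linarith⟩
  intro x t s ht hs
  rcases le_total s t with h | h
  · exact key x t s hs h
  · rw [abs_sub_comm, abs_sub_comm t s]; exact key x s t ht h

end Uniform

/-! ### Derivatives read off from restrictions to lines -/

theorem inner_gradient_eq_sum (v : Space d → ℝ) (x ξ : Space d) :
    inner ℝ (∇ v x) ξ = ∑ i, ξ i * pderiv i v x := by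
  rw [inner_gradient_left, fderiv_apply_eq_sum]

theorem inner_gradient_of_line {v : Space d → ℝ} (hv : Differentiable ℝ v) {x ξ : Space d} {c : ℝ}
    (h : HasDerivAt (fun s : ℝ => v (x + s • ξ)) c 0) : inner ℝ (∇ v x) ξ = c := by
  have := (hasDerivAt_line hv x ξ 0).unique h
  rw [inner_gradient_eq_sum]
  simpa using this

theorem hessForm_of_line {v : Space d → ℝ} (hv : ContDiff ℝ 2 v) {x ξ : Space d} {f' : ℝ → ℝ}
    {c : ℝ} (h : ∀ s, HasDerivAt (fun s : ℝ => v (x + s • ξ)) (f' s) s) (h' : HasDerivAt f' c 0) :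
    hessForm v x ξ = c := by
  have h1 : f' = fun s : ℝ => ∑ i, ξ i * pderiv i v (x + s • ξ) := funext fun s =>
    (h s).unique (hasDerivAt_line (hv.differentiable two_ne_zero) x ξ s)
  rw [h1] at h'
  have := (hasDerivAt_line₂ hv x ξ 0).unique h'
  simpa using this

theorem norm_add_smul_sq (z ξ : Space d) (s : ℝ) :
    ‖z + s • ξ‖ ^ 2 = ‖z‖ ^ 2 + 2 * s * inner ℝ z ξ + s ^ 2 * ‖ξ‖ ^ 2 := by
  rw [norm_add_sq_real, norm_smul, inner_smul_right, mul_pow, Real.norm_eq_abs, sq_abs]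
  ring

theorem hessForm_half_norm_sq (x ξ : Space d) :
    hessForm (fun y : Space d => ‖y‖ ^ 2 / 2) x ξ = ‖ξ‖ ^ 2 := by
  refine hessForm_of_line ((contDiff_norm_sq ℝ).div_const 2)
    (f' := fun s => inner ℝ x ξ + s * ‖ξ‖ ^ 2) (fun s => ?_) ?_
  · simp_rw [norm_add_smul_sq]
    have h1 := (((hasDerivAt_id' s).const_mul 2).mul_const (inner ℝ x ξ)).const_add (‖x‖ ^ 2)
    have h2 := ((hasDerivAt_id' s).fun_pow 2).mul_const (‖ξ‖ ^ 2)
    refine ((h1.fun_add h2).div_const 2).congr_deriv ?_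
    simp; ring
  · simpa using ((hasDerivAt_id' (0 : ℝ)).mul_const (‖ξ‖ ^ 2)).const_add (inner ℝ x ξ)

theorem hessForm_single (v : Space d → ℝ) (x : Space d) (i : Fin d) :
    hessForm v x (EuclideanSpace.single i 1) = pderiv i (pderiv i v) x := by
  simp [hessForm]

/-- The error is `c` times the trace of the coefficient matrix. That trace is at most `d`, as one
sees by testing on `‖y‖² / 2`, whose Hessian is the identity. -/
theorem projectedHessianTrace_le_add {q : Space d} {s c : ℝ} (hs : 0 < s) (hq : ‖q‖ ^ 2 ≤ s)
    (hc : 0 ≤ c) {v w : Space d → ℝ} {x y : Space d}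
    (h : ∀ ξ, hessForm v x ξ ≤ hessForm w y ξ + c * ‖ξ‖ ^ 2) :
    projectedHessianTrace q s v x ≤ projectedHessianTrace q s w y + c * d := by
  obtain ⟨l, hl⟩ := exists_projection_root hs hq
  have h0 : projectedHessianTrace q s (fun y : Space d => ‖y‖ ^ 2 / 2) 0 ≤ d := by
    rw [projectedHessianTrace_eq_trace_sub, hessForm_half_norm_sq]
    simp_rw [← hessForm_single, hessForm_half_norm_sq]
    have : 0 ≤ ‖q‖ ^ 2 / s := by positivity
    simp
    exact this
  rw [projectedHessianTrace_eq_sum_hessForm hl] at h0 ⊢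
  rw [projectedHessianTrace_eq_sum_hessForm hl]
  simp_rw [hessForm_half_norm_sq] at h0
  refine (Finset.sum_le_sum fun k _ => h _).trans ?_
  rw [Finset.sum_add_distrib, ← Finset.mul_sum]
  gcongr

/-! ### The quartic penalisation -/

/-- The quartic function `|x - y|⁴ / (4 α)`. -/
noncomputable def quartic (α : ℝ) (y x : Space d) : ℝ := ‖x - y‖ ^ 4 / (4 * α)

theorem contDiff_quartic (α : ℝ) (y : Space d) {n : WithTop ℕ∞} :
    ContDiff ℝ n (quartic α y) := by
  have : quartic α y = fun x => (‖x - y‖ ^ 2) ^ 2 / (4 * α) := by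
    funext x; rw [quartic]; ring
  rw [this]
  exact ((((contDiff_id.sub contDiff_const).norm_sq ℝ)).pow 2).div_const _

theorem quartic_nonneg {α : ℝ} (hα : 0 < α) (y x : Space d) : 0 ≤ quartic α y x := by
  rw [quartic]; positivity

theorem quartic_comm (α : ℝ) (x y : Space d) : quartic α y x = quartic α x y := by
  rw [quartic, quartic, norm_sub_rev]

theorem hasDerivAt_quartic_line {α : ℝ} (hα : 0 < α) (y x ξ : Space d) (s : ℝ) :
    HasDerivAt (fun s : ℝ => quartic α y (x + s • ξ))
      ((‖x - y‖ ^ 2 + 2 * s * inner ℝ (x - y) ξ + s ^ 2 * ‖ξ‖ ^ 2)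
        * (inner ℝ (x - y) ξ + s * ‖ξ‖ ^ 2) / α) s := by
  have : (fun s : ℝ => quartic α y (x + s • ξ)) = fun s : ℝ =>
      (‖x - y‖ ^ 2 + 2 * s * inner ℝ (x - y) ξ + s ^ 2 * ‖ξ‖ ^ 2) ^ 2 / (4 * α) := by
    funext s
    rw [← norm_add_smul_sq, quartic, add_sub_right_comm]; ring
  rw [this]
  have h1 := (((hasDerivAt_id' s).const_mul 2).mul_const (inner ℝ (x - y) ξ)).const_add
    (‖x - y‖ ^ 2)
  have h2 := ((hasDerivAt_id' s).fun_pow 2).mul_const (‖ξ‖ ^ 2)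
  refine (((h1.fun_add h2).fun_pow 2).div_const (4 * α)).congr_deriv ?_
  simp
  field_simp
  ring

theorem gradient_quartic {α : ℝ} (hα : 0 < α) (y x : Space d) :
    ∇ (quartic α y) x = (‖x - y‖ ^ 2 / α) • (x - y) := by
  refine ext_inner_right ℝ fun ξ => ?_
  rw [inner_gradient_of_line ((contDiff_quartic α y (n := 1)).differentiable one_ne_zero)
    (hasDerivAt_quartic_line hα y x ξ 0), inner_smul_left]
  simp; ring

theorem norm_gradient_quartic {α : ℝ} (hα : 0 < α) (y x : Space d) :
    ‖∇ (quartic α y) x‖ = ‖x - y‖ ^ 3 / α := by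
  rw [gradient_quartic hα, norm_smul, Real.norm_of_nonneg (by positivity)]; ring

theorem hessForm_quartic {α : ℝ} (hα : 0 < α) (y x ξ : Space d) :
    hessForm (quartic α y) x ξ
      = (2 * (inner ℝ (x - y) ξ) ^ 2 + ‖x - y‖ ^ 2 * ‖ξ‖ ^ 2) / α := by
  refine hessForm_of_line (contDiff_quartic α y) (hasDerivAt_quartic_line hα y x ξ) ?_
  have h1 := (((hasDerivAt_id' (0 : ℝ)).const_mul 2).mul_const (inner ℝ (x - y) ξ)).const_add
    (‖x - y‖ ^ 2)
  have h2 := ((hasDerivAt_id' (0 : ℝ)).fun_pow 2).mul_const (‖ξ‖ ^ 2)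
  have h3 := ((hasDerivAt_id' (0 : ℝ)).mul_const (‖ξ‖ ^ 2)).const_add (inner ℝ (x - y) ξ)
  refine (((h1.fun_add h2).fun_mul h3).div_const α).congr_deriv ?_
  simp
  ring

/-- The Hessian is of order `‖x - y‖²` and the gradient of order `‖x - y‖³`, so the Hessian vanishes
where the gradient does. A quadratic penalisation would not have this property. -/
theorem hessForm_quartic_le {α : ℝ} (hα : 0 < α) (y x ξ : Space d) :
    hessForm (quartic α y) x ξ ≤ 3 * ‖x - y‖ ^ 2 / α * ‖ξ‖ ^ 2 := by
  rw [hessForm_quartic hα, div_mul_eq_mul_div]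
  have h := abs_real_inner_le_norm (x - y) ξ
  have h2 : (inner ℝ (x - y) ξ) ^ 2 ≤ (‖x - y‖ * ‖ξ‖) ^ 2 := by
    rw [← sq_abs]; gcongr
  gcongr
  nlinarith

theorem hessForm_neg (v : Space d → ℝ) (x ξ : Space d) :
    hessForm (fun y => - v y) x ξ = - hessForm v x ξ := by
  simp only [hessForm, pderiv_pderiv_neg, ← Finset.sum_neg_distrib]
  exact Finset.sum_congr rfl fun i _ => Finset.sum_congr rfl fun j _ => by ring

/-- Small distances are absorbed by the constant `m`, large ones by the fourth power. Thus Lipschitz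
functions can be compared at two points at the price of the penalisation plus `m`. -/
theorem exists_quartic_dominates {L m : ℝ} (hL : 0 ≤ L) (hm : 0 < m) :
    ∃ α : ℝ, 0 < α ∧ ∀ r : ℝ, 0 ≤ r → L * r ≤ r ^ 4 / (4 * α) + m := by
  -- The crossover: `L c ≤ m`, and with `4 α = c³ / (L + 1)` the quartic exceeds `L r` as soon as `r
  -- ≥ c`.
  set c := m / (L + 1) with hc
  have hc0 : 0 < c := by positivity
  refine ⟨c ^ 3 / (4 * (L + 1)), by positivity, fun r hr => ?_⟩
  have h4 : 4 * (c ^ 3 / (4 * (L + 1))) = c ^ 3 / (L + 1) := by field_simp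
  rw [h4]
  rcases le_total r c with h | h
  · have h1 : (L + 1) * c = m := by rw [hc]; field_simp
    have : 0 ≤ r ^ 4 / (c ^ 3 / (L + 1)) := by positivity
    nlinarith
  · have h1 : L * r ≤ r ^ 4 / (c ^ 3 / (L + 1)) := by
      rw [le_div_iff₀ (by positivity), mul_div_assoc', div_le_iff₀ (by positivity)]
      have h2 : c ^ 3 ≤ r ^ 3 := by gcongr
      have h3 : L * r * c ^ 3 ≤ (L + 1) * r * r ^ 3 := by gcongr; linarith
      nlinarith
    linarith

/-! ### Solutions of the penalised equation almost respect the obstacles -/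

variable {φ ψ g : Space d → ℝ} {L C M : ℝ}

/-- The penalisation dominates the curvature of the quartic barrier. -/
theorem exists_penalty_dominates (H : ℝ) (hH : 0 ≤ H) {K α : ℝ} (hK : 0 < K) (hα : 0 < α) :
    ∃ ε₀ : ℝ, 0 < ε₀ ∧ ∀ ε, 0 < ε → ε < ε₀ → ∀ r P : ℝ, 0 ≤ r → ε ≤ P → r ^ 3 / α ≤ P →
      H * r ^ 2 / α ≤ P * (K / ε) := by
  -- For `r ≤ ρ` the curvature term is at most `K`, and `P ≥ ε` suffices. For `r ≥ ρ` the gradient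
  -- bound `P ≥ r³ / α` wins once `ε` is small.
  set ρ := √(K * α / (H + 1)) with hρ
  have hρ0 : 0 < ρ := Real.sqrt_pos.2 (by positivity)
  have hρsq : ρ ^ 2 = K * α / (H + 1) := Real.sq_sqrt (by positivity)
  refine ⟨ρ * K / (H + 1), by positivity, fun ε hε hεle r P hr hP1 hP2 => ?_⟩
  rcases le_total (r ^ 2) (ρ ^ 2) with h | h
  · calc H * r ^ 2 / α ≤ (H + 1) * ρ ^ 2 / α := by gcongr; linarith
      _ = K := by rw [hρsq]; field_simp
      _ = ε * (K / ε) := by field_simp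
      _ ≤ P * (K / ε) := by gcongr
  · have hr' : ρ ≤ r := by nlinarith
    calc H * r ^ 2 / α ≤ (H + 1) * r ^ 2 / α := by gcongr; linarith
      _ ≤ r ^ 3 / α * (K / ε) := by
        rw [div_mul_div_comm, div_le_div_iff₀ hα (by positivity)]
        rw [lt_div_iff₀ (by positivity)] at hεle
        have h3 : ε * (H + 1) ≤ r * K := by nlinarith
        have : 0 ≤ r ^ 2 * α := by positivity
        nlinarith [mul_le_mul_of_nonneg_left h3 this]
      _ ≤ P * (K / ε) := by gcongr

/-- `φ` is only `C¹` and cannot itself be a barrier, so it is replaced near each point `y` by a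
quartic cap below it. Where the cap exceeds `u`, the violation of the obstacle is at least `m / 2`,
and the resulting force of order `1 / ε` beats the curvature of the cap. -/
theorem exists_lower_obstacle_bound (hB : UniformBounds φ ψ g L C M) (hφψ : ∀ x, φ x < ψ x)
    (hφg : ∀ x, φ x ≤ g x) (hgψ : ∀ x, g x ≤ ψ x) {m : ℝ} (hm : 0 < m) :
    ∃ ε₀ : ℝ, 0 < ε₀ ∧ ∀ ε, 0 < ε → ε < ε₀ → ∀ u, IsClassicalSolution ε φ ψ g u →
      ∀ x t, 0 ≤ t → φ x - m ≤ u x t := by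
  obtain ⟨α, hα, hdom⟩ := exists_quartic_dominates hB.L_nonneg (half_pos hm)
  -- `3 d` comes from the trace of the Hessian bound of the quartic, and `4 (m / 2)³` is `ε` times
  -- the force at violation `m / 2`.
  obtain ⟨ε₀, hε₀, hpen⟩ := exists_penalty_dominates (3 * d) (by positivity)
    (K := 4 * (m / 2) ^ 3) (by positivity) hα
  refine ⟨ε₀, hε₀, fun ε hε hεlt u hu y t ht => ?_⟩
  have hM0 : 0 ≤ M := (abs_nonneg _).trans (hB.abs_lower 0)
  have hub := hu.abs_le_bound hB hε hφψ hφg hgψ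
  have hφdom : ∀ x, φ y - φ x ≤ quartic α y x + m / 2 := fun x => by
    have h1 := (le_abs_self _).trans (hB.lip_lower y x)
    rw [norm_sub_rev] at h1
    have := hdom ‖x - y‖ (norm_nonneg _)
    rw [quartic]; linarith
  suffices H : ∀ x t, 0 ≤ t → (φ y - m - quartic α y x) - u x t ≤ 0 by
    have := H y t ht
    simp [quartic] at this
    linarith
  -- Outside this ball the quartic exceeds `2 M`, so the cap is below `u`; the maximum `1` allows
  -- the fourth power to be bounded below by the first.
  refine nonpos_of_parabolic (isCompact_closedBall y (max 1 (8 * α * M))) ?_ ?_ ?_ ?_ ?_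
  · refine ContinuousOn.sub (Continuous.continuousOn ?_) hu.continuousOn
    have := (contDiff_quartic α y (n := 0)).continuous
    fun_prop
  · intro x t ht
    exact (hu.differentiableAt_time x t ht).const_sub _
  · intro x
    rw [hu.initial]
    linarith [hφg x, hφdom x]
  · intro x t ht hpos
    refine ⟨x, ?_, le_rfl⟩
    rw [Metric.mem_closedBall, dist_eq_norm]
    by_contra! hlt
    have h1 := (abs_le.1 (hub x t ht)).1
    have h2 := (abs_le.1 (hB.abs_lower y)).2
    have h3 : quartic α y x ≤ 2 * M := by linarith
    rw [quartic, div_le_iff₀ (by positivity)] at h3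
    have h4 : 1 < ‖x - y‖ := (le_max_left _ _).trans_lt hlt
    have h5 : 8 * α * M < ‖x - y‖ := (le_max_right _ _).trans_lt hlt
    have h6 : ‖x - y‖ ^ 1 ≤ ‖x - y‖ ^ 4 := pow_le_pow_right₀ h4.le (by norm_num)
    rw [pow_one] at h6
    nlinarith
  · intro x t ht hpos hmax
    have hloc : IsLocalMax (fun z => - quartic α y z - u z t) x := by
      refine Eventually.of_forall fun z => ?_
      have := hmax z
      simp only; linarith
    obtain ⟨h1, h2⟩ := isLocalMax_sub_conditions (neg_contDiff (contDiff_quartic α y))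
      (hu.contDiff_space t ht) hloc
    rw [gradient_neg'] at h1
    have hd : deriv (fun s => φ y - m - quartic α y x - u x s) t = - deriv (u x) t := by
      rw [deriv_const_sub]
    rw [hd, hu.equation x t ht]
    set p := ∇ (fun y => u y t) x with hp
    have hpn : ‖p‖ = ‖x - y‖ ^ 3 / α := by rw [← h1, norm_neg, norm_gradient_quartic hα]
    have hP1 := le_regNorm ε p
    have hP2 := norm_le_regNorm ε p
    rw [hpn] at hP2
    -- Comparison with the zero function states that the Hessian of `u` is bounded below by minus
    -- that of the quartic, hence the curvature term by minus `d` times it.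
    have h3 : projectedHessianTrace p (regNorm ε p ^ 2) (fun _ => (0 : ℝ)) x
        ≤ projectedHessianTrace p (regNorm ε p ^ 2) (fun y => u y t) x
          + 3 * ‖x - y‖ ^ 2 / α * d := by
      refine projectedHessianTrace_le_add (pow_pos (regNorm_pos hε _) 2)
        (norm_sq_le_regNorm_sq _ _) (by positivity) fun ξ => ?_
      have h4 := h2 ξ
      rw [hessForm_neg] at h4
      have h5 := hessForm_quartic_le hα y x ξ
      have h6 : hessForm (fun _ : Space d => (0 : ℝ)) x ξ = 0 := by
        have : ∀ j : Fin d, pderiv j (fun _ : Space d => (0 : ℝ)) = fun _ => 0 :=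
          fun j => funext fun y => pderiv_const 0 j y
        simp [hessForm, this, pderiv_const]
      linarith
    rw [projectedHessianTrace_const] at h3
    have hforce : 4 * (m / 2) ^ 3 / ε ≤ force ε φ ψ x (u x t) := by
      have h7 : m / 2 ≤ φ x - u x t := by linarith [hφdom x]
      rw [force, max_eq_left (by linarith : 0 ≤ φ x - u x t),
        max_eq_right (by linarith [hφψ x] : u x t - ψ x ≤ 0), div_mul_eq_mul_div]
      have h8 : (m / 2) ^ 3 ≤ (φ x - u x t) ^ 3 := by gcongr
      norm_num
      gcongr
    have h9 := hpen ε hε hεlt ‖x - y‖ (regNorm ε p) (norm_nonneg _) hP1 hP2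
    have h10 := mul_le_mul_of_nonneg_left hforce (regNorm_pos hε p).le
    have h11 : 3 * (d : ℝ) * ‖x - y‖ ^ 2 / α = 3 * ‖x - y‖ ^ 2 / α * d := by ring
    linarith

/-! ### Comparison of viscosity subsolutions with classical solutions -/

/-- The quadratic polynomial with gradient `p` at `x₀` and Hessian form `hessForm U y + κ |·|²`. -/
noncomputable def taylorPoly (U : Space d → ℝ) (y x₀ : Space d) (κ : ℝ) (x : Space d) : ℝ :=
  inner ℝ (∇ U y) (x - x₀) + (hessForm U y (x - x₀) + κ * ‖x - x₀‖ ^ 2) / 2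

theorem contDiff_apply (i : Fin d) {n : WithTop ℕ∞} : ContDiff ℝ n (fun x : Space d => x i) :=
  contDiff_piLp_apply 2

theorem contDiff_taylorPoly (U : Space d → ℝ) (y x₀ : Space d) (κ : ℝ) {n : WithTop ℕ∞} :
    ContDiff ℝ n (taylorPoly U y x₀ κ) := by
  have h0 : ContDiff ℝ n (fun x : Space d => x - x₀) := contDiff_id.sub contDiff_const
  unfold taylorPoly hessForm
  refine (contDiff_const.inner ℝ h0).add ((ContDiff.add ?_ ?_).div_const 2)
  · refine ContDiff.sum fun i _ => ContDiff.sum fun j _ => ?_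
    exact (((contDiff_apply i).comp h0).mul ((contDiff_apply j).comp h0)).mul contDiff_const
  · exact contDiff_const.mul (h0.norm_sq ℝ)

theorem hasDerivAt_taylorPoly_line (U : Space d → ℝ) (y x₀ ξ : Space d) (κ s : ℝ) :
    HasDerivAt (fun s : ℝ => taylorPoly U y x₀ κ (x₀ + s • ξ))
      (inner ℝ (∇ U y) ξ + s * (hessForm U y ξ + κ * ‖ξ‖ ^ 2)) s := by
  have : (fun s : ℝ => taylorPoly U y x₀ κ (x₀ + s • ξ)) = fun s : ℝ =>
      s * inner ℝ (∇ U y) ξ + s ^ 2 * ((hessForm U y ξ + κ * ‖ξ‖ ^ 2) / 2) := by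
    funext s
    rw [taylorPoly, add_sub_cancel_left, hessForm_smul, inner_smul_right, norm_smul, mul_pow,
      Real.norm_eq_abs, sq_abs]
    ring
  rw [this]
  have h1 := (hasDerivAt_id' s).mul_const (inner ℝ (∇ U y) ξ)
  have h2 := ((hasDerivAt_id' s).fun_pow 2).mul_const ((hessForm U y ξ + κ * ‖ξ‖ ^ 2) / 2)
  refine (h1.fun_add h2).congr_deriv ?_
  simp; ring

theorem gradient_taylorPoly (U : Space d → ℝ) (y x₀ : Space d) (κ : ℝ) :
    ∇ (taylorPoly U y x₀ κ) x₀ = ∇ U y := by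
  refine ext_inner_right ℝ fun ξ => ?_
  rw [inner_gradient_of_line ((contDiff_taylorPoly U y x₀ κ (n := 1)).differentiable one_ne_zero)
    (hasDerivAt_taylorPoly_line U y x₀ ξ κ 0)]
  simp

theorem hessForm_taylorPoly (U : Space d → ℝ) (y x₀ : Space d) (κ : ℝ) (ξ : Space d) :
    hessForm (taylorPoly U y x₀ κ) x₀ ξ = hessForm U y ξ + κ * ‖ξ‖ ^ 2 := by
  refine hessForm_of_line (contDiff_taylorPoly U y x₀ κ)
    (hasDerivAt_taylorPoly_line U y x₀ ξ κ) ?_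
  simpa using ((hasDerivAt_id' (0 : ℝ)).mul_const (hessForm U y ξ + κ * ‖ξ‖ ^ 2)).const_add
    (inner ℝ (∇ U y) ξ)

theorem gradient_add_const (v : Space d → ℝ) (c : ℝ) (x : Space d) :
    ∇ (fun y => v y + c) x = ∇ v x :=
  gradient_eq_of_pderiv fun i => by simp only [pderiv]; rw [fderiv_add_const]

theorem projectedHessianTrace_add_const (q : Space d) (s c : ℝ) (v : Space d → ℝ) (x : Space d) :
    projectedHessianTrace q s (fun y => v y + c) x = projectedHessianTrace q s v x := by
  have key : ∀ j, pderiv j (fun y => v y + c) = pderiv j v := fun j => funext fun y => by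
    simp only [pderiv]; rw [fderiv_add_const]
  simp only [projectedHessianTrace, key]

/-- The regularisation error of the projected Hessian is small for small `ε`, given the Hessian
bound of the quartic penalisation. -/
theorem exists_regularisation_error_small {α δ : ℝ} (hα : 0 < α) (hδ : 0 < δ) :
    ∃ ε₀ : ℝ, 0 < ε₀ ∧ ∀ ε, 0 < ε → ε < ε₀ → ∀ r : ℝ, 0 ≤ r →
      3 * r ^ 2 / α * (ε ^ 2 / (ε ^ 2 + (r ^ 3 / α) ^ 2)) ≤ δ := by
  -- For `r ≤ ρ` the Hessian bound alone is at most `δ`. For larger `r` the gradient stays away from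
  -- zero, and the threshold `e` on `ε` makes the relative regularisation error small enough.
  set ρ := √(δ * α / 3) with hρ
  have hρ0 : 0 < ρ := Real.sqrt_pos.2 (by positivity)
  have hρsq : ρ ^ 2 = δ * α / 3 := Real.sq_sqrt (by positivity)
  set e := √(δ * ρ ^ 4 / (3 * α)) with he
  have he0 : 0 < e := Real.sqrt_pos.2 (by positivity)
  have hesq : e ^ 2 = δ * ρ ^ 4 / (3 * α) := Real.sq_sqrt (by positivity)
  refine ⟨e, he0, fun ε hε hεlt r hr => ?_⟩
  rcases le_total (r ^ 2) (ρ ^ 2) with h | h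
  · calc 3 * r ^ 2 / α * (ε ^ 2 / (ε ^ 2 + (r ^ 3 / α) ^ 2)) ≤ 3 * ρ ^ 2 / α * 1 := by
          gcongr
          rw [div_le_one (by positivity)]
          nlinarith [sq_nonneg (r ^ 3 / α)]
      _ = δ := by rw [hρsq]; field_simp
  · have hr0 : 0 < r := by
      rcases hr.lt_or_eq with h0 | h0
      · exact h0
      · rw [← h0] at h; nlinarith
    have hr' : ρ ≤ r := by nlinarith
    calc 3 * r ^ 2 / α * (ε ^ 2 / (ε ^ 2 + (r ^ 3 / α) ^ 2))
        ≤ 3 * r ^ 2 / α * (e ^ 2 / (r ^ 3 / α) ^ 2) := by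
          gcongr
          nlinarith [sq_nonneg ε]
      _ = δ * (ρ ^ 4 / r ^ 4) := by rw [hesq]; field_simp
      _ ≤ δ * 1 := by
          gcongr
          rw [div_le_one (by positivity)]
          gcongr
      _ = δ := mul_one δ

variable {φ ψ g : Space d → ℝ} {L C M : ℝ}

/-- The contradiction obtained at an interior maximum of the doubled function. -/
theorem false_of_doubled_maximum {ε α γ δ : ℝ} (hε : 0 < ε) (hα : 0 < α) (hδ : 0 < δ)
    {u v : Space d → ℝ → ℝ} (hu : IsClassicalSolution ε φ ψ g u)
    (hv : IsViscositySubsolution φ ψ v) {x₀ y₀ : Space d} {t₀ s₀ : ℝ} (ht₀ : 0 < t₀) (hs₀ : 0 < s₀)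
    (hmax : ∀ x y t s, 0 ≤ t → 0 ≤ s →
      v x t - u y s - quartic α x y - (t - s) ^ 2 / (2 * γ) - δ * t
        ≤ v x₀ t₀ - u y₀ s₀ - quartic α x₀ y₀ - (t₀ - s₀) ^ 2 / (2 * γ) - δ * t₀)
    (hφv : φ x₀ < v x₀ t₀) (hψu : u y₀ s₀ ≤ ψ y₀)
    (herr : 3 * ‖y₀ - x₀‖ ^ 2 / α * (ε ^ 2 / (ε ^ 2 + (‖y₀ - x₀‖ ^ 3 / α) ^ 2)) ≤ δ / 2) :
    False := by
  set U : Space d → ℝ := fun y => u y s₀ with hUdef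
  have hU : ContDiff ℝ 2 U := hu.contDiff_space s₀ hs₀
  set p := ∇ U y₀ with hp
  -- conditions in `y`
  have hloc : IsLocalMax (fun y => - quartic α x₀ y - U y) y₀ := by
    refine Eventually.of_forall fun y => ?_
    have := hmax x₀ y t₀ s₀ ht₀.le hs₀.le
    simp only [hUdef]; linarith
  obtain ⟨h1, h2⟩ := isLocalMax_sub_conditions (neg_contDiff (contDiff_quartic α x₀)) hU hloc
  rw [gradient_neg'] at h1
  have hpn : ‖p‖ = ‖y₀ - x₀‖ ^ 3 / α := by rw [hp, ← h1, norm_neg, norm_gradient_quartic hα]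
  have hHess : ∀ ξ, - (3 * ‖y₀ - x₀‖ ^ 2 / α * ‖ξ‖ ^ 2) ≤ hessForm U y₀ ξ := fun ξ => by
    have h4 := h2 ξ
    rw [hessForm_neg] at h4
    linarith [hessForm_quartic_le hα x₀ y₀ ξ]
  -- condition in `s`
  set ρ := (t₀ - s₀) / γ with hρ
  have hds : deriv (u y₀) s₀ = ρ := by
    have hl : IsLocalMax (fun s => - u y₀ s - (t₀ - s) ^ 2 / (2 * γ)) s₀ := by
      filter_upwards [lt_mem_nhds hs₀] with s hs
      have := hmax x₀ y₀ t₀ s ht₀.le (le_of_lt hs)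
      linarith
    have hd : HasDerivAt (fun s => - u y₀ s - (t₀ - s) ^ 2 / (2 * γ))
        (- deriv (u y₀) s₀ + ρ) s₀ := by
      have a1 := (hu.differentiableAt_time y₀ s₀ hs₀).hasDerivAt.fun_neg
      have a2 := (((hasDerivAt_id' s₀).const_sub t₀).fun_pow 2).div_const (2 * γ)
      refine (a1.fun_sub a2).congr_deriv ?_
      rw [hρ]; simp; ring
    have := hl.hasDerivAt_eq_zero hd
    linarith
  have heq := hu.equation y₀ s₀ hs₀
  rw [hds] at heq
  have hforce : 0 ≤ force ε φ ψ y₀ (u y₀ s₀) := force_nonneg hε hψu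
  have hPforce := mul_nonneg (regNorm_pos hε p).le hforce
  have hρge : ∑ i, pderiv i (pderiv i U) y₀ - hessForm U y₀ p / regNorm ε p ^ 2 ≤ ρ := by
    rw [← projectedHessianTrace_eq_trace_sub]; linarith
  -- the test function
  set κ := δ / (4 * (d + 1)) with hκ
  have hκ0 : 0 < κ := by positivity
  have hκd : κ * d ≤ δ / 4 := by
    rw [hκ, div_mul_eq_mul_div, div_le_div_iff₀ (by positivity) (by norm_num)]
    nlinarith
  set η : Space d × ℝ → ℝ := fun q =>
    taylorPoly U y₀ x₀ κ q.1 + ((q.2 - s₀) ^ 2 / (2 * γ) + δ * q.2) with hη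
  have hηsm : ContDiff ℝ ∞ η := by
    refine ((contDiff_taylorPoly U y₀ x₀ κ).comp contDiff_fst).add ?_
    exact (((contDiff_snd.sub contDiff_const).pow 2).div_const _).add
      (contDiff_const.mul contDiff_snd)
  -- Moving `x` and `y` by the same vector leaves the quartic unchanged, so `v(x) - U(y₀ + x - x₀)`
  -- has a maximum; replacing `U` by its upper Taylor polynomial produces a smooth test function for
  -- `v`.
  have hηmax : IsLocalMax (fun q : Space d × ℝ => v q.1 q.2 - η q) (x₀, t₀) := by
    have e1 : ∀ᶠ q : Space d × ℝ in 𝓝 (x₀, t₀), U (y₀ + (q.1 - x₀)) ≤ U y₀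
        + ∑ i, (q.1 - x₀) i * pderiv i U y₀
        + (hessForm U y₀ (q.1 - x₀) + κ * ‖q.1 - x₀‖ ^ 2) / 2 := by
      have ht : Tendsto (fun q : Space d × ℝ => q.1 - x₀) (𝓝 (x₀, t₀)) (𝓝 0) := by
        have : Continuous (fun q : Space d × ℝ => q.1 - x₀) := by fun_prop
        simpa using this.tendsto (x₀, t₀)
      exact ht.eventually (eventually_le_taylor hU y₀ hκ0)
    have e2 : ∀ᶠ q : Space d × ℝ in 𝓝 (x₀, t₀), 0 < q.2 :=
      (continuous_snd.tendsto (x₀, t₀)).eventually (lt_mem_nhds ht₀)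
    filter_upwards [e1, e2] with q hq1 hq2
    have h3 := hmax q.1 (y₀ + (q.1 - x₀)) q.2 s₀ hq2.le hs₀.le
    have h4 : quartic α q.1 (y₀ + (q.1 - x₀)) = quartic α x₀ y₀ := by
      rw [quartic, quartic]; congr 3; abel
    rw [h4] at h3
    rw [← inner_gradient_eq_sum] at hq1
    have h5 : taylorPoly U y₀ x₀ κ x₀ = 0 := by
      simp [taylorPoly, hessForm]
    simp only [hη, h5]
    simp only [taylorPoly]
    simp only [hUdef] at hq1 h3 ⊢
    linarith
  obtain ⟨hne, hzero⟩ := hv.2 η hηsm x₀ t₀ ht₀ hηmax hφv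
  have hgrad : ∇ (fun y => η (y, t₀)) x₀ = p := by
    simp only [hη]; rw [gradient_add_const, gradient_taylorPoly]
  have htime : deriv (fun s => η (x₀, s)) t₀ = ρ + δ := by
    have a1 := (((hasDerivAt_id' t₀).sub_const s₀).fun_pow 2).div_const (2 * γ)
    have a2 := (hasDerivAt_id' t₀).const_mul δ
    have a3 := (a1.fun_add a2).const_add (taylorPoly U y₀ x₀ κ x₀)
    simp only [hη]
    rw [a3.deriv, hρ]; simp; ring
  have htrace : ∀ (q : Space d) (r : ℝ), 0 < r → ‖q‖ ^ 2 ≤ r →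
      projectedHessianTrace q r (fun y => η (y, t₀)) x₀
        ≤ ∑ i, pderiv i (pderiv i U) y₀ - hessForm U y₀ q / r + δ / 4 := by
    intro q r hr hq
    simp only [hη]
    rw [projectedHessianTrace_add_const, ← projectedHessianTrace_eq_trace_sub]
    refine (projectedHessianTrace_le_add hr hq hκ0.le fun ξ =>
      (hessForm_taylorPoly U y₀ x₀ κ ξ).le).trans ?_
    linarith
  rw [hgrad, htime] at hne hzero
  -- Zero gradient forces `y₀ = x₀`. Then the quartic has zero Hessian there, the Hessian form of
  -- `U` is nonnegative, and any direction `ζ` in the unit ball gives the contradiction.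
  by_cases hp0 : p = 0
  · obtain ⟨ζ, hζ, hle⟩ := hzero hp0
    have h3 := htrace ζ 1 one_pos (by nlinarith [norm_nonneg ζ])
    have hz : ‖y₀ - x₀‖ = 0 := by
      rw [hp0, norm_zero, eq_comm, div_eq_zero_iff] at hpn
      rcases hpn with h | h
      · exact pow_eq_zero_iff (by norm_num) |>.1 h
      · exact absurd h hα.ne'
    have h4 := hHess ζ
    rw [hz] at h4
    rw [hp0] at hρge
    have h5 : hessForm U y₀ 0 = 0 := by simp [hessForm]
    rw [h5] at hρge
    simp at h4 hρge
    linarith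
  · have hle := hne hp0
    have hpn0 : 0 < ‖p‖ := norm_pos_iff.2 hp0
    have h3 := htrace p (‖p‖ ^ 2) (by positivity) le_rfl
    have h4 := hHess p
    rw [regNorm_sq] at hρge
    -- The only discrepancy between the two operators is `|p|_ε²` against `‖p‖²` in the normal
    -- direction; the lower Hessian bound makes it small.
    have h5 : hessForm U y₀ p / (ε ^ 2 + ‖p‖ ^ 2) - hessForm U y₀ p / ‖p‖ ^ 2
        ≤ 3 * ‖y₀ - x₀‖ ^ 2 / α * (ε ^ 2 / (ε ^ 2 + ‖p‖ ^ 2)) := by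
      have h6 : hessForm U y₀ p / (ε ^ 2 + ‖p‖ ^ 2) - hessForm U y₀ p / ‖p‖ ^ 2
          = (- hessForm U y₀ p / ‖p‖ ^ 2) * (ε ^ 2 / (ε ^ 2 + ‖p‖ ^ 2)) := by
        field_simp; ring
      rw [h6]
      refine mul_le_mul_of_nonneg_right ?_ (by positivity)
      rw [div_le_iff₀ (by positivity)]
      linarith
    rw [hpn] at h5
    rw [hpn] at hρge hle h3
    linarith

/-- A viscosity solution is merely continuous at time zero, but periodicity and compactness make its
departure from the initial values uniform in space. -/
theorem exists_initial_modulus {v : Space d → ℝ → ℝ}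
    (hper : ∀ t, 0 ≤ t → IsPeriodic (fun x => v x t))
    (hc : ContinuousOn (fun p : Space d × ℝ => v p.1 p.2) (univ ×ˢ Ici 0)) {m : ℝ} (hm : 0 < m) :
    ∃ τ : ℝ, 0 < τ ∧ ∀ x t, 0 ≤ t → t ≤ τ → v x t ≤ v x 0 + m := by
  have hK : IsCompact (closure (cube d) ×ˢ Icc (0 : ℝ) 1) := isCompact_closure_cube.prod isCompact_Icc
  have huc := hK.uniformContinuousOn_of_continuous
    (hc.mono (prod_mono (subset_univ _) fun s hs => hs.1))
  obtain ⟨r, hr, hrr⟩ := Metric.uniformContinuousOn_iff.1 huc m hm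
  refine ⟨min (r / 2) 1, by positivity, fun x t ht htle => ?_⟩
  obtain ⟨k, hk⟩ := exists_int_shift_mem_Icc x
  set y := x + WithLp.toLp 2 (fun i => (k i : ℝ))
  have h1 : v y t = v x t := hper t ht x k
  have h2 : v y 0 = v x 0 := hper 0 le_rfl x k
  have ht1 : t ≤ 1 := htle.trans (min_le_right _ _)
  have ht2 : t < r := by linarith [htle.trans (min_le_left (r / 2) 1)]
  have := hrr (y, t) ⟨subset_closure hk, ht, ht1⟩ (y, 0)
    ⟨subset_closure hk, left_mem_Icc.2 zero_le_one⟩ (by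
      rw [Prod.dist_eq, dist_self, Real.dist_eq, sub_zero, abs_of_nonneg ht]
      exact max_lt hr ht2)
  rw [Real.dist_eq, h1, h2] at this
  linarith [le_abs_self (v x t - v x 0)]

/-- If the inequality failed, the doubled function would have a large maximum. The initial estimates
exclude time zero. There `v` is strictly above `φ`, so its inequality is available, and `u` is below
`ψ`, so the force on `u` has the favourable sign. `false_of_doubled_maximum` then concludes. -/
theorem exists_subsolution_le (hB : UniformBounds φ ψ g L C M) (hg : ContDiff ℝ 2 g)
    (hgper : IsPeriodic g) (hφψ : ∀ x, φ x < ψ x) (hφg : ∀ x, φ x ≤ g x) (hgψ : ∀ x, g x ≤ ψ x)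
    {v : Space d → ℝ → ℝ} (hv : IsViscositySubsolution φ ψ v) (hv0 : ∀ x, v x 0 ≤ g x)
    {m T : ℝ} (hm : 0 < m) (hT : 0 ≤ T) :
    ∃ ε₀ : ℝ, 0 < ε₀ ∧ ∀ ε, 0 < ε → ε < ε₀ → ∀ u, IsClassicalSolution ε φ ψ g u →
      ∀ x t, 0 ≤ t → t ≤ T → v x t ≤ u x t + m := by
  have hm8 : 0 < m / 8 := by positivity
  -- The time tilt may consume at most half of `m` up to time `T`; the other half pays for errors of
  -- size `m / 8`.
  set δ := m / (2 * (T + 1)) with hδ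
  have hδ0 : 0 < δ := by positivity
  have hδT : ∀ t, t ≤ T → δ * t ≤ m / 2 := fun t ht => by
    rw [hδ, div_mul_eq_mul_div, div_le_div_iff₀ (by positivity) (by norm_num)]
    nlinarith
  obtain ⟨α, hα, hdom⟩ := exists_quartic_dominates hB.L_nonneg hm8
  obtain ⟨τ, hτ, hmod⟩ := exists_initial_modulus hv.1.periodic hv.1.continuousOn hm8
  obtain ⟨N, hN⟩ := hv.1.bounded
  have hN0 : 0 ≤ N := (abs_nonneg _).trans (hN 0 0 le_rfl)
  have hM0 : 0 ≤ M := (abs_nonneg _).trans (hB.abs_lower 0)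
  -- The first condition forces `|t - s| < τ` where the doubled function is large; the second
  -- absorbs the time Lipschitz constant of `u`, by completing the square.
  obtain ⟨γ, hγ, hγ1, hγ2⟩ : ∃ γ : ℝ, 0 < γ ∧ M + N ≤ τ ^ 2 / (2 * γ) ∧
      ∀ r, 0 ≤ r → C * r - r ^ 2 / (2 * γ) ≤ m / 8 := by
    refine ⟨min (τ ^ 2 / (2 * (M + N + 1))) (m / (4 * (C ^ 2 + 1))), by positivity, ?_, ?_⟩
    · rw [le_div_iff₀ (by positivity)]
      have h1 := min_le_left (τ ^ 2 / (2 * (M + N + 1))) (m / (4 * (C ^ 2 + 1)))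
      rw [le_div_iff₀ (by positivity)] at h1
      have h2 : 0 < min (τ ^ 2 / (2 * (M + N + 1))) (m / (4 * (C ^ 2 + 1))) := by positivity
      nlinarith
    · intro r hr
      have h1 := min_le_right (τ ^ 2 / (2 * (M + N + 1))) (m / (4 * (C ^ 2 + 1)))
      have h2 : 0 < min (τ ^ 2 / (2 * (M + N + 1))) (m / (4 * (C ^ 2 + 1))) := by positivity
      set γ := min (τ ^ 2 / (2 * (M + N + 1))) (m / (4 * (C ^ 2 + 1)))
      rw [le_div_iff₀ (by positivity)] at h1
      have h3 : C * r ≤ r ^ 2 / (2 * γ) + C ^ 2 * γ / 2 := by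
        have : r ^ 2 / (2 * γ) + C ^ 2 * γ / 2 - C * r = (r - C * γ) ^ 2 / (2 * γ) := by
          field_simp; ring
        have h4 : 0 ≤ (r - C * γ) ^ 2 / (2 * γ) := by positivity
        linarith
      nlinarith
  obtain ⟨ε₁, hε₁, hlow⟩ := exists_lower_obstacle_bound hB hφψ hφg hgψ hm8
  obtain ⟨ε₂, hε₂, hreg⟩ := exists_regularisation_error_small hα (half_pos hδ0)
  refine ⟨min ε₁ ε₂, by positivity, fun ε hε hεlt u hu x₁ t₁ ht₁ ht₁T => ?_⟩
  by_contra! hcon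
  have hub := hu.abs_le_bound hB hε hφψ hφg hgψ
  have hqd : ∀ f : Space d → ℝ, (∀ x y, |f x - f y| ≤ L * ‖x - y‖) → ∀ x y,
      f x - f y ≤ quartic α x y + m / 8 := fun f hf x y => by
    have h1 := (le_abs_self _).trans (hf x y)
    have h2 := hdom ‖x - y‖ (norm_nonneg _)
    rw [quartic_comm, quartic]; linarith
  set Φ : Space d → Space d → ℝ → ℝ → ℝ := fun x y t s =>
    v x t - u y s - quartic α x y - (t - s) ^ 2 / (2 * γ) - δ * t with hΦ
  have hq0 : ∀ x y : Space d, 0 ≤ quartic α x y := fun x y => quartic_nonneg hα x y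
  have hp0 : ∀ t s : ℝ, 0 ≤ (t - s) ^ 2 / (2 * γ) := fun t s => by positivity
  have hlarge : m / 2 < Φ x₁ x₁ t₁ t₁ := by
    simp only [hΦ, quartic, sub_self, norm_zero]
    have := hδT t₁ ht₁T
    norm_num
    linarith
  obtain ⟨R₀, hR₀⟩ := (Metric.isBounded_iff_subset_closedBall (0 : Space d)).1
    (isBounded_cube (d := d)).closure
  set R := max 1 (4 * α * (M + N)) with hR
  -- the region where the doubled function is large
  have hregion : ∀ x y t s, 0 ≤ t → 0 ≤ s → m / 2 < Φ x y t s →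
      ‖y - x‖ ≤ R ∧ t ≤ (M + N) / δ ∧ |t - s| < τ := by
    intro x y t s ht hs h
    simp only [hΦ] at h
    have b1 := (abs_le.1 (hN x t ht)).2
    have b2 := (abs_le.1 (hub y s hs)).1
    have b3 := hq0 x y
    have b4 := hp0 t s
    have b5 := mul_nonneg hδ0.le ht
    refine ⟨?_, ?_, ?_⟩
    · by_contra! hlt
      have h3 : quartic α x y ≤ M + N := by linarith
      rw [quartic, div_le_iff₀ (by positivity)] at h3
      have h4 : 1 < ‖y - x‖ := (le_max_left _ _).trans_lt hlt
      have h5 : 4 * α * (M + N) < ‖y - x‖ := (le_max_right _ _).trans_lt hlt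
      have h6 : ‖y - x‖ ^ 1 ≤ ‖y - x‖ ^ 4 := pow_le_pow_right₀ h4.le (by norm_num)
      rw [pow_one] at h6
      nlinarith
    · rw [le_div_iff₀ hδ0]; linarith
    · by_contra! hlt
      have h3 : τ ^ 2 ≤ (t - s) ^ 2 := by rw [← sq_abs (t - s)]; gcongr
      have h4 : τ ^ 2 / (2 * γ) ≤ (t - s) ^ 2 / (2 * γ) := by gcongr
      linarith
  -- Only a simultaneous lattice translation preserves the quartic, so `x` is brought into the cube
  -- and `y` follows within distance `R`.
  set K : Set ((Space d × Space d) × (ℝ × ℝ)) :=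
    (closure (cube d) ×ˢ Metric.closedBall 0 (R₀ + R)) ×ˢ
      (Icc 0 ((M + N) / δ) ×ˢ Icc 0 ((M + N) / δ + τ)) with hK
  have hKc : IsCompact K := (isCompact_closure_cube.prod (isCompact_closedBall _ _)).prod
    (isCompact_Icc.prod isCompact_Icc)
  have hcont : ContinuousOn (fun q : (Space d × Space d) × (ℝ × ℝ) =>
      Φ q.1.1 q.1.2 q.2.1 q.2.2) K := by
    have c1 : ContinuousOn (fun q : (Space d × Space d) × (ℝ × ℝ) => v q.1.1 q.2.1) K :=
      hv.1.continuousOn.comp (f := fun q : (Space d × Space d) × (ℝ × ℝ) => (q.1.1, q.2.1))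
        (by fun_prop) fun q hq => ⟨mem_univ _, hq.2.1.1⟩
    have c2 : ContinuousOn (fun q : (Space d × Space d) × (ℝ × ℝ) => u q.1.2 q.2.2) K :=
      hu.continuousOn.comp (f := fun q : (Space d × Space d) × (ℝ × ℝ) => (q.1.2, q.2.2))
        (by fun_prop) fun q hq => ⟨mem_univ _, hq.2.2.1⟩
    have c3 : Continuous (fun q : (Space d × Space d) × (ℝ × ℝ) => quartic α q.1.1 q.1.2
        + (q.2.1 - q.2.2) ^ 2 / (2 * γ) + δ * q.2.1) := by
      unfold quartic; fun_prop
    refine ((c1.sub c2).sub c3.continuousOn).congr fun q _ => ?_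
    simp only [hΦ, Pi.sub_apply]; ring
  have hshift : ∀ x y t s, 0 ≤ t → 0 ≤ s → m / 2 < Φ x y t s →
      ∃ x' y', ((x', y'), (t, s)) ∈ K ∧ Φ x' y' t s = Φ x y t s := by
    intro x y t s ht hs h
    obtain ⟨r1, r2, r3⟩ := hregion x y t s ht hs h
    obtain ⟨k, hk⟩ := exists_int_shift_mem_Icc x
    set κ : Space d := WithLp.toLp 2 (fun i => (k i : ℝ)) with hκ
    refine ⟨x + κ, y + κ, ⟨⟨subset_closure hk, ?_⟩, ⟨ht, r2⟩, hs, ?_⟩, ?_⟩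
    · have h1 := hR₀ (subset_closure hk)
      rw [mem_closedBall_zero_iff] at h1 ⊢
      calc ‖y + κ‖ = ‖(x + κ) + (y - x)‖ := by congr 1; abel
        _ ≤ _ := (norm_add_le _ _).trans (add_le_add h1 r1)
    · simp only
      linarith [(abs_lt.1 r3).1]
    · simp only [hΦ]
      have h1 : v (x + κ) t = v x t := hv.1.periodic t ht x k
      have h2 : u (y + κ) s = u y s := hu.periodic s hs y k
      have h3 : quartic α (x + κ) (y + κ) = quartic α x y := by
        rw [quartic, quartic, add_sub_add_right_eq_sub]
      rw [h1, h2, h3]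
  obtain ⟨x', y', hmem, -⟩ := hshift x₁ x₁ t₁ t₁ ht₁ ht₁ hlarge
  obtain ⟨⟨⟨x₀, y₀⟩, ⟨t₀, s₀⟩⟩, hmem₀, hmaxK⟩ := hKc.exists_isMaxOn ⟨_, hmem⟩ hcont
  have ht₀ : 0 ≤ t₀ := hmem₀.2.1.1
  have hs₀ : 0 ≤ s₀ := hmem₀.2.2.1
  have hbig : m / 2 < Φ x₀ y₀ t₀ s₀ := by
    obtain ⟨a, b, hab, he⟩ := hshift x₁ x₁ t₁ t₁ ht₁ ht₁ hlarge
    have := hmaxK hab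
    simp only [mem_ofPred_eq] at this
    linarith
  have hmaxAll : ∀ x y t s, 0 ≤ t → 0 ≤ s → Φ x y t s ≤ Φ x₀ y₀ t₀ s₀ := by
    intro x y t s ht hs
    by_cases h : m / 2 < Φ x y t s
    · obtain ⟨a, b, hab, he⟩ := hshift x y t s ht hs h
      have := hmaxK hab
      simp only [mem_ofPred_eq] at this
      linarith
    · linarith
  have hbig' := hbig
  simp only [hΦ] at hbig'
  have hgq := hqd g hB.lip_initial x₀ y₀
  have hδt := mul_nonneg hδ0.le ht₀
  -- At `t₀ = 0` the difference is at most that of `g` plus the drift `C s₀`, each paid for by its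
  -- penalisation up to `m / 8`.
  have ht₀pos : 0 < t₀ := by
    refine lt_of_le_of_ne ht₀ fun h => ?_
    rw [← h] at hbig'
    have h1 := (abs_le.1 (hu.abs_sub_initial_le hB hε hg hgper hφg hgψ y₀ s₀ hs₀)).1
    have h2 := hγ2 s₀ hs₀
    rw [zero_sub, neg_sq] at hbig'
    linarith [hv0 x₀]
  -- At `s₀ = 0` the time `t₀` is below `τ`, so `v` has risen by at most `m / 8` above its initial
  -- values.
  have hs₀pos : 0 < s₀ := by
    refine lt_of_le_of_ne hs₀ fun h => ?_
    obtain ⟨-, -, r3⟩ := hregion x₀ y₀ t₀ s₀ ht₀ hs₀ hbig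
    rw [← h, sub_zero, abs_of_nonneg ht₀] at r3
    have h1 := hmod x₀ t₀ ht₀ r3.le
    have h3 := hp0 t₀ s₀
    rw [← h] at hbig' h3
    rw [hu.initial] at hbig'
    linarith [hv0 x₀]
  have hp1 := hp0 t₀ s₀
  refine false_of_doubled_maximum hε hα hδ0 hu hv ht₀pos hs₀pos hmaxAll ?_ ?_ ?_
  · have h1 := hlow ε hε (hεlt.trans_le (min_le_left _ _)) u hu y₀ s₀ hs₀
    have h2 := hqd φ hB.lip_lower x₀ y₀
    linarith
  · have h1 := (hv.1.obstacles x₀ t₀ ht₀).2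
    have h2 := hqd ψ hB.lip_upper x₀ y₀
    linarith
  · exact hreg ε hε (hεlt.trans_le (min_le_right _ _)) _ (norm_nonneg _)

/-! ### Reflection of viscosity solutions -/

section Reflection

variable {φ ψ : Space d → ℝ} {v : Space d → ℝ → ℝ}

theorem IsAdmissible.neg (h : IsAdmissible φ ψ v) :
    IsAdmissible (fun x => - ψ x) (fun x => - φ x) (fun x t => - v x t) where
  periodic t ht := (h.periodic t ht).neg
  continuousOn := h.continuousOn.neg
  bounded := by
    obtain ⟨M, hM⟩ := h.bounded
    exact ⟨M, fun x t ht => by rw [abs_neg]; exact hM x t ht⟩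
  obstacles x t ht := ⟨neg_le_neg (h.obstacles x t ht).2, neg_le_neg (h.obstacles x t ht).1⟩

theorem IsViscositySupersolution.neg (h : IsViscositySupersolution φ ψ v) :
    IsViscositySubsolution (fun x => - ψ x) (fun x => - φ x) (fun x t => - v x t) := by
  refine ⟨h.1.neg, fun η hη x₀ t₀ ht₀ hmax hobs => ?_⟩
  have hmin : IsLocalMin (fun p : Space d × ℝ => v p.1 p.2 - (fun q => - η q) p) (x₀, t₀) := by
    filter_upwards [hmax] with p hp
    linarith
  obtain ⟨h1, h2⟩ := h.2 (fun q => - η q) hη.neg x₀ t₀ ht₀ hmin (by linarith)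
  have hd : deriv (fun s => - η (x₀, s)) t₀ = - deriv (fun s => η (x₀, s)) t₀ := deriv.fun_neg
  simp only [gradient_neg', norm_neg, projectedHessianTrace_neg_left, projectedHessianTrace_neg,
    hd] at h1 h2
  refine ⟨fun hne => ?_, fun h0 => ?_⟩
  · linarith [h1 (neg_ne_zero.2 hne)]
  · obtain ⟨ζ, hζ, hle⟩ := h2 (neg_eq_zero.2 h0)
    exact ⟨ζ, hζ, by linarith⟩

theorem IsViscositySubsolution.neg (h : IsViscositySubsolution φ ψ v) :
    IsViscositySupersolution (fun x => - ψ x) (fun x => - φ x) (fun x t => - v x t) := by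
  refine ⟨h.1.neg, fun η hη x₀ t₀ ht₀ hmin hobs => ?_⟩
  have hmax : IsLocalMax (fun p : Space d × ℝ => v p.1 p.2 - (fun q => - η q) p) (x₀, t₀) := by
    filter_upwards [hmin] with p hp
    linarith
  obtain ⟨h1, h2⟩ := h.2 (fun q => - η q) hη.neg x₀ t₀ ht₀ hmax (by linarith)
  have hd : deriv (fun s => - η (x₀, s)) t₀ = - deriv (fun s => η (x₀, s)) t₀ := deriv.fun_neg
  simp only [gradient_neg', norm_neg, projectedHessianTrace_neg_left, projectedHessianTrace_neg,
    hd] at h1 h2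
  refine ⟨fun hne => ?_, fun h0 => ?_⟩
  · linarith [h1 (neg_ne_zero.2 hne)]
  · obtain ⟨ζ, hζ, hle⟩ := h2 (neg_eq_zero.2 h0)
    exact ⟨ζ, hζ, by linarith⟩

end Reflection

/-! ### Space-time derivatives of smooth functions -/

theorem pderiv_slice {w : Space d × ℝ → ℝ} (hw : Differentiable ℝ w) (j : Fin d) (x : Space d)
    (t : ℝ) : pderiv j (fun y => w (y, t)) x
      = fderiv ℝ w (x, t) (EuclideanSpace.single j 1, 0) := by
  have h1 : HasFDerivAt (fun y : Space d => (y, t)) (ContinuousLinearMap.inl ℝ (Space d) ℝ) x :=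
    hasFDerivAt_prodMk_left x t
  have h2 := (hw (x, t)).hasFDerivAt.comp x h1
  rw [pderiv]
  have h3 : fderiv ℝ (fun y => w (y, t)) x
      = (fderiv ℝ w (x, t)).comp (ContinuousLinearMap.inl ℝ (Space d) ℝ) := h2.fderiv
  rw [h3]; simp

theorem deriv_slice {w : Space d × ℝ → ℝ} (hw : Differentiable ℝ w) (x : Space d) (t : ℝ) :
    deriv (fun s => w (x, s)) t = fderiv ℝ w (x, t) (0, 1) := by
  have h1 : HasDerivAt (fun s : ℝ => (x, s)) ((0 : Space d), (1 : ℝ)) t :=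
    (hasDerivAt_const t x).prodMk (hasDerivAt_id t)
  exact ((hw (x, t)).hasFDerivAt.comp_hasDerivAt t h1).deriv

theorem contDiff_pderiv_slice {w : Space d × ℝ → ℝ} (hw : ContDiff ℝ ∞ w) (j : Fin d) :
    ContDiff ℝ ∞ (fun p : Space d × ℝ => pderiv j (fun y => w (y, p.2)) p.1) := by
  have hd : Differentiable ℝ w := hw.differentiable (by simp)
  simp_rw [pderiv_slice hd]
  exact (hw.fderiv_right (m := ∞) (by norm_num)).clm_apply contDiff_const

theorem continuous_pderiv₂_slice {w : Space d × ℝ → ℝ} (hw : ContDiff ℝ ∞ w) (i j : Fin d) :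
    Continuous (fun p : Space d × ℝ => pderiv i (pderiv j (fun y => w (y, p.2))) p.1) :=
  (contDiff_pderiv_slice (contDiff_pderiv_slice hw j) i).continuous

theorem continuous_gradient_slice {w : Space d × ℝ → ℝ} (hw : ContDiff ℝ ∞ w) :
    Continuous (fun p : Space d × ℝ => ∇ (fun y => w (y, p.2)) p.1) := by
  have h : Continuous (fun p : Space d × ℝ => fun i => (∇ (fun y => w (y, p.2)) p.1) i) := by
    refine continuous_pi fun i => ?_
    simp_rw [gradient_apply_eq_pderiv]
    exact (contDiff_pderiv_slice hw i).continuous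
  exact (PiLp.continuous_toLp 2 _).comp h

theorem continuous_deriv_slice {w : Space d × ℝ → ℝ} (hw : ContDiff ℝ ∞ w) :
    Continuous (fun p : Space d × ℝ => deriv (fun s => w (p.1, s)) p.2) := by
  have hd : Differentiable ℝ w := hw.differentiable (by simp)
  simp_rw [deriv_slice hd]
  exact ((hw.fderiv_right (m := ∞) (by norm_num)).clm_apply contDiff_const).continuous

theorem continuous_projectedHessianTrace_slice {w : Space d × ℝ → ℝ} (hw : ContDiff ℝ ∞ w) :
    Continuous (fun p : Space d × (Space d × ℝ) =>
      projectedHessianTrace p.1 1 (fun y => w (y, p.2.2)) p.2.1) := by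
  unfold projectedHessianTrace
  refine continuous_finsetSum _ fun i _ => continuous_finsetSum _ fun j _ => ?_
  refine Continuous.mul (by fun_prop) ?_
  exact (continuous_pderiv₂_slice hw i j).comp continuous_snd

/-- The regularised and the limiting operators are both of the form `projectedHessianTrace ζ 1` with
`ζ` in the unit ball. Compactness of that ball allows passing to the limit even where the gradient
vanishes. -/
theorem projectedHessianTrace_smul {c s : ℝ} (q : Space d) (v : Space d → ℝ) (x : Space d)
    (h : c ^ 2 = 1 / s) :
    projectedHessianTrace (c • q) 1 v x = projectedHessianTrace q s v x := by
  simp only [projectedHessianTrace]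
  refine Finset.sum_congr rfl fun i _ => Finset.sum_congr rfl fun j _ => ?_
  congr 2
  have : q i * q j / s = c ^ 2 * (q i * q j) := by rw [h]; ring
  rw [this]; simp; ring

theorem norm_regNormal_le {ε : ℝ} (hε : 0 < ε) (p : Space d) : ‖regNormal ε p‖ ≤ 1 := by
  rw [regNormal, norm_smul, norm_inv, Real.norm_of_nonneg (regNorm_pos hε p).le,
    inv_mul_le_one₀ (regNorm_pos hε p)]
  exact norm_le_regNorm ε p

/-! ### Stability -/

/-- The penalisation at the maximiser is bounded by twice the uniform distance between `u k` and
`u₀`, hence tends to zero. -/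
theorem tendsto_penalised_maximisers {u : ℕ → Space d × ℝ → ℝ} {u₀ η : Space d × ℝ → ℝ}
    {x₀ : Space d} {t₀ : ℝ} {K : Set (Space d × ℝ)} (hK0 : (x₀, t₀) ∈ K)
    (hconv : TendstoUniformlyOn u u₀ atTop K) (hmax : ∀ p ∈ K, u₀ p - η p ≤ u₀ (x₀, t₀) - η (x₀, t₀))
    {p : ℕ → Space d × ℝ} (hpK : ∀ k, p k ∈ K)
    (hp : ∀ k, u k (x₀, t₀) - η (x₀, t₀)
      ≤ u k (p k) - η (p k) - (‖(p k).1 - x₀‖ ^ 4 + ((p k).2 - t₀) ^ 2)) :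
    Tendsto p atTop (𝓝 (x₀, t₀)) := by
  rw [Metric.tendsto_nhds]
  intro e he
  have hmin : 0 < min (e ^ 4) (e ^ 2) := by positivity
  filter_upwards [Metric.tendstoUniformlyOn_iff.1 hconv (min (e ^ 4) (e ^ 2) / 2) (by positivity)]
    with k hk
  have h1 := hk _ hK0
  have h2 := hk _ (hpK k)
  rw [Real.dist_eq] at h1 h2
  have h3 := (abs_lt.1 h1).2
  have h4 := (abs_lt.1 h2).1
  have h5 := hmax _ (hpK k)
  have h6 := hp k
  have h7 : ‖(p k).1 - x₀‖ ^ 4 + ((p k).2 - t₀) ^ 2 < min (e ^ 4) (e ^ 2) := by linarith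
  rw [Prod.dist_eq, max_lt_iff, dist_eq_norm, Real.dist_eq]
  constructor
  · refine lt_of_pow_lt_pow_left₀ 4 he.le ?_
    nlinarith [min_le_left (e ^ 4) (e ^ 2), sq_nonneg ((p k).2 - t₀)]
  · refine lt_of_pow_lt_pow_left₀ 2 he.le ?_
    rw [sq_abs]
    have : 0 ≤ ‖(p k).1 - x₀‖ ^ 4 := by positivity
    nlinarith [min_le_right (e ^ 4) (e ^ 2)]

theorem hessForm_add {v w : Space d → ℝ} (hv : ContDiff ℝ 2 v) (hw : ContDiff ℝ 2 w)
    (x ξ : Space d) : hessForm (fun y => v y + w y) x ξ = hessForm v x ξ + hessForm w x ξ := by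
  have h := hessForm_sub hv (neg_contDiff hw) x ξ
  rw [hessForm_neg] at h
  simpa using h

theorem gradient_add' {v w : Space d → ℝ} (hv : ContDiff ℝ 2 v) (hw : ContDiff ℝ 2 w)
    (x : Space d) : ∇ (fun y => v y + w y) x = ∇ v x + ∇ w x := by
  ext i
  rw [PiLp.add_apply, gradient_apply_eq_pderiv, gradient_apply_eq_pderiv, gradient_apply_eq_pderiv,
    pderiv_add (hv.differentiable two_ne_zero x) (hw.differentiable two_ne_zero x)]

/-- The approximations touch the perturbed test function at points converging to the contact point.
There they lie above `φ`, so the force is nonpositive and can be dropped before taking the limit. -/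
theorem isViscositySubsolution_of_tendsto {φ ψ g : Space d → ℝ} {ε : ℕ → ℝ} (hφ : Continuous φ)
    (hε : ∀ k, 0 < ε k) (hε0 : Tendsto ε atTop (𝓝 0)) {uε : ℕ → Space d → ℝ → ℝ}
    (huε : ∀ k, IsClassicalSolution (ε k) φ ψ g (uε k)) {u : Space d → ℝ → ℝ}
    (hadm : IsAdmissible φ ψ u)
    (hconv : ∀ T, 0 < T → TendstoUniformlyOn (fun k (p : Space d × ℝ) => uε k p.1 p.2)
      (fun p => u p.1 p.2) atTop (univ ×ˢ Icc 0 T)) :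
    IsViscositySubsolution φ ψ u := by
  refine ⟨hadm, fun η hη x₀ t₀ ht₀ hmax hobs => ?_⟩
  obtain ⟨r₁, hr₁, hball⟩ := Metric.eventually_nhds_iff.1 hmax
  set r := min (r₁ / 2) (t₀ / 2) with hr
  have hr0 : 0 < r := by positivity
  set K : Set (Space d × ℝ) := Metric.closedBall (x₀, t₀) r with hK
  have hKc : IsCompact K := isCompact_closedBall _ _
  have hK0 : (x₀, t₀) ∈ K := Metric.mem_closedBall_self hr0.le
  have hKt : ∀ p ∈ K, 0 < p.2 ∧ p.2 ≤ 2 * t₀ := fun p hp => by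
    rw [hK, Metric.mem_closedBall, Prod.dist_eq, max_le_iff, Real.dist_eq] at hp
    have h1 := abs_le.1 (hp.2.trans (min_le_right _ _))
    constructor <;> linarith [h1.1, h1.2]
  have hKsub : K ⊆ univ ×ˢ Icc 0 (2 * t₀) := fun p hp => ⟨mem_univ _, (hKt p hp).1.le, (hKt p hp).2⟩
  have hKmax : ∀ p ∈ K, u p.1 p.2 - η p ≤ u x₀ t₀ - η (x₀, t₀) := fun p hp => by
    refine hball (lt_of_le_of_lt (Metric.mem_closedBall.1 hp) ?_)
    linarith [min_le_left (r₁ / 2) (t₀ / 2)]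
  have hconvK := (hconv (2 * t₀) (by positivity)).mono hKsub
  -- the perturbed test function
  set η' : Space d × ℝ → ℝ := fun p => (η p + quartic (1 / 4) x₀ p.1) + (p.2 - t₀) ^ 2 with hη'
  have hη's : ContDiff ℝ ∞ η' :=
    (hη.add ((contDiff_quartic _ _).comp contDiff_fst)).add
      ((contDiff_snd.sub contDiff_const).pow 2)
  have hq4 : ∀ x, quartic (1 / 4) x₀ x = ‖x - x₀‖ ^ 4 := fun x => by rw [quartic]; norm_num
  have hcont : ∀ k, ContinuousOn (fun p : Space d × ℝ => uε k p.1 p.2 - η' p) K := fun k =>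
    ((huε k).continuousOn.mono (hKsub.trans (prod_mono_right Icc_subset_Ici_self))).sub
      hη's.continuous.continuousOn
  choose p hpK hpmax using fun k => hKc.exists_isMaxOn ⟨_, hK0⟩ (hcont k)
  have hplim : Tendsto p atTop (𝓝 (x₀, t₀)) := by
    refine tendsto_penalised_maximisers hK0 hconvK hKmax hpK fun k => ?_
    have := hpmax k hK0
    simp only [mem_ofPred_eq, hη', hq4, sub_self, norm_zero] at this
    simp only
    linarith
  have hulim : Tendsto (fun k => uε k (p k).1 (p k).2) atTop (𝓝 (u x₀ t₀)) := by
    have hcu : ContinuousWithinAt (fun q : Space d × ℝ => u q.1 q.2) K (x₀, t₀) :=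
      (hadm.continuousOn.mono (hKsub.trans (prod_mono_right Icc_subset_Ici_self))) _ hK0
    have hpw : Tendsto p atTop (𝓝[K] (x₀, t₀)) :=
      tendsto_nhdsWithin_iff.2 ⟨hplim, Eventually.of_forall hpK⟩
    exact hconvK.tendsto_comp hcu hpw
  set ζ : ℕ → Space d := fun k => regNormal (ε k) (∇ (fun y => η' (y, (p k).2)) (p k).1) with hζ
  have hineq : ∀ᶠ k in atTop, deriv (fun s => η' ((p k).1, s)) (p k).2
      ≤ projectedHessianTrace (ζ k) 1 (fun y => η' (y, (p k).2)) (p k).1 := by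
    have e1 : ∀ᶠ k in atTop, p k ∈ Metric.ball (x₀, t₀) r :=
      hplim.eventually (Metric.ball_mem_nhds _ hr0)
    have e2 : ∀ᶠ k in atTop, φ (p k).1 < uε k (p k).1 (p k).2 := by
      have hφl : Tendsto (fun k => φ (p k).1) atTop (𝓝 (φ x₀)) :=
        (hφ.tendsto x₀).comp ((continuous_fst.tendsto _).comp hplim)
      exact hφl.eventually_lt hulim hobs
    filter_upwards [e1, e2] with k hk1 hk2
    have htk := (hKt _ (hpK k)).1
    have hloc : IsLocalMax (fun q : Space d × ℝ => uε k q.1 q.2 - η' q) (p k) := by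
      filter_upwards [Metric.isOpen_ball.mem_nhds hk1] with q hq
      exact hpmax k (Metric.ball_subset_closedBall hq)
    have hlocx : IsLocalMax (fun y => uε k y (p k).2 - η' (y, (p k).2)) (p k).1 := by
      have : Tendsto (fun y : Space d => (y, (p k).2)) (𝓝 (p k).1) (𝓝 (p k)) :=
        (Continuous.prodMk_left (p k).2).tendsto _
      exact this.eventually hloc
    have hloct : IsLocalMax (fun s => uε k (p k).1 s - η' ((p k).1, s)) (p k).2 := by
      have : Tendsto (fun s : ℝ => ((p k).1, s)) (𝓝 (p k).2) (𝓝 (p k)) :=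
        (Continuous.prodMk_right (p k).1).tendsto _
      exact this.eventually hloc
    have hC2 : ContDiff ℝ 2 (fun y => η' (y, (p k).2)) :=
      (hη's.comp (contDiff_prodMk_left (p k).2)).of_le ENat.LEInfty.out
    obtain ⟨hgr, hhess⟩ := isLocalMax_sub_conditions ((huε k).contDiff_space _ htk) hC2 hlocx
    have hdt : deriv (uε k (p k).1) (p k).2 = deriv (fun s => η' ((p k).1, s)) (p k).2 := by
      have h1 := ((huε k).differentiableAt_time (p k).1 _ htk).hasDerivAt
      have h2 : DifferentiableAt ℝ (fun s => η' ((p k).1, s)) (p k).2 :=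
        ((hη's.comp (contDiff_prodMk_right (p k).1)).differentiable (by simp)) _
      have := hloct.hasDerivAt_eq_zero (h1.fun_sub h2.hasDerivAt)
      linarith
    have heq := (huε k).equation (p k).1 _ htk
    rw [hdt, hgr] at heq
    have hf := mul_nonpos_of_nonneg_of_nonpos
      (regNorm_pos (hε k) (∇ (fun y => η' (y, (p k).2)) (p k).1)).le
      (force_nonpos (ψ := ψ) (hε k) hk2.le)
    have hcmp := projectedHessianTrace_le (pow_pos (regNorm_pos (hε k)
      (∇ (fun y => η' (y, (p k).2)) (p k).1)) 2) (norm_sq_le_regNorm_sq _ _) hhess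
    rw [hζ]
    simp only [regNormal]
    rw [projectedHessianTrace_smul (s := regNorm (ε k) (∇ (fun y => η' (y, (p k).2)) (p k).1) ^ 2)
      _ _ _ (by rw [inv_pow, one_div])]
    linarith
  -- The regularised normals need not converge when the gradient tends to zero; any cluster point
  -- provides the direction required by the definition.
  obtain ⟨ζ₀, hζ₀, σ, hσ, hσlim⟩ := (isCompact_closedBall (0 : Space d) 1).tendsto_subseq
    (x := ζ) (fun k => by rw [mem_closedBall_zero_iff]; exact norm_regNormal_le (hε k) _)
  have hpσ : Tendsto (p ∘ σ) atTop (𝓝 (x₀, t₀)) := hplim.comp hσ.tendsto_atTop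
  have hlimit : deriv (fun s => η' (x₀, s)) t₀
      ≤ projectedHessianTrace ζ₀ 1 (fun y => η' (y, t₀)) x₀ := by
    refine le_of_tendsto_of_tendsto (((continuous_deriv_slice hη's).tendsto _).comp hpσ)
      (((continuous_projectedHessianTrace_slice hη's).tendsto (ζ₀, (x₀, t₀))).comp
        (hσlim.prodMk_nhds hpσ)) ?_
    exact hσ.tendsto_atTop.eventually hineq
  have hηx : ContDiff ℝ 2 (fun y => η (y, t₀)) :=
    (hη.comp (contDiff_prodMk_left t₀)).of_le ENat.LEInfty.out
  have hform : (fun y => η' (y, t₀)) = fun y => (η (y, t₀) + quartic (1 / 4) x₀ y) + 0 := by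
    funext y; simp [hη']
  have htime : deriv (fun s => η' (x₀, s)) t₀ = deriv (fun s => η (x₀, s)) t₀ := by
    have h2 : DifferentiableAt ℝ (fun s => η (x₀, s)) t₀ :=
      ((hη.comp (contDiff_prodMk_right x₀)).differentiable (by simp)) _
    have h3 := ((hasDerivAt_id' t₀).sub_const t₀).fun_pow 2
    have := ((h2.hasDerivAt.add_const (quartic (1 / 4) x₀ x₀)).fun_add h3).deriv
    simp only [hη']
    rw [this]; simp
  have hgrad : ∇ (fun y => η' (y, t₀)) x₀ = ∇ (fun y => η (y, t₀)) x₀ := by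
    rw [hform, gradient_add_const, gradient_add' hηx (contDiff_quartic _ _),
      gradient_quartic (by norm_num)]
    simp
  have htr : projectedHessianTrace ζ₀ 1 (fun y => η' (y, t₀)) x₀
      ≤ projectedHessianTrace ζ₀ 1 (fun y => η (y, t₀)) x₀ := by
    rw [hform, projectedHessianTrace_add_const]
    have hζ1 : ‖ζ₀‖ ≤ 1 := mem_closedBall_zero_iff.1 hζ₀
    refine projectedHessianTrace_le one_pos (by nlinarith [norm_nonneg ζ₀]) fun ξ => ?_
    rw [hessForm_add hηx (contDiff_quartic _ _), hessForm_quartic (by norm_num)]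
    simp
  rw [htime] at hlimit
  refine ⟨fun hne => ?_, fun _ => ⟨ζ₀, mem_closedBall_zero_iff.1 hζ₀, hlimit.trans htr⟩⟩
  have hζeq : ζ₀ = ‖∇ (fun y => η (y, t₀)) x₀‖⁻¹ • ∇ (fun y => η (y, t₀)) x₀ := by
    have hgl : Tendsto (fun k => ∇ (fun y => η' (y, (p (σ k)).2)) (p (σ k)).1) atTop
        (𝓝 (∇ (fun y => η (y, t₀)) x₀)) := by
      rw [← hgrad]
      exact ((continuous_gradient_slice hη's).tendsto _).comp hpσ
    have hnl : Tendsto (fun k => regNorm (ε (σ k))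
        (∇ (fun y => η' (y, (p (σ k)).2)) (p (σ k)).1)) atTop
        (𝓝 ‖∇ (fun y => η (y, t₀)) x₀‖) := by
      have h1 : Tendsto (fun k => ε (σ k)) atTop (𝓝 0) := hε0.comp hσ.tendsto_atTop
      have h2 := ((h1.pow 2).add (hgl.norm.pow 2)).sqrt
      simpa [regNorm] using h2
    have := (hnl.inv₀ (norm_ne_zero_iff.2 hne)).smul hgl
    exact tendsto_nhds_unique hσlim this
  have hfinal := hlimit.trans htr
  rwa [hζeq, projectedHessianTrace_smul (s := ‖∇ (fun y => η (y, t₀)) x₀‖ ^ 2) _ _ _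
    (by rw [inv_pow, one_div])] at hfinal

/-! ### Compactness of equi-Lipschitz sequences -/

theorem tendstoUniformlyOn_of_lipschitz {X : Type*} [PseudoMetricSpace X] {f : ℕ → X → ℝ}
    {f₀ : X → ℝ} {K : NNReal} (hf : ∀ k, LipschitzWith K (f k)) (hf₀ : LipschitzWith K f₀)
    (hpt : ∀ x, Tendsto (fun k => f k x) atTop (𝓝 (f₀ x))) {S : Set X} (hS : IsCompact S) :
    TendstoUniformlyOn f f₀ atTop S := by
  rw [Metric.tendstoUniformlyOn_iff]
  intro e he
  set r : ℝ := e / (4 * (K + 1)) with hr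
  have hr0 : 0 < r := by positivity
  have hKr : K * r ≤ e / 4 := by
    rw [hr, mul_div_assoc', div_le_div_iff₀ (by positivity) (by norm_num)]
    nlinarith [K.coe_nonneg]
  obtain ⟨F, -, hFfin, hFcov⟩ := hS.finite_cover_balls hr0
  have hev : ∀ᶠ k in atTop, ∀ y ∈ F, dist (f k y) (f₀ y) < e / 4 :=
    (hFfin.eventually_all).2 fun y _ => Metric.tendsto_nhds.1 (hpt y) _ (by positivity)
  filter_upwards [hev] with k hk x hx
  obtain ⟨y, hyF, hxy⟩ := mem_iUnion₂.1 (hFcov hx)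
  have hd : dist x y < r := hxy
  have h1 := (hf k).dist_le_mul x y
  have h2 := hf₀.dist_le_mul x y
  have h3 : (K : ℝ) * dist x y ≤ e / 4 := (mul_le_mul_of_nonneg_left hd.le K.coe_nonneg).trans hKr
  have h4 := dist_triangle4 (f₀ x) (f₀ y) (f k y) (f k x)
  rw [dist_comm (f₀ y), dist_comm (f k y) (f k x)] at h4
  linarith [hk y hyF]

/-- Arzelà–Ascoli without a diagonal sequence: sequential compactness of a countable product of
intervals gives convergence on a dense sequence, and the common Lipschitz constant spreads it. -/
theorem exists_subseq_tendstoUniformlyOn {X : Type*} [PseudoMetricSpace X]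
    [TopologicalSpace.SeparableSpace X] [Nonempty X] {f : ℕ → X → ℝ} {K : NNReal} {M : ℝ}
    (hf : ∀ k, LipschitzWith K (f k)) (hM : ∀ k x, |f k x| ≤ M) :
    ∃ σ : ℕ → ℕ, StrictMono σ ∧ ∃ f₀ : X → ℝ, LipschitzWith K f₀ ∧
      (∀ x, Tendsto (fun k => f (σ k) x) atTop (𝓝 (f₀ x))) ∧
      ∀ S, IsCompact S → TendstoUniformlyOn (fun k => f (σ k)) f₀ atTop S := by
  set D := TopologicalSpace.denseSeq X
  have hcpt : IsCompact (Set.pi univ fun _ : ℕ => Icc (-M) M) :=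
    isCompact_univ_pi fun _ => isCompact_Icc
  obtain ⟨a, -, σ, hσ, hlim⟩ := hcpt.tendsto_subseq (x := fun k n => f k (D n))
    (fun k n _ => abs_le.1 (hM k (D n)))
  rw [tendsto_pi_nhds] at hlim
  have hcauchy : ∀ x, CauchySeq (fun k => f (σ k) x) := by
    intro x
    rw [Metric.cauchySeq_iff']
    intro e he
    set r : ℝ := e / (4 * (K + 1)) with hr
    have hr0 : 0 < r := by positivity
    have hKr : K * r ≤ e / 4 := by
      rw [hr, mul_div_assoc', div_le_div_iff₀ (by positivity) (by norm_num)]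
      nlinarith [K.coe_nonneg]
    obtain ⟨n, hn⟩ := (TopologicalSpace.denseRange_denseSeq X).exists_dist_lt x hr0
    obtain ⟨N, hN⟩ := Metric.cauchySeq_iff'.1 (hlim n).cauchySeq (e / 4) (by positivity)
    refine ⟨N, fun k hk => ?_⟩
    have h1 := (hf (σ k)).dist_le_mul x (D n)
    have h2 := (hf (σ N)).dist_le_mul x (D n)
    have h3 : (K : ℝ) * dist x (D n) ≤ e / 4 :=
      (mul_le_mul_of_nonneg_left hn.le K.coe_nonneg).trans hKr
    have h4 := dist_triangle4 (f (σ k) x) (f (σ k) (D n)) (f (σ N) (D n)) (f (σ N) x)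
    rw [dist_comm (f (σ N) (D n)) (f (σ N) x)] at h4
    have h5 := hN k hk
    simp only [Function.comp] at h5
    linarith
  choose f₀ hf₀ using fun x => cauchySeq_tendsto_of_complete (hcauchy x)
  have hlip : LipschitzWith K f₀ := by
    refine LipschitzWith.of_dist_le_mul fun x y => ?_
    exact le_of_tendsto' ((hf₀ x).dist (hf₀ y)) fun k => (hf (σ k)).dist_le_mul x y
  exact ⟨σ, hσ, f₀, hlip, hf₀, fun S hS =>
    tendstoUniformlyOn_of_lipschitz (fun k => hf (σ k)) hlip hf₀ hS⟩

theorem tendstoUniformlyOn_of_periodic {v : ℕ → Space d → ℝ → ℝ} {v₀ : Space d → ℝ → ℝ}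
    (hv : ∀ k t, 0 ≤ t → IsPeriodic (fun x => v k x t)) (hv₀ : ∀ t, 0 ≤ t → IsPeriodic (fun x => v₀ x t))
    {T : ℝ} (h : TendstoUniformlyOn (fun k (p : Space d × ℝ) => v k p.1 p.2) (fun p => v₀ p.1 p.2)
      atTop (closure (cube d) ×ˢ Icc 0 T)) :
    TendstoUniformlyOn (fun k (p : Space d × ℝ) => v k p.1 p.2) (fun p => v₀ p.1 p.2)
      atTop (univ ×ˢ Icc 0 T) := by
  rw [Metric.tendstoUniformlyOn_iff] at h ⊢
  intro e he
  filter_upwards [h e he] with k hk p hp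
  obtain ⟨n, hn⟩ := exists_int_shift_mem_Icc p.1
  have h1 := hk (p.1 + WithLp.toLp 2 (fun i => (n i : ℝ)), p.2) ⟨subset_closure hn, hp.2⟩
  have h2 := hv k p.2 hp.2.1 p.1 n
  have h3 := hv₀ p.2 hp.2.1 p.1 n
  simp only at h1 h2 h3
  rwa [h2, h3] at h1

/-! ### Existence, uniqueness and convergence -/

/-- A function which is Lipschitz in space and time, and constant in time for negative times. -/
structure IsLipschitzFlow (L C : ℝ) (u : Space d → ℝ → ℝ) : Prop where
  lipschitz : ∀ x y t s, |u x t - u y s| ≤ L * ‖x - y‖ + C * |t - s|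
  eq_max : ∀ x t, u x t = u x (max t 0)

/-- Freezing the solution at negative times makes it Lipschitz on all of space-time, so that
compactness, Rademacher's theorem and whole-space integration by parts apply directly. -/
theorem isLipschitzFlow_extension {u : Space d → ℝ → ℝ} {L C : ℝ} (hC : 0 ≤ C)
    (h1 : ∀ x y t, 0 ≤ t → |u x t - u y t| ≤ L * ‖x - y‖)
    (h2 : ∀ x t s, 0 ≤ t → 0 ≤ s → |u x t - u x s| ≤ C * |t - s|) :
    IsLipschitzFlow L C (fun x t => u x (max t 0)) where
  lipschitz x y t s := by
    have a := h1 x y (max t 0) (le_max_right _ _)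
    have b := h2 y (max t 0) (max s 0) (le_max_right _ _) (le_max_right _ _)
    have c : |max t 0 - max s 0| ≤ |t - s| := abs_max_sub_max_le_abs t s 0
    calc |u x (max t 0) - u y (max s 0)|
        ≤ |u x (max t 0) - u y (max t 0)| + |u y (max t 0) - u y (max s 0)| := abs_sub_le _ _ _
      _ ≤ L * ‖x - y‖ + C * |t - s| := add_le_add a (b.trans (by gcongr))
  eq_max x t := by simp

theorem IsLipschitzFlow.lipschitzWith {u : Space d → ℝ → ℝ} {L C : ℝ} (hL : 0 ≤ L) (hC : 0 ≤ C)
    (h : IsLipschitzFlow L C u) :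
    LipschitzWith (Real.toNNReal (L + C)) (fun p : Space d × ℝ => u p.1 p.2) := by
  refine LipschitzWith.of_dist_le_mul fun p q => ?_
  rw [Real.coe_toNNReal _ (by positivity), Real.dist_eq]
  refine (h.lipschitz p.1 q.1 p.2 q.2).trans ?_
  have h1 : ‖p.1 - q.1‖ ≤ dist p q := by
    rw [← dist_eq_norm, Prod.dist_eq]; exact le_max_left _ _
  have h2 : |p.2 - q.2| ≤ dist p q := by
    rw [← Real.dist_eq, Prod.dist_eq]; exact le_max_right _ _
  rw [add_mul]
  gcongr

/-- Comparison between a subsolution and the limit, obtained through the classical approximations;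
together with its reflection it gives uniqueness. -/
theorem viscositySolution_le_of_tendsto {φ ψ g : Space d → ℝ} {L C M : ℝ}
    (hB : UniformBounds φ ψ g L C M) (hg : ContDiff ℝ 2 g) (hgper : IsPeriodic g)
    (hφψ : ∀ x, φ x < ψ x) (hφg : ∀ x, φ x ≤ g x) (hgψ : ∀ x, g x ≤ ψ x)
    {ε : ℕ → ℝ} (hε : ∀ k, 0 < ε k) (hε0 : Tendsto ε atTop (𝓝 0)) {uε : ℕ → Space d → ℝ → ℝ}
    (huε : ∀ k, IsClassicalSolution (ε k) φ ψ g (uε k)) {u v : Space d → ℝ → ℝ}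
    (hlim : ∀ x t, 0 ≤ t → Tendsto (fun k => uε k x t) atTop (𝓝 (u x t)))
    (hv : IsViscositySubsolution φ ψ v) (hv0 : ∀ x, v x 0 = g x) :
    ∀ x t, 0 ≤ t → v x t ≤ u x t := by
  intro x t ht
  refine le_of_forall_pos_le_add fun m hm => ?_
  obtain ⟨ε₀, hε₀, h⟩ := exists_subsolution_le hB hg hgper hφψ hφg hgψ hv (fun x => (hv0 x).le)
    hm ht
  refine ge_of_tendsto ((hlim x t ht).add_const m) ?_
  filter_upwards [hε0.eventually (gt_mem_nhds hε₀)] with k hk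
  exact h (ε k) (hε k) hk (uε k) (huε k) x t ht le_rfl

theorem exists_limit_flow {φ ψ g : Space d → ℝ} {L C M : ℝ}
    (hB : UniformBounds φ ψ g L C M) (hg : ContDiff ℝ 2 g) (hgper : IsPeriodic g)
    (hφ : Continuous φ) (hψ : Continuous ψ)
    (hφψ : ∀ x, φ x < ψ x) (hφg : ∀ x, φ x ≤ g x) (hgψ : ∀ x, g x ≤ ψ x)
    {ε : ℕ → ℝ} (hε : ∀ k, 0 < ε k) (hε0 : Tendsto ε atTop (𝓝 0)) {uε : ℕ → Space d → ℝ → ℝ}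
    (huε : ∀ k, IsClassicalSolution (ε k) φ ψ g (uε k)) :
    ∃ σ : ℕ → ℕ, StrictMono σ ∧ ∃ u : Space d → ℝ → ℝ, IsLipschitzFlow L C u ∧
      IsViscositySolution φ ψ g u ∧
      (∀ v, IsViscositySolution φ ψ g v → ∀ x t, 0 ≤ t → v x t = u x t) ∧
      ∀ T, 0 < T → TendstoUniformlyOn (fun k (p : Space d × ℝ) => uε (σ k) p.1 p.2)
        (fun p => u p.1 p.2) atTop (univ ×ˢ Icc 0 T) := by
  have hflow : ∀ k, IsLipschitzFlow L C (fun x t => uε k x (max t 0)) := fun k =>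
    isLipschitzFlow_extension hB.C_nonneg ((huε k).lipschitz_space hB (hε k))
      ((huε k).lipschitz_time hB (hε k) hg hgper hφg hgψ)
  obtain ⟨σ, hσ, f₀, -, hpt, hunif⟩ := exists_subseq_tendstoUniformlyOn (X := Space d × ℝ)
    (f := fun k p => uε k p.1 (max p.2 0))
    (fun k => (hflow k).lipschitzWith hB.L_nonneg hB.C_nonneg)
    (fun k p => (huε k).abs_le_bound hB (hε k) hφψ hφg hgψ p.1 _ (le_max_right _ _))
  set u : Space d → ℝ → ℝ := fun x t => f₀ (x, t) with hu
  have hεσ : Tendsto (fun k => ε (σ k)) atTop (𝓝 0) := hε0.comp hσ.tendsto_atTop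
  have hlim : ∀ x t, 0 ≤ t → Tendsto (fun k => uε (σ k) x t) atTop (𝓝 (u x t)) := fun x t ht => by
    have := hpt (x, t)
    simpa [max_eq_left ht] using this
  have huflow : IsLipschitzFlow L C u := by
    constructor
    · intro x y t s
      exact le_of_tendsto' (((hpt (x, t)).sub (hpt (y, s))).abs) fun k =>
        (hflow (σ k)).lipschitz x y t s
    · intro x t
      refine tendsto_nhds_unique (hpt (x, t)) ?_
      have := hpt (x, max t 0)
      simpa using this
  have hper : ∀ t, 0 ≤ t → IsPeriodic (fun x => u x t) := fun t ht x k => by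
    refine tendsto_nhds_unique (hlim _ t ht) ?_
    have h : ∀ n, uε (σ n) (x + WithLp.toLp 2 (fun i => (k i : ℝ))) t = uε (σ n) x t :=
      fun n => (huε (σ n)).periodic t ht x k
    simp_rw [h]
    exact hlim x t ht
  have hconv : ∀ T, 0 < T → TendstoUniformlyOn (fun k (p : Space d × ℝ) => uε (σ k) p.1 p.2)
      (fun p => u p.1 p.2) atTop (univ ×ˢ Icc 0 T) := fun T _ => by
    refine tendstoUniformlyOn_of_periodic (fun k t ht => (huε (σ k)).periodic t ht) hper ?_
    refine (hunif _ (isCompact_closure_cube.prod isCompact_Icc)).congr ?_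
    refine Eventually.of_forall fun k p hp => ?_
    simp only [max_eq_left hp.2.1]
  have hlow : ∀ x t, 0 ≤ t → φ x ≤ u x t := fun x t ht => by
    refine le_of_forall_pos_le_add fun m hm => ?_
    obtain ⟨ε₀, hε₀, h⟩ := exists_lower_obstacle_bound hB hφψ hφg hgψ hm
    refine ge_of_tendsto ((hlim x t ht).add_const m) ?_
    filter_upwards [hεσ.eventually (gt_mem_nhds hε₀)] with k hk
    linarith [h _ (hε _) hk _ (huε (σ k)) x t ht]
  have hupp : ∀ x t, 0 ≤ t → u x t ≤ ψ x := fun x t ht => by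
    refine le_of_forall_pos_le_add fun m hm => ?_
    obtain ⟨ε₀, hε₀, h⟩ := exists_lower_obstacle_bound hB.neg (fun x => neg_lt_neg (hφψ x))
      (fun x => neg_le_neg (hgψ x)) (fun x => neg_le_neg (hφg x)) hm
    refine le_of_tendsto (hlim x t ht) ?_
    filter_upwards [hεσ.eventually (gt_mem_nhds hε₀)] with k hk
    linarith [h _ (hε _) hk _ (huε (σ k)).neg x t ht]
  have hadm : IsAdmissible φ ψ u :=
    ⟨hper, (huflow.lipschitzWith hB.L_nonneg hB.C_nonneg).continuous.continuousOn,
      ⟨M, fun x t ht => le_of_tendsto' (hlim x t ht).abs fun k =>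
        (huε (σ k)).abs_le_bound hB (hε _) hφψ hφg hgψ x t ht⟩,
      fun x t ht => ⟨hlow x t ht, hupp x t ht⟩⟩
  have hsub : IsViscositySubsolution φ ψ u :=
    isViscositySubsolution_of_tendsto hφ (fun k => hε (σ k)) hεσ (fun k => huε (σ k)) hadm hconv
  have hnegsub : IsViscositySubsolution (fun x => - ψ x) (fun x => - φ x) (fun x t => - u x t) := by
    refine isViscositySubsolution_of_tendsto hψ.neg (fun k => hε (σ k)) hεσ
      (fun k => (huε (σ k)).neg) hadm.neg fun T hT => ?_
    have := hconv T hT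
    rw [Metric.tendstoUniformlyOn_iff] at this ⊢
    intro e he
    filter_upwards [this e he] with k hk p hp
    rw [dist_neg_neg]; exact hk p hp
  have hsup : IsViscositySupersolution φ ψ u := by
    simpa using hnegsub.neg
  have hinit : ∀ x, u x 0 = g x := fun x => by
    refine tendsto_nhds_unique (hlim x 0 le_rfl) ?_
    simp_rw [fun k => (huε (σ k)).initial x]
    exact tendsto_const_nhds
  refine ⟨σ, hσ, u, huflow, ⟨hsub, hsup, hinit⟩, fun v hv x t ht => ?_, hconv⟩
  -- Any other solution is squeezed: as a subsolution it lies below the limit, and its reflection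
  -- lies below the reflected limit.
  refine le_antisymm (viscositySolution_le_of_tendsto hB hg hgper hφψ hφg hgψ (fun k => hε (σ k))
    hεσ (fun k => huε (σ k)) hlim hv.1 hv.2.2 x t ht) ?_
  have := viscositySolution_le_of_tendsto hB.neg (neg_contDiff hg) hgper.neg
    (fun x => neg_lt_neg (hφψ x)) (fun x => neg_le_neg (hgψ x)) (fun x => neg_le_neg (hφg x))
    (fun k => hε (σ k)) hεσ (fun k => (huε (σ k)).neg) (fun x t ht => (hlim x t ht).neg)
    hv.2.1.neg (fun x => by rw [hv.2.2]) x t ht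
  linarith

/-! ### Integration over the fundamental cube -/

/-- The standard basis of `ℝ^d`. -/
noncomputable abbrev stdBasis (d : ℕ) : Module.Basis (Fin d) ℝ (Space d) :=
  (EuclideanSpace.basisFun (Fin d) ℝ).toBasis

theorem cube_eq_fundamentalDomain : cube d = ZSpan.fundamentalDomain (stdBasis d) := by
  ext x
  rw [ZSpan.mem_fundamentalDomain]
  simp [cube]

theorem measurableSet_cube : MeasurableSet (cube d) := by
  rw [cube_eq_fundamentalDomain]
  exact ZSpan.fundamentalDomain_measurableSet _

theorem volume_cube : volume (cube d) = 1 := by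
  have h := (EuclideanSpace.volume_preserving_symm_measurableEquiv_toLp (Fin d)).measure_preimage_equiv
    (univ.pi fun _ => Ico (0 : ℝ) 1)
  rw [Real.volume_pi_Ico] at h
  simp only [sub_zero, ENNReal.ofReal_one, Finset.prod_const_one] at h
  rw [← h]
  congr 1
  ext x
  simp [cube]

instance isProbabilityMeasure_cube : IsProbabilityMeasure (volume.restrict (cube d)) :=
  ⟨by rw [Measure.restrict_apply_univ, volume_cube]⟩

theorem IsPeriodic.vadd_eq {α : Type*} {f : Space d → α} (hf : IsPeriodic f)
    (k : (Submodule.span ℤ (range (stdBasis d))).toAddSubgroup) (x : Space d) : f (k +ᵥ x) = f x := by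
  have hk := (Module.Basis.mem_span_iff_repr_mem ℤ (stdBasis d) (k : Space d)).1 k.2
  choose n hn using hk
  have h1 : (k : Space d) = WithLp.toLp 2 (fun i => (n i : ℝ)) := by
    ext i
    have := hn i
    simp at this
    simp [this]
  have h2 : k +ᵥ x = x + (k : Space d) := by
    rw [add_comm]; rfl
  rw [h2, h1]
  exact hf x n

open scoped Pointwise in
-- The cube and its translate are both fundamental domains of the lattice.
theorem IsPeriodic.setIntegral_comp_add {F : Type*} [NormedAddCommGroup F] [NormedSpace ℝ F]
    {f : Space d → F} (hf : IsPeriodic f) (v : Space d) :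
    ∫ x in cube d, f (x + v) = ∫ x in cube d, f x := by
  have hfd : IsAddFundamentalDomain (Submodule.span ℤ (range (stdBasis d))).toAddSubgroup
      (cube d) (volume : Measure (Space d)) := by
    rw [cube_eq_fundamentalDomain]; exact ZSpan.isAddFundamentalDomain' _ _
  have : Countable (Submodule.span ℤ (range (stdBasis d))).toAddSubgroup :=
    inferInstanceAs (Countable (Submodule.span ℤ (range (stdBasis d))))
  have h2 := (hfd.vadd_of_comm v).setIntegral_eq hfd (f := f) hf.vadd_eq
  rw [← h2]
  have h3 := (measurePreserving_add_right (volume : Measure (Space d)) v).setIntegral_preimage_emb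
    (measurableEmbedding_addRight v) f (v +ᵥ cube d)
  rw [← h3]
  congr 2
  ext x
  rw [mem_preimage, mem_vadd_set_iff_neg_vadd_mem]
  simp [add_comm]

theorem Continuous.integrableOn_cube {F : Type*} [NormedAddCommGroup F] {f : Space d → F}
    (hf : Continuous f) : IntegrableOn f (cube d) :=
  (hf.continuousOn.integrableOn_compact isCompact_closure_cube).mono_set subset_closure

theorem IsPeriodic.exists_lipschitzWith {v : Space d → ℝ} (hv : IsPeriodic v)
    (hc : ContDiff ℝ 1 v) : ∃ K, LipschitzWith K v := by
  obtain ⟨L, hL, h⟩ := hv.exists_lipschitz hc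
  refine ⟨L.toNNReal, LipschitzWith.of_dist_le_mul fun x y => ?_⟩
  rw [Real.coe_toNNReal _ hL, Real.dist_eq, dist_eq_norm]
  exact h x y

/-- Integration by parts for Lipschitz functions on the torus, with line derivatives. -/
theorem integral_lineDeriv_mul_cube {f h : Space d → ℝ} {K K' : NNReal} (hf : LipschitzWith K f)
    (hh : LipschitzWith K' h) (hfp : IsPeriodic f) (hhp : IsPeriodic h) (v : Space d) :
    ∫ x in cube d, lineDeriv ℝ f x v * h x = ∫ x in cube d, lineDeriv ℝ h x (-v) * f x := by
  have hind : ∀ p q : Space d → ℝ, (fun x => p x * (cube d).indicator q x)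
      = (cube d).indicator (fun x => p x * q x) := fun p q => by
    funext x; by_cases hx : x ∈ cube d <;> simp [hx]
  -- The second factor must be integrable on the whole space, so it is cut off to the cube; being
  -- only integrable, it may jump there.
  have A := LipschitzWith.integral_inv_smul_sub_mul_tendsto_integral_lineDeriv_mul
    (μ := (volume : Measure (Space d))) hf
    (hh.continuous.integrableOn_cube.integrable_indicator measurableSet_cube) v
  have B := LipschitzWith.integral_inv_smul_sub_mul_tendsto_integral_lineDeriv_mul
    (μ := (volume : Measure (Space d))) hh
    (hf.continuous.integrableOn_cube.integrable_indicator measurableSet_cube) (-v)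
  simp only [hind, integral_indicator measurableSet_cube] at A B
  -- For every step `t` the two difference quotient integrals coincide: the terms without shift are
  -- equal, and the shifted ones differ by a translation of a periodic integrand.
  refine tendsto_nhds_unique A (B.congr fun t => ?_)
  have e1 : ∀ x, t⁻¹ • (h (x + t • -v) - h x) * f x
      = t⁻¹ * (h (x + t • -v) * f x) - t⁻¹ * (h x * f x) := fun x => by
    rw [smul_eq_mul]; ring
  have e2 : ∀ x, t⁻¹ • (f (x + t • v) - f x) * h x
      = t⁻¹ * (f (x + t • v) * h x) - t⁻¹ * (h x * f x) := fun x => by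
    rw [smul_eq_mul]; ring
  have hfc := hf.continuous
  have hhc := hh.continuous
  have i0 : IntegrableOn (fun x => t⁻¹ * (h x * f x)) (cube d) :=
    Continuous.integrableOn_cube (by fun_prop)
  have i1 : IntegrableOn (fun x => t⁻¹ * (h (x + t • -v) * f x)) (cube d) :=
    Continuous.integrableOn_cube (by fun_prop)
  have i2 : IntegrableOn (fun x => t⁻¹ * (f (x + t • v) * h x)) (cube d) :=
    Continuous.integrableOn_cube (by fun_prop)
  simp_rw [e1, e2]
  rw [integral_sub i1 i0, integral_sub i2 i0]
  congr 1
  have hper : IsPeriodic (fun x => t⁻¹ * (h (x + t • -v) * f x)) := fun x k => by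
    have a1 := hhp.comp_add (t • -v) x k
    have a2 := hfp x k
    simp only at a1 ⊢
    rw [a1, a2]
  rw [← hper.setIntegral_comp_add (t • v)]
  refine integral_congr_ae (Eventually.of_forall fun x => ?_)
  simp only
  rw [show x + t • v + t • -v = x by rw [smul_neg]; abel]
  ring

theorem ae_lineDeriv_eq_gradient {f : Space d → ℝ} {K : NNReal} (hf : LipschitzWith K f)
    (i : Fin d) : ∀ᵐ x, lineDeriv ℝ f x (EuclideanSpace.single i 1) = (∇ f x) i
      ∧ lineDeriv ℝ f x (-EuclideanSpace.single i 1) = - (∇ f x) i := by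
  filter_upwards [hf.ae_differentiableAt (μ := volume)] with x hx
  rw [hx.lineDeriv_eq_fderiv, hx.lineDeriv_eq_fderiv, map_neg, gradient_apply_eq_pderiv]
  exact ⟨rfl, rfl⟩

/-- Integration by parts for Lipschitz functions on the torus. -/
theorem integral_gradient_mul_cube {f h : Space d → ℝ} {K K' : NNReal} (hf : LipschitzWith K f)
    (hh : LipschitzWith K' h) (hfp : IsPeriodic f) (hhp : IsPeriodic h) (i : Fin d) :
    ∫ x in cube d, (∇ f x) i * h x = - ∫ x in cube d, f x * (∇ h x) i := by
  have h1 := integral_lineDeriv_mul_cube hf hh hfp hhp (EuclideanSpace.single i 1)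
  have e1 : ∫ x in cube d, lineDeriv ℝ f x (EuclideanSpace.single i 1) * h x
      = ∫ x in cube d, (∇ f x) i * h x := by
    refine integral_congr_ae (ae_restrict_of_ae ?_)
    filter_upwards [ae_lineDeriv_eq_gradient hf i] with x hx
    rw [hx.1]
  have e2 : ∫ x in cube d, lineDeriv ℝ h x (-EuclideanSpace.single i 1) * f x
      = - ∫ x in cube d, f x * (∇ h x) i := by
    rw [← integral_neg]
    refine integral_congr_ae (ae_restrict_of_ae ?_)
    filter_upwards [ae_lineDeriv_eq_gradient hh i] with x hx
    rw [hx.2]; ring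
  rw [← e1, h1, e2]

/-! ### Weak gradients -/

theorem measurable_gradient (f : Space d → ℝ) : Measurable (fun x => ∇ f x) :=
  (InnerProductSpace.toDual ℝ (Space d)).symm.continuous.measurable.comp (measurable_fderiv ℝ f)

theorem norm_gradient_le_of_lipschitz {f : Space d → ℝ} {K : NNReal} (hf : LipschitzWith K f)
    (x : Space d) : ‖∇ f x‖ ≤ K := by
  have : ‖∇ f x‖ = ‖fderiv ℝ f x‖ := (InnerProductSpace.toDual ℝ (Space d)).symm.norm_map _
  rw [this]
  exact norm_fderiv_le_of_lipschitz ℝ hf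

/-- By Rademacher's theorem the classical gradient exists almost everywhere; the value `0` it takes
at the other points affects no integral. -/
theorem isWeakGradient_gradient {f : Space d → ℝ} {K : NNReal} (hf : LipschitzWith K f)
    (hfp : IsPeriodic f) : IsWeakGradient f (fun x => ∇ f x) where
  memLp_fun := by
    obtain ⟨M, hM⟩ := hfp.exists_bound hf.continuous
    exact memLp_top_of_bound hf.continuous.aestronglyMeasurable M
      (Eventually.of_forall fun x => hM x)
  memLp_grad := memLp_top_of_bound (measurable_gradient f).aestronglyMeasurable K
    (Eventually.of_forall fun x => norm_gradient_le_of_lipschitz hf x)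
  parts ζ hζ hζp i := by
    obtain ⟨K', hK'⟩ := hζp.exists_lipschitzWith (hζ.of_le ENat.LEInfty.out)
    rw [integral_gradient_mul_cube hf hK' hfp hζp i, neg_neg]
    simp_rw [gradient_apply_eq_pderiv]

theorem memW1Infty_of_lipschitz {f : Space d → ℝ} {K : NNReal} (hf : LipschitzWith K f)
    (hfp : IsPeriodic f) : MemW1Infty f :=
  ⟨hfp, hf.continuous, _, isWeakGradient_gradient hf hfp⟩

theorem MemW1Infty.isWeakGradient {f : Space d → ℝ} (hf : MemW1Infty f) :
    IsWeakGradient f (weakGradient f) := by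
  have h := hf.2.2
  rw [weakGradient, dif_pos h]
  exact h.choose_spec

/-! ### Periodic mollification, duality and uniqueness of weak gradients. -/

/-- The representative in the unit cube of a point modulo `ℤ^d`. -/
noncomputable def fractPart (x : Space d) : Space d := WithLp.toLp 2 (fun i => Int.fract (x i))

theorem measurable_fractPart : Measurable (fractPart (d := d)) := by
  refine (WithLp.measurable_toLp 2 _).comp (measurable_pi_lambda _ fun i => ?_)
  exact measurable_fract.comp (by fun_prop)

theorem isPeriodic_comp_fractPart {α : Type*} (f : Space d → α) :
    IsPeriodic (fun x => f (fractPart x)) := fun x k => by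
  simp [fractPart]

theorem fractPart_of_mem_cube {x : Space d} (hx : x ∈ cube d) : fractPart x = x := by
  ext i
  simp only [fractPart]
  exact Int.fract_eq_self.2 (hx i)

/-- Periodic mollifications of bounded periodic vector fields. -/
theorem exists_smooth_periodic_approx {F : Space d → Space d} (hF : Measurable F)
    (hper : IsPeriodic F) (hb : ∀ x, ‖F x‖ ≤ 1) :
    ∃ ζ : ℕ → Space d → Space d, (∀ n, ContDiff ℝ ∞ (ζ n)) ∧ (∀ n, IsPeriodic (ζ n)) ∧
      (∀ n x, ‖ζ n x‖ ≤ 1) ∧ ∀ᵐ x, Tendsto (fun n => ζ n x) atTop (𝓝 (F x)) := by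
  have hloc : LocallyIntegrable F volume := by
    have : MemLp F ⊤ volume := memLp_top_of_bound hF.aestronglyMeasurable 1
      (Eventually.of_forall hb)
    exact this.locallyIntegrable le_top
  -- The fixed ratio `2` of the radii is what the almost everywhere convergence of the convolutions
  -- requires.
  set ρ : ℕ → ContDiffBump (0 : Space d) := fun n =>
    ⟨1 / (n + 1), 2 / (n + 1), by positivity, by gcongr; norm_num⟩ with hρ
  refine ⟨fun n => convolution ((ρ n).normed volume) F (ContinuousLinearMap.lsmul ℝ ℝ) volume,
    fun n => ?_, fun n x k => ?_, fun n x => ?_, ?_⟩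
  · exact HasCompactSupport.contDiff_convolution_left _ (ρ n).hasCompactSupport_normed
      (ρ n).contDiff_normed hloc
  · simp only [convolution]
    refine integral_congr_ae (Eventually.of_forall fun t => ?_)
    simp only
    rw [show x + WithLp.toLp 2 (fun i => (k i : ℝ)) - t
      = (x - t) + WithLp.toLp 2 (fun i => (k i : ℝ)) by abel, hper]
  · simp only [convolution]
    have h1 : ∫ t, (ρ n).normed volume t = 1 := (ρ n).integral_normed
    rw [← h1]
    refine norm_integral_le_of_norm_le (ρ n).integrable_normed (Eventually.of_forall fun t => ?_)
    rw [ContinuousLinearMap.lsmul_apply, norm_smul, Real.norm_of_nonneg ((ρ n).nonneg_normed t)]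
    exact mul_le_of_le_one_right ((ρ n).nonneg_normed t) (hb _)
  · refine ContDiffBump.ae_convolution_tendsto_right_of_locallyIntegrable (K := 2) ?_ ?_ hloc
    · simp only [hρ]
      have := tendsto_one_div_add_atTop_nhds_zero_nat (𝕜 := ℝ)
      simpa [div_eq_mul_inv] using this.const_mul 2
    · refine Eventually.of_forall fun n => ?_
      simp only [hρ]
      rw [mul_one_div]

/-- The norm of an integrable field is attained asymptotically by smooth periodic unit fields. -/
theorem exists_smooth_dual {K : Space d → Space d}
    (hK : IntegrableOn K (cube d)) :
    ∃ ζ : ℕ → Space d → Space d, (∀ n, ContDiff ℝ ∞ (ζ n)) ∧ (∀ n, IsPeriodic (ζ n)) ∧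
      (∀ n x, ‖ζ n x‖ ≤ 1) ∧
      Tendsto (fun n => ∫ x in cube d, inner ℝ (K x) (ζ n x)) atTop (𝓝 (∫ x in cube d, ‖K x‖)) := by
  -- A measurable representative, so that its normalised periodic extension is measurable on the
  -- whole space. At zeros the normalisation gives `0`, which is harmless.
  set K' := hK.aestronglyMeasurable.mk K with hK'
  have hK'm : Measurable K' := hK.aestronglyMeasurable.stronglyMeasurable_mk.measurable
  have hKK' : K =ᵐ[volume.restrict (cube d)] K' := hK.aestronglyMeasurable.ae_eq_mk
  set F : Space d → Space d := fun x => ‖K' (fractPart x)‖⁻¹ • K' (fractPart x) with hF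
  have hFm : Measurable F := by
    have := hK'm.comp measurable_fractPart
    exact (this.norm.inv).smul this
  obtain ⟨ζ, h1, h2, h3, h4⟩ := exists_smooth_periodic_approx hFm
    (isPeriodic_comp_fractPart fun y => ‖K' y‖⁻¹ • K' y) (fun x => by
      rw [hF, norm_smul, norm_inv, norm_norm]
      exact inv_mul_le_one)
  refine ⟨ζ, h1, h2, h3, ?_⟩
  refine tendsto_integral_of_dominated_convergence (fun x => ‖K x‖) (fun n => ?_) hK.norm
    (fun n => ?_) ?_
  · exact hK.aestronglyMeasurable.inner (h1 n).continuous.aestronglyMeasurable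
  · refine Eventually.of_forall fun x => ?_
    rw [Real.norm_eq_abs]
    exact (abs_real_inner_le_norm _ _).trans (mul_le_of_le_one_right (norm_nonneg _) (h3 n x))
  · filter_upwards [hKK', ae_restrict_of_ae h4, ae_restrict_mem measurableSet_cube]
      with x hx1 hx2 hx3
    have hFx : inner ℝ (K x) (F x) = ‖K x‖ := by
      simp only [hF]
      rw [fractPart_of_mem_cube hx3, ← hx1, inner_smul_right, real_inner_self_eq_norm_sq]
      by_cases h0 : ‖K x‖ = 0
      · simp [h0]
      · field_simp
    rw [← hFx]
    exact tendsto_const_nhds.inner hx2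

theorem IsWeakGradient.integrableOn {v : Space d → ℝ} {G : Space d → Space d}
    (h : IsWeakGradient v G) : IntegrableOn G (cube d) :=
  h.memLp_grad.integrable le_top

theorem isPeriodic_apply {ζ : Space d → Space d} (h : IsPeriodic ζ) (i : Fin d) :
    IsPeriodic (fun x => ζ x i) := fun x k => by simp only [h x k]

/-- The weak gradient tested with smooth periodic vector fields. -/
theorem IsWeakGradient.integral_inner {v : Space d → ℝ} {G : Space d → Space d}
    (h : IsWeakGradient v G) {ζ : Space d → Space d} (hζ : ContDiff ℝ ∞ ζ) (hper : IsPeriodic ζ) :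
    ∫ x in cube d, inner ℝ (G x) (ζ x)
      = - ∫ x in cube d, v x * ∑ i, pderiv i (fun y => ζ y i) x := by
  have hζi : ∀ i, ContDiff ℝ ∞ (fun y => ζ y i) := fun i => (contDiff_apply i).comp hζ
  have hGi : ∀ i, IntegrableOn (fun x => G x i * ζ x i) (cube d) := fun i => by
    obtain ⟨M, hM⟩ := (isPeriodic_apply hper i).exists_bound (hζi i).continuous
    refine Integrable.mul_bdd (c := M) ?_ (hζi i).continuous.aestronglyMeasurable
      (Eventually.of_forall hM)
    exact (EuclideanSpace.proj (𝕜 := ℝ) i).integrable_comp h.integrableOn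
  have hvi : ∀ i, IntegrableOn (fun x => v x * pderiv i (fun y => ζ y i) x) (cube d) := fun i => by
    obtain ⟨M, hM⟩ := ((isPeriodic_apply hper i).pderivative i).exists_bound
      (contDiff_pderiv_infty (hζi i) i).continuous
    exact Integrable.mul_bdd (c := M) (h.memLp_fun.integrable le_top)
      (contDiff_pderiv_infty (hζi i) i).continuous.aestronglyMeasurable (Eventually.of_forall hM)
  have e1 : ∀ x, inner ℝ (G x) (ζ x) = ∑ i, G x i * ζ x i := fun x => by
    rw [PiLp.inner_apply]
    exact Finset.sum_congr rfl fun i _ => by simp [mul_comm]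
  simp_rw [e1, Finset.mul_sum]
  rw [integral_finsetSum _ fun i _ => hGi i, integral_finsetSum _ fun i _ => hvi i,
    ← Finset.sum_neg_distrib]
  refine Finset.sum_congr rfl fun i _ => ?_
  rw [h.parts _ (hζi i) (isPeriodic_apply hper i) i, neg_neg]

/-- All pairings of `G - G'` with smooth periodic fields vanish, and a sequence of them converges to
its `L¹` norm. Hence the chosen `weakGradient` may be replaced by any convenient representative. -/
theorem IsWeakGradient.unique {v : Space d → ℝ} {G G' : Space d → Space d}
    (h : IsWeakGradient v G) (h' : IsWeakGradient v G') :
    G =ᵐ[volume.restrict (cube d)] G' := by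
  have hint : IntegrableOn (fun x => G x - G' x) (cube d) := h.integrableOn.sub h'.integrableOn
  obtain ⟨ζ, h1, h2, h3, h4⟩ := exists_smooth_dual hint
  have hinner : ∀ {H : Space d → Space d} n, IntegrableOn H (cube d) →
      IntegrableOn (fun x => inner ℝ (H x) (ζ n x)) (cube d) := fun {H} n hH => by
    refine hH.norm.mono' (hH.aestronglyMeasurable.inner (h1 n).continuous.aestronglyMeasurable) ?_
    refine Eventually.of_forall fun x => ?_
    rw [Real.norm_eq_abs]
    exact (abs_real_inner_le_norm _ _).trans (mul_le_of_le_one_right (norm_nonneg _) (h3 n x))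
  have h5 : ∀ n, ∫ x in cube d, inner ℝ (G x - G' x) (ζ n x) = 0 := fun n => by
    simp_rw [inner_sub_left]
    rw [integral_sub (hinner n h.integrableOn) (hinner n h'.integrableOn),
      h.integral_inner (h1 n) (h2 n), h'.integral_inner (h1 n) (h2 n), sub_self]
  simp_rw [h5] at h4
  have h6 : ∫ x in cube d, ‖G x - G' x‖ = 0 := tendsto_nhds_unique h4 tendsto_const_nhds
  rw [integral_eq_zero_iff_of_nonneg (fun x => norm_nonneg _) hint.norm] at h6
  filter_upwards [h6] with x hx
  exact sub_eq_zero.1 (norm_eq_zero.1 hx)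

theorem weakGradient_ae_eq {f : Space d → ℝ} {K : NNReal} (hf : LipschitzWith K f)
    (hfp : IsPeriodic f) :
    weakGradient f =ᵐ[volume.restrict (cube d)] fun x => ∇ f x :=
  (memW1Infty_of_lipschitz hf hfp).isWeakGradient.unique (isWeakGradient_gradient hf hfp)

/-! ### Weak space-time derivatives -/

instance isAddHaarMeasure_spaceTime :
    (volume : Measure (Space d × ℝ)).IsAddHaarMeasure :=
  inferInstanceAs (((volume : Measure (Space d)).prod (volume : Measure ℝ)).IsAddHaarMeasure)

theorem measurableSet_cylinder (T : ℝ) : MeasurableSet (cylinder d T) :=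
  measurableSet_cube.prod measurableSet_Ioo

theorem restrict_cylinder (T : ℝ) : (volume : Measure (Space d × ℝ)).restrict (cylinder d T)
    = (volume.restrict (cube d)).prod (volume.restrict (Ioo 0 T)) := by
  rw [Measure.prod_restrict, cylinder, Measure.volume_eq_prod]

theorem Continuous.integrableOn_cylinder {f : Space d × ℝ → ℝ} (hf : Continuous f) (T : ℝ) :
    IntegrableOn f (cylinder d T) :=
  (hf.continuousOn.integrableOn_compact (isCompact_closure_cube.prod (isCompact_Icc (a := 0)
    (b := T)))).mono_set (prod_mono subset_closure Ioo_subset_Icc_self)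

theorem measurable_slice_gradient {u : Space d → ℝ → ℝ}
    (hu : Continuous (fun p : Space d × ℝ => u p.1 p.2)) :
    Measurable (fun p : Space d × ℝ => ∇ (fun y => u y p.2) p.1) := by
  have h1 : Continuous (Function.uncurry (fun (t : ℝ) (y : Space d) => u y t)) :=
    hu.comp continuous_swap
  exact (InnerProductSpace.toDual ℝ (Space d)).symm.continuous.measurable.comp
    ((measurable_fderiv_with_param ℝ h1).comp measurable_swap)

theorem IsLipschitzFlow.lipschitz_slice {L C : ℝ} {u : Space d → ℝ → ℝ} (hL : 0 ≤ L)
    (h : IsLipschitzFlow L C u) (t : ℝ) : LipschitzWith L.toNNReal (fun x => u x t) :=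
  LipschitzWith.of_dist_le_mul fun x y => by
    have := h.lipschitz x y t t
    rw [Real.coe_toNNReal _ hL, Real.dist_eq, dist_eq_norm]
    simpa using this

theorem IsLipschitzFlow.lipschitz_time_slice {L C : ℝ} {u : Space d → ℝ → ℝ} (hC : 0 ≤ C)
    (h : IsLipschitzFlow L C u) (x : Space d) : LipschitzWith C.toNNReal (u x) :=
  LipschitzWith.of_dist_le_mul fun t s => by
    have := h.lipschitz x x t s
    rw [Real.coe_toNNReal _ hC, Real.dist_eq, Real.dist_eq]
    simpa using this

/-- The compact support strictly inside `(0, T)` allows integration over the whole line and removes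
all boundary terms. -/
theorem integral_mul_deriv_eq {f h : ℝ → ℝ} {K : NNReal} (hf : LipschitzWith K f)
    (hh : ContDiff ℝ ∞ h) {a b T : ℝ} (ha : 0 < a) (hb : b < T) (hsupp : ∀ t ∉ Icc a b, h t = 0) :
    ∫ t in Ioo 0 T, f t * deriv h t = - ∫ t in Ioo 0 T, deriv f t * h t := by
  have hcs : HasCompactSupport h := HasCompactSupport.intro isCompact_Icc hsupp
  obtain ⟨K', hK'⟩ := (hh.of_le (m := 1) ENat.LEInfty.out).lipschitzWith_of_hasCompactSupport hcs
    one_ne_zero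
  have h1 := LipschitzWith.integral_lineDeriv_mul_eq (μ := (volume : Measure ℝ)) hf hK' hcs 1
  have l1 : ∀ (w : ℝ → ℝ) t, lineDeriv ℝ w t 1 = deriv w t := fun w t => by
    simp only [lineDeriv, smul_eq_mul, mul_one]
    rw [deriv_comp_const_add w t 0, add_zero]
  have l2 : ∀ t, lineDeriv ℝ h t (-1) = - deriv h t := fun t => by
    rw [lineDeriv_neg, l1]
  simp_rw [l1, l2] at h1
  have hz : ∀ t ∉ Ioo 0 T, t ∉ Icc a b := fun t ht hab =>
    ht ⟨ha.trans_le hab.1, hab.2.trans_lt hb⟩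
  have hdz : ∀ t ∉ Ioo 0 T, deriv h t = 0 := fun t ht => by
    have hopen : (Icc a b)ᶜ ∈ 𝓝 t := isClosed_Icc.isOpen_compl.mem_nhds (hz t ht)
    have : h =ᶠ[𝓝 t] fun _ => 0 := by
      filter_upwards [hopen] with s hs using hsupp s hs
    rw [this.deriv_eq, deriv_const]
  rw [setIntegral_eq_integral_of_forall_compl_eq_zero fun t ht => by rw [hdz t ht, mul_zero],
    setIntegral_eq_integral_of_forall_compl_eq_zero
      fun t ht => by rw [hsupp t (hz t ht), mul_zero], h1, ← integral_neg]
  exact integral_congr_ae (Eventually.of_forall fun t => by simp only; ring)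

/-- Fubini reduces both identities to integration by parts on slices, where the function is
Lipschitz. -/
theorem hasWeakDerivatives_of_lipschitz {L C M : ℝ} {u : Space d → ℝ → ℝ} (hL : 0 ≤ L) (hC : 0 ≤ C)
    (h : IsLipschitzFlow L C u) (hper : ∀ t, 0 ≤ t → IsPeriodic (fun x => u x t))
    (hM : ∀ x t, 0 ≤ t → |u x t| ≤ M) (T : ℝ) :
    HasWeakDerivatives T u (fun p => ∇ (fun y => u y p.2) p.1) (fun p => deriv (u p.1) p.2) := by
  have hcont : Continuous (fun p : Space d × ℝ => u p.1 p.2) := (h.lipschitzWith hL hC).continuous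
  have hGm := measurable_slice_gradient hcont
  have hGb : ∀ p : Space d × ℝ, ‖∇ (fun y => u y p.2) p.1‖ ≤ L.toNNReal := fun p =>
    norm_gradient_le_of_lipschitz (h.lipschitz_slice hL p.2) p.1
  have hVm : Measurable (fun p : Space d × ℝ => deriv (u p.1) p.2) :=
    measurable_deriv_with_param (f := u) hcont
  have hVb : ∀ p : Space d × ℝ, ‖deriv (u p.1) p.2‖ ≤ C.toNNReal := fun p =>
    norm_deriv_le_of_lipschitz (h.lipschitz_time_slice hC p.1)
  have hmem : ∀ᵐ p ∂(volume.restrict (cylinder d T)), p ∈ cylinder d T :=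
    ae_restrict_mem (measurableSet_cylinder T)
  refine ⟨?_, ?_, ?_, ?_, ?_⟩
  · refine memLp_top_of_bound hcont.aestronglyMeasurable M ?_
    filter_upwards [hmem] with p hp using hM p.1 p.2 hp.2.1.le
  · exact memLp_top_of_bound hGm.aestronglyMeasurable _ (Eventually.of_forall hGb)
  · exact memLp_top_of_bound hVm.aestronglyMeasurable _ (Eventually.of_forall hVb)
  · rintro ζ ⟨hζ, hζp, a, b, ha, hb, hsupp⟩ i
    have i1 : IntegrableOn (fun p : Space d × ℝ => u p.1 p.2 * pderiv i (fun y => ζ (y, p.2)) p.1)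
        (cylinder d T) := by
      refine Continuous.integrableOn_cylinder (hcont.mul ?_) T
      exact (contDiff_pderiv_slice hζ i).continuous
    have i2 : IntegrableOn (fun p : Space d × ℝ => (∇ (fun y => u y p.2) p.1) i * ζ p)
        (cylinder d T) := by
      refine Integrable.bdd_mul (c := (L.toNNReal : ℝ))
        (Continuous.integrableOn_cylinder hζ.continuous T)
        ?_ (Eventually.of_forall fun p => (abs_apply_le_norm _ i).trans (hGb p))
      have : Continuous (fun q : Space d => q i) := by fun_prop
      exact (this.measurable.comp hGm).aestronglyMeasurable
    rw [IntegrableOn, restrict_cylinder] at i1 i2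
    rw [restrict_cylinder, integral_prod_symm _ i1, integral_prod_symm _ i2, ← integral_neg]
    refine setIntegral_congr_fun measurableSet_Ioo fun t ht => ?_
    have hs : ContDiff ℝ ∞ (fun y : Space d => ζ (y, t)) := hζ.comp (contDiff_prodMk_left t)
    obtain ⟨K', hK'⟩ := (hζp t).exists_lipschitzWith (hs.of_le ENat.LEInfty.out)
    have := integral_gradient_mul_cube (h.lipschitz_slice hL t) hK' (hper t ht.1.le) (hζp t) i
    simp only
    rw [this, neg_neg]
    simp_rw [gradient_apply_eq_pderiv]
  · rintro ζ ⟨hζ, hζp, a, b, ha, hb, hsupp⟩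
    have i1 : IntegrableOn (fun p : Space d × ℝ => u p.1 p.2 * deriv (fun s => ζ (p.1, s)) p.2)
        (cylinder d T) :=
      Continuous.integrableOn_cylinder (hcont.mul (continuous_deriv_slice hζ)) T
    have i2 : IntegrableOn (fun p : Space d × ℝ => deriv (u p.1) p.2 * ζ p)
        (cylinder d T) :=
      Integrable.bdd_mul (c := (C.toNNReal : ℝ)) (Continuous.integrableOn_cylinder hζ.continuous T)
        hVm.aestronglyMeasurable (Eventually.of_forall hVb)
    rw [IntegrableOn, restrict_cylinder] at i1 i2
    rw [restrict_cylinder, integral_prod _ i1, integral_prod _ i2, ← integral_neg]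
    refine integral_congr_ae (Eventually.of_forall fun x => ?_)
    exact integral_mul_deriv_eq (h.lipschitz_time_slice hC x)
      (hζ.comp (contDiff_prodMk_right x)) ha hb fun t ht => hsupp x t ht

/-! ### Weak-`*` convergence of gradients -/

/-- Derivatives of bounded equi-Lipschitz functions that converge pointwise converge weakly-`*`. -/
theorem tendsto_integral_lineDeriv_mul {E : Type*} [NormedAddCommGroup E] [NormedSpace ℝ E]
    [FiniteDimensional ℝ E] [MeasurableSpace E] [BorelSpace E] {μ : Measure E} [μ.IsAddHaarMeasure]
    {f : ℕ → E → ℝ} {f₀ : E → ℝ} {K : NNReal} (hf : ∀ k, LipschitzWith K (f k))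
    (hf₀ : LipschitzWith K f₀) {M : ℝ} (hM : ∀ k x, |f k x| ≤ M)
    (hlim : ∀ x, Tendsto (fun k => f k x) atTop (𝓝 (f₀ x))) (v : E) {η : E → ℝ}
    (hη : Integrable η μ) :
    Tendsto (fun k => ∫ x, lineDeriv ℝ (f k) x v * η x ∂μ) atTop
      (𝓝 (∫ x, lineDeriv ℝ f₀ x v * η x ∂μ)) := by
  have hbd : ∀ {w : E → ℝ} (_ : LipschitzWith K w) x, ‖lineDeriv ℝ w x v‖ ≤ K * ‖v‖ := fun hw x =>
    norm_lineDeriv_le_of_lipschitz ℝ hw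
  have hmul : ∀ {w : E → ℝ} (_ : LipschitzWith K w) {θ : E → ℝ}, Integrable θ μ →
      Integrable (fun x => lineDeriv ℝ w x v * θ x) μ := fun {_} hw {_} hθ =>
    Integrable.bdd_mul (c := K * ‖v‖) hθ (aestronglyMeasurable_lineDeriv hw.continuous μ)
      (Eventually.of_forall (hbd hw))
  rw [Metric.tendsto_atTop]
  intro e he
  set δ : ℝ := e / (4 * (K * ‖v‖ + 1)) with hδ
  have hA : 0 ≤ (K : ℝ) * ‖v‖ := by positivity
  have hδ0 : 0 < δ := by positivity
  have hAδ : K * ‖v‖ * δ ≤ e / 4 := by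
    rw [hδ, mul_div_assoc', div_le_div_iff₀ (by positivity) (by norm_num)]
    nlinarith
  -- Replacing `η` by a smooth `θ` costs at most `K ‖v‖ δ ≤ e / 4`, uniformly in the sequence.
  obtain ⟨θ, hθc, hθs, hθ⟩ := MemLp.exist_eLpNorm_sub_le (p := 1) ENNReal.one_ne_top le_rfl
    (memLp_one_iff_integrable.2 hη) hδ0
  have hθi : Integrable θ μ := hθs.continuous.integrable_of_hasCompactSupport hθc
  have hsub : ∫ x, ‖η x - θ x‖ ∂μ ≤ δ := by
    rw [eLpNorm_one_eq_lintegral_enorm] at hθ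
    have h1 := integral_norm_eq_lintegral_enorm (hη.sub hθi).aestronglyMeasurable
    simp only [Pi.sub_apply] at h1 hθ
    rw [h1]
    exact ENNReal.toReal_le_of_le_ofReal hδ0.le hθ
  have hdiff : ∀ {w : E → ℝ} (_ : LipschitzWith K w),
      |(∫ x, lineDeriv ℝ w x v * η x ∂μ) - ∫ x, lineDeriv ℝ w x v * θ x ∂μ| ≤ e / 4 := fun hw => by
    rw [← integral_sub (hmul hw hη) (hmul hw hθi)]
    refine le_trans ?_ hAδ
    refine le_trans ?_ (mul_le_mul_of_nonneg_left hsub hA)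
    rw [← integral_const_mul, ← Real.norm_eq_abs]
    refine norm_integral_le_of_norm_le ((hη.sub hθi).norm.const_mul _)
      (Eventually.of_forall fun x => ?_)
    rw [← mul_sub, norm_mul]
    exact mul_le_mul_of_nonneg_right (hbd hw x) (norm_nonneg _)
  obtain ⟨K', hK'⟩ := (hθs.of_le (m := 1) ENat.LEInfty.out).lipschitzWith_of_hasCompactSupport hθc
    one_ne_zero
  have hθ' : Continuous (fun x => lineDeriv ℝ θ x (-v)) := by
    have : (fun x => lineDeriv ℝ θ x (-v)) = fun x => fderiv ℝ θ x (-v) := by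
      funext x
      exact ((hθs.differentiable (by simp)) x).lineDeriv_eq_fderiv
    rw [this]
    exact (hθs.continuous_fderiv (by simp)).clm_apply continuous_const
  have hθ'i : Integrable (fun x => lineDeriv ℝ θ x (-v)) μ := by
    refine hθ'.integrable_of_hasCompactSupport ?_
    have : (fun x => lineDeriv ℝ θ x (-v)) = fun x => fderiv ℝ θ x (-v) := by
      funext x
      exact ((hθs.differentiable (by simp)) x).lineDeriv_eq_fderiv
    rw [this]
    exact hθc.fderiv_apply ℝ (-v)
  have hmain : Tendsto (fun k => ∫ x, lineDeriv ℝ (f k) x v * θ x ∂μ) atTop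
      (𝓝 (∫ x, lineDeriv ℝ f₀ x v * θ x ∂μ)) := by
    -- With the derivative moved onto `θ`, pointwise convergence and the bound `M` suffice for
    -- dominated convergence.
    rw [LipschitzWith.integral_lineDeriv_mul_eq hf₀ hK' hθc v]
    simp_rw [fun k => LipschitzWith.integral_lineDeriv_mul_eq (μ := μ) (hf k) hK' hθc v]
    refine tendsto_integral_of_dominated_convergence (fun x => ‖lineDeriv ℝ θ x (-v)‖ * M)
      (fun k => (hθ'.mul (hf k).continuous).aestronglyMeasurable) (hθ'i.norm.mul_const M)
      (fun k => Eventually.of_forall fun x => ?_) (Eventually.of_forall fun x => ?_)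
    · rw [norm_mul]
      exact mul_le_mul_of_nonneg_left (hM k x) (norm_nonneg _)
    · exact (hlim x).const_mul _
  obtain ⟨N, hN⟩ := Metric.tendsto_atTop.1 hmain (e / 4) (by positivity)
  refine ⟨N, fun k hk => ?_⟩
  have h1 := abs_le.1 (hdiff (hf k))
  have h2 := abs_le.1 (hdiff hf₀)
  have h3 := hN k hk
  rw [Real.dist_eq, abs_lt] at h3 ⊢
  constructor <;> linarith

theorem ae_lineDeriv_eq_slice_gradient {u : Space d → ℝ → ℝ} {K : NNReal}
    (h : LipschitzWith K (fun p : Space d × ℝ => u p.1 p.2)) (i : Fin d) :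
    ∀ᵐ p : Space d × ℝ, lineDeriv ℝ (fun p : Space d × ℝ => u p.1 p.2) p
      (EuclideanSpace.single i 1, 0) = (∇ (fun y => u y p.2) p.1) i := by
  filter_upwards [h.ae_differentiableAt (μ := volume)] with p hp
  have h1 : HasFDerivAt (fun y : Space d => ((y, p.2) : Space d × ℝ))
      (ContinuousLinearMap.inl ℝ (Space d) ℝ) p.1 := hasFDerivAt_prodMk_left p.1 p.2
  have h2 : HasFDerivAt (fun y => u y p.2)
      ((fderiv ℝ (fun p : Space d × ℝ => u p.1 p.2) p).comp
        (ContinuousLinearMap.inl ℝ (Space d) ℝ)) p.1 :=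
    HasFDerivAt.comp (g := fun p : Space d × ℝ => u p.1 p.2) p.1 hp.hasFDerivAt h1
  rw [hp.lineDeriv_eq_fderiv, gradient_apply_eq_pderiv, pderiv, h2.fderiv]
  rfl

/-- Componentwise this is weak-`*` convergence of directional derivatives on all of space-time,
tested with an `L¹` function cut off to the cylinder. The freezing of negative times is not seen
there. -/
theorem weakStarTendsto_gradient {L C M : ℝ} {v : ℕ → Space d → ℝ → ℝ} {u : Space d → ℝ → ℝ}
    (hL : 0 ≤ L) (hC : 0 ≤ C) (hv : ∀ k, IsLipschitzFlow L C (fun x t => v k x (max t 0)))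
    (hu : IsLipschitzFlow L C u) (hM : ∀ k x t, 0 ≤ t → |v k x t| ≤ M)
    (hlim : ∀ x t, 0 ≤ t → Tendsto (fun k => v k x t) atTop (𝓝 (u x t))) (T : ℝ) :
    WeakStarTendsto T (fun k p => ∇ (fun y => v k y p.2) p.1)
      (fun p => ∇ (fun y => u y p.2) p.1) := by
  have hmem : ∀ᵐ p ∂(volume.restrict (cylinder d T)), p ∈ cylinder d T :=
    ae_restrict_mem (measurableSet_cylinder T)
  have hgrad : ∀ {w : Space d → ℝ → ℝ}, IsLipschitzFlow L C w →
      MemLp (fun p : Space d × ℝ => ∇ (fun y => w y p.2) p.1) ⊤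
        (volume.restrict (cylinder d T)) := fun {w} hw =>
    memLp_top_of_bound (measurable_slice_gradient
      (hw.lipschitzWith hL hC).continuous).aestronglyMeasurable L.toNNReal
      (Eventually.of_forall fun p => norm_gradient_le_of_lipschitz (hw.lipschitz_slice hL p.2) p.1)
  have hae : ∀ k, (fun p : Space d × ℝ => ∇ (fun y => v k y (max p.2 0)) p.1)
      =ᵐ[volume.restrict (cylinder d T)] fun p => ∇ (fun y => v k y p.2) p.1 := fun k => by
    filter_upwards [hmem] with p hp
    rw [max_eq_left hp.2.1.le]
  refine ⟨fun k => (hgrad (hv k)).ae_eq (hae k), hgrad hu, fun η hη => ?_⟩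
  have hexp : ∀ {w : Space d → ℝ → ℝ}, IsLipschitzFlow L C w →
      ∫ p in cylinder d T, inner ℝ (∇ (fun y => w y p.2) p.1) (η p)
        = ∑ i, ∫ p, lineDeriv ℝ (fun p : Space d × ℝ => w p.1 p.2) p (EuclideanSpace.single i 1, 0)
          * (cylinder d T).indicator (fun p => η p i) p := fun {w} hw => by
    have e1 : ∀ p : Space d × ℝ, inner ℝ (∇ (fun y => w y p.2) p.1) (η p)
        = ∑ i, (∇ (fun y => w y p.2) p.1) i * η p i := fun p => by
      rw [PiLp.inner_apply]
      exact Finset.sum_congr rfl fun i _ => by simp [mul_comm]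
    simp_rw [e1]
    have hηi : ∀ i, Integrable (fun p => η p i) (volume.restrict (cylinder d T)) := fun i =>
      (EuclideanSpace.proj (𝕜 := ℝ) i).integrable_comp hη
    have hint : ∀ i, Integrable (fun p : Space d × ℝ => (∇ (fun y => w y p.2) p.1) i * η p i)
        (volume.restrict (cylinder d T)) := fun i => by
      refine Integrable.bdd_mul (c := (L.toNNReal : ℝ)) (hηi i) ?_
        (Eventually.of_forall fun p => (abs_apply_le_norm _ i).trans
          (norm_gradient_le_of_lipschitz (hw.lipschitz_slice hL p.2) p.1))
      have hc : Continuous (fun q : Space d => q i) := by fun_prop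
      exact (hc.measurable.comp (measurable_slice_gradient
        (hw.lipschitzWith hL hC).continuous)).aestronglyMeasurable
    rw [integral_finsetSum _ fun i _ => hint i]
    refine Finset.sum_congr rfl fun i _ => ?_
    rw [← integral_indicator (measurableSet_cylinder T)]
    refine integral_congr_ae ?_
    filter_upwards [ae_lineDeriv_eq_slice_gradient (hw.lipschitzWith hL hC) i] with p hp
    rw [hp]
    by_cases hpc : p ∈ cylinder d T <;> simp [hpc]
  have hk : ∀ k, ∫ p in cylinder d T, inner ℝ (∇ (fun y => v k y p.2) p.1) (η p)
      = ∫ p in cylinder d T, inner ℝ (∇ (fun y => v k y (max p.2 0)) p.1) (η p) := fun k => by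
    refine integral_congr_ae ?_
    filter_upwards [hae k] with p hp
    rw [hp]
  simp_rw [hk, fun k => hexp (hv k)]
  rw [hexp hu]
  refine tendsto_finsetSum _ fun i _ => ?_
  refine tendsto_integral_lineDeriv_mul (fun k => (hv k).lipschitzWith hL hC)
    (hu.lipschitzWith hL hC) (fun k p => hM k p.1 _ (le_max_right _ _)) (fun p => ?_) _ ?_
  · rw [hu.eq_max]
    exact hlim p.1 _ (le_max_right _ _)
  · have hηi : IntegrableOn (fun p => η p i) (cylinder d T) :=
      (EuclideanSpace.proj (𝕜 := ℝ) i).integrable_comp hη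
    exact hηi.integrable_indicator (measurableSet_cylinder T)

/-! ### `Γ`-convergence of the energies -/

/-- A nonnegative continuous periodic function that is positive somewhere has positive integral. -/
theorem IsPeriodic.setIntegral_cube_pos {h : Space d → ℝ} (hp : IsPeriodic h) (hc : Continuous h)
    (h0 : ∀ x, 0 ≤ h x) {x₀ : Space d} (hx₀ : 0 < h x₀) : 0 < ∫ x in cube d, h x := by
  -- Translating the point of positivity to the centre of the cube places it in the interior, where
  -- a neighbourhood has positive measure.
  set c : Space d := WithLp.toLp 2 (fun _ => (1 / 2 : ℝ)) with hcdef
  rw [← hp.setIntegral_comp_add (x₀ - c)]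
  have hcont : Continuous (fun x => h (x + (x₀ - c))) := by fun_prop
  rw [setIntegral_pos_iff_support_of_nonneg_ae (Eventually.of_forall fun x => h0 _)
    (Continuous.integrableOn_cube hcont)]
  set I : Set (Space d) := {x | ∀ i, x i ∈ Ioo (0 : ℝ) 1} with hI
  have hIo : IsOpen I := by
    have : I = ⋂ i, (fun x : Space d => x i) ⁻¹' Ioo 0 1 := by ext x; simp [hI]
    rw [this]
    exact isOpen_iInter_of_finite fun i => isOpen_Ioo.preimage (by fun_prop)
  have hO : IsOpen (Function.support (fun x => h (x + (x₀ - c))) ∩ I) :=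
    (isOpen_ne_fun hcont continuous_const).inter hIo
  refine (hO.measure_pos volume ⟨c, ?_, fun i => ?_⟩).trans_le
    (measure_mono (inter_subset_inter_right _ fun x hx i => ⟨(hx i).1.le, (hx i).2⟩))
  · simp [hx₀.ne']
  · simp only [hcdef]; norm_num

/-- `ε` times the penalty. -/
noncomputable def violation (φ ψ : Space d → ℝ) (x : Space d) (s : ℝ) : ℝ :=
  (max (φ x - s) 0) ^ 4 + (max (s - ψ x) 0) ^ 4

theorem penalty_eq_violation (ε : ℝ) (φ ψ : Space d → ℝ) (x : Space d) (s : ℝ) :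
    penalty ε φ ψ x s = 1 / ε * violation φ ψ x s := by
  rw [penalty, violation, mul_add]

theorem violation_nonneg (φ ψ : Space d → ℝ) (x : Space d) (s : ℝ) : 0 ≤ violation φ ψ x s := by
  unfold violation; positivity

theorem penalty_nonneg {ε : ℝ} (hε : 0 < ε) (φ ψ : Space d → ℝ) (x : Space d) (s : ℝ) :
    0 ≤ penalty ε φ ψ x s := by
  unfold penalty; positivity

theorem penalty_eq_zero (ε : ℝ) {φ ψ : Space d → ℝ} {x : Space d} {s : ℝ} (h1 : φ x ≤ s)
    (h2 : s ≤ ψ x) : penalty ε φ ψ x s = 0 := by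
  rw [penalty, max_eq_right (by linarith), max_eq_right (by linarith)]; simp

theorem tendsto_integral_of_tendstoUniformly {w : ℕ → Space d → ℝ} {w₀ : Space d → ℝ}
    (hw : ∀ i, Continuous (w i)) (hw₀ : Continuous w₀) (hper : IsPeriodic w₀)
    (h : TendstoUniformly w w₀ atTop) {Φ : Space d → ℝ → ℝ}
    (hΦ : Continuous (fun p : Space d × ℝ => Φ p.1 p.2)) :
    Tendsto (fun i => ∫ x in cube d, Φ x (w i x)) atTop (𝓝 (∫ x in cube d, Φ x (w₀ x))) := by
  obtain ⟨M, hM⟩ := hper.exists_bound hw₀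
  have hK : IsCompact (closure (cube d) ×ˢ Icc (-(M + 1)) (M + 1)) :=
    isCompact_closure_cube.prod isCompact_Icc
  obtain ⟨B, hB⟩ := hK.exists_bound_of_continuousOn hΦ.continuousOn
  have hev := Metric.tendstoUniformly_iff.1 h 1 one_pos
  refine tendsto_integral_filter_of_dominated_convergence (fun _ => B)
    (Eventually.of_forall fun i => ?_) ?_ (integrable_const B) (Eventually.of_forall fun x => ?_)
  · exact (hΦ.comp (continuous_id.prodMk (hw i))).aestronglyMeasurable
  · filter_upwards [hev] with i hi
    filter_upwards [ae_restrict_mem measurableSet_cube] with x hx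
    refine hB (x, w i x) ⟨subset_closure hx, abs_le.1 ?_⟩
    have h1 := hi x
    have h2 := hM x
    rw [Real.dist_eq, abs_lt] at h1
    rw [abs_le] at h2
    exact abs_le.2 ⟨by linarith, by linarith⟩
  · exact (hΦ.tendsto (x, w₀ x)).comp
      (tendsto_const_nhds.prodMk_nhds (h.tendsto_at x))

theorem ofReal_integral_norm_le_regEnergy {ε : ℝ} (hε : 0 < ε) (φ ψ : Space d → ℝ)
    {w : Space d → ℝ} (hw : MemW1Infty w) :
    ENNReal.ofReal (∫ x in cube d, ‖weakGradient w x‖) ≤ regEnergy ε φ ψ w := by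
  rw [ofReal_integral_eq_lintegral_ofReal hw.isWeakGradient.integrableOn.norm
    (Eventually.of_forall fun x => norm_nonneg _)]
  refine lintegral_mono fun x => ENNReal.ofReal_le_ofReal ?_
  have h1 := norm_le_regNorm ε (weakGradient w x)
  linarith [penalty_nonneg hε φ ψ x (w x)]

theorem regEnergy_le_add {ε : ℝ} (hε : 0 < ε) {φ ψ : Space d → ℝ} {w : Space d → ℝ}
    (hw : ∀ x, φ x ≤ w x ∧ w x ≤ ψ x) :
    regEnergy ε φ ψ w ≤ (∫⁻ x in cube d, ‖weakGradient w x‖ₑ) + ENNReal.ofReal ε := by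
  have h1 : regEnergy ε φ ψ w
      ≤ ∫⁻ x in cube d, (‖weakGradient w x‖ₑ + ENNReal.ofReal ε) := by
    refine lintegral_mono fun x => ?_
    rw [penalty_eq_zero ε (hw x).1 (hw x).2, add_zero, ← ofReal_norm,
      ← ENNReal.ofReal_add (norm_nonneg _) hε.le]
    refine ENNReal.ofReal_le_ofReal ?_
    have := regNorm_le_add hε.le (weakGradient w x)
    linarith
  refine h1.trans ?_
  rw [lintegral_add_right _ measurable_const]
  simp

/-- Admissible limit: the total variation is a limit of pairings with smooth fields, and each
pairing is continuous under uniform convergence after integration by parts. Inadmissible limit: the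
violation keeps a positive integral, which is divided by `ε`. -/
theorem limitEnergy_le_liminf {ε : ℕ → ℝ} (hε : ∀ k, 0 < ε k) (hε0 : Tendsto ε atTop (𝓝 0))
    {φ ψ : Space d → ℝ} (hφ : Continuous φ) (hψ : Continuous ψ) (hφp : IsPeriodic φ)
    (hψp : IsPeriodic ψ) {w : ℕ → Space d → ℝ} {w₀ : Space d → ℝ} (hw : ∀ i, MemW1Infty (w i))
    (hw₀ : MemW1Infty w₀) (h : TendstoUniformly w w₀ atTop) :
    limitEnergy φ ψ w₀ ≤ liminf (fun i => regEnergy (ε i) φ ψ (w i)) atTop := by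
  by_cases hob : ∀ x, φ x ≤ w₀ x ∧ w₀ x ≤ ψ x
  · have hG := hw₀.isWeakGradient
    obtain ⟨ζ, h1, h2, h3, h4⟩ := exists_smooth_dual hG.integrableOn
    have hE : limitEnergy φ ψ w₀ = ENNReal.ofReal (∫ x in cube d, ‖weakGradient w₀ x‖) := by
      rw [limitEnergy, if_pos hob, ofReal_integral_norm_eq_lintegral_enorm hG.integrableOn]
    rw [hE]
    refine le_of_tendsto' ((ENNReal.continuous_ofReal.tendsto _).comp h4) fun n => ?_
    have hdiv : Continuous (fun x => ∑ i, pderiv i (fun y => ζ n y i) x) :=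
      continuous_finsetSum _ fun i _ =>
        (contDiff_pderiv_infty ((contDiff_apply i).comp (h1 n)) i).continuous
    have h5 : Tendsto (fun i => ∫ x in cube d, inner ℝ (weakGradient (w i) x) (ζ n x)) atTop
        (𝓝 (∫ x in cube d, inner ℝ (weakGradient w₀ x) (ζ n x))) := by
      rw [hG.integral_inner (h1 n) (h2 n)]
      simp_rw [fun i => (hw i).isWeakGradient.integral_inner (h1 n) (h2 n)]
      refine Tendsto.neg ?_
      exact tendsto_integral_of_tendstoUniformly (fun i => (hw i).2.1) hw₀.2.1 hw₀.1 h
        (Φ := fun x s => s * ∑ i, pderiv i (fun y => ζ n y i) x)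
        (continuous_snd.mul (hdiv.comp continuous_fst))
    have h6 := ((ENNReal.continuous_ofReal.tendsto _).comp h5).liminf_eq
    simp only [Function.comp_apply] at h6 ⊢
    rw [← h6]
    refine liminf_le_liminf (Eventually.of_forall fun i => ?_)
    refine le_trans (ENNReal.ofReal_le_ofReal ?_)
      (ofReal_integral_norm_le_regEnergy (hε i) φ ψ (hw i))
    have hGi := (hw i).isWeakGradient.integrableOn
    have hle : ∀ x, ‖inner ℝ (weakGradient (w i) x) (ζ n x)‖ ≤ ‖weakGradient (w i) x‖ := fun x => by
      rw [Real.norm_eq_abs]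
      exact (abs_real_inner_le_norm _ _).trans (mul_le_of_le_one_right (norm_nonneg _) (h3 n x))
    exact (le_abs_self _).trans (norm_integral_le_of_norm_le hGi.norm (Eventually.of_forall hle))
  · have hΦ : Continuous (fun p : Space d × ℝ => violation φ ψ p.1 p.2) := by
      unfold violation; fun_prop
    have hlim := tendsto_integral_of_tendstoUniformly (fun i => (hw i).2.1) hw₀.2.1 hw₀.1 h hΦ
    have hpos : 0 < ∫ x in cube d, violation φ ψ x (w₀ x) := by
      obtain ⟨x₀, hx₀⟩ := not_forall.1 hob
      refine IsPeriodic.setIntegral_cube_pos (x₀ := x₀) (fun x k => ?_)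
        (hΦ.comp (continuous_id.prodMk hw₀.2.1)) (fun x => violation_nonneg φ ψ x _) ?_
      · simp only [violation, hφp x k, hψp x k, hw₀.1 x k]
      · unfold violation
        by_cases h1 : φ x₀ ≤ w₀ x₀
        · have h2 : ψ x₀ < w₀ x₀ := by
            by_contra h3
            exact hx₀ ⟨h1, not_lt.1 h3⟩
          have : 0 < max (w₀ x₀ - ψ x₀) 0 := lt_max_of_lt_left (by linarith)
          positivity
        · have : 0 < max (φ x₀ - w₀ x₀) 0 := lt_max_of_lt_left (by linarith)
          positivity
    have hinv : Tendsto (fun i => 1 / ε i) atTop atTop := by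
      simp_rw [one_div]
      exact tendsto_inv_nhdsGT_zero.comp (tendsto_nhdsWithin_iff.2 ⟨hε0,
        Eventually.of_forall hε⟩)
    have htop : Tendsto (fun i => regEnergy (ε i) φ ψ (w i)) atTop (𝓝 ⊤) := by
      refine tendsto_nhds_top_mono'
        (ENNReal.tendsto_ofReal_atTop.comp (hinv.atTop_mul_pos hpos hlim)) fun i => ?_
      simp only [Function.comp_apply]
      have hci : Continuous (fun x => violation φ ψ x (w i x)) :=
        hΦ.comp (continuous_id.prodMk (hw i).2.1)
      rw [← integral_const_mul, ofReal_integral_eq_lintegral_ofReal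
        ((Continuous.integrableOn_cube hci).const_mul _)
        (Eventually.of_forall fun x => by
          simp only [Pi.zero_apply, ← penalty_eq_violation]; exact penalty_nonneg (hε i) φ ψ x _)]
      refine lintegral_mono fun x => ENNReal.ofReal_le_ofReal ?_
      rw [← penalty_eq_violation]
      linarith [(regNorm_pos (hε i) (weakGradient (w i) x)).le]
    rw [htop.liminf_eq]
    exact le_top

theorem gammaConverges_regEnergy {ε : ℕ → ℝ} (hε : ∀ k, 0 < ε k) (hε0 : Tendsto ε atTop (𝓝 0))
    {φ ψ : Space d → ℝ} (hφ : Continuous φ) (hψ : Continuous ψ) (hφp : IsPeriodic φ)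
    (hψp : IsPeriodic ψ) :
    GammaConverges (fun k => regEnergy (ε k) φ ψ) (limitEnergy φ ψ) := by
  refine ⟨fun w w₀ hw hw₀ h => limitEnergy_le_liminf hε hε0 hφ hψ hφp hψp hw hw₀ h, fun w₀ hw₀ => ?_⟩
  -- Constant sequences suffice: for an admissible function the penalty vanishes and `|p|_ε ≤ ‖p‖ +
  -- ε`; otherwise the limit energy is infinite.
  refine ⟨fun _ => w₀, fun _ => hw₀, fun U hU => Eventually.of_forall fun _ _ => refl_mem_uniformity hU, ?_⟩
  by_cases hob : ∀ x, φ x ≤ w₀ x ∧ w₀ x ≤ ψ x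
  · rw [limitEnergy, if_pos hob]
    have hlim : Tendsto (fun k => (∫⁻ x in cube d, ‖weakGradient w₀ x‖ₑ) + ENNReal.ofReal (ε k))
        atTop (𝓝 (∫⁻ x in cube d, ‖weakGradient w₀ x‖ₑ)) := by
      have := (ENNReal.continuous_ofReal.tendsto 0).comp hε0
      simpa using (tendsto_const_nhds (x := ∫⁻ x in cube d, ‖weakGradient w₀ x‖ₑ)).add this
    rw [← hlim.limsup_eq]
    exact limsup_le_limsup (Eventually.of_forall fun k => regEnergy_le_add (hε k) hob)
  · rw [limitEnergy, if_neg hob]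
    exact le_top

/-! ### Accretivity of the regularised operator -/

theorem abs_regNorm_sub_le {ε : ℝ} (hε : 0 < ε) (p q : Space d) :
    |regNorm ε p - regNorm ε q| ≤ ‖p - q‖ := by
  have key : ∀ p q : Space d, regNorm ε p ≤ regNorm ε q + ‖p - q‖ := fun p q => by
    refine Real.sqrt_le_iff.2 ⟨by positivity [regNorm_pos hε q], ?_⟩
    have h1 := regNorm_sq ε q
    have h2 : ‖p‖ ≤ ‖q‖ + ‖p - q‖ := by
      have := norm_add_le q (p - q)
      rwa [add_sub_cancel] at this
    nlinarith [norm_nonneg p, norm_nonneg q, norm_nonneg (p - q), norm_le_regNorm ε q]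
  have h1 := key p q
  have h2 := key q p
  rw [norm_sub_rev] at h2
  exact abs_le.2 ⟨by linarith, by linarith⟩

theorem abs_inv_regNorm_sub_le {ε : ℝ} (hε : 0 < ε) (p q : Space d) :
    |(regNorm ε p)⁻¹ - (regNorm ε q)⁻¹| ≤ ‖p - q‖ / ε ^ 2 := by
  have hp := regNorm_pos hε p
  have hq := regNorm_pos hε q
  rw [inv_sub_inv hp.ne' hq.ne', abs_div, abs_of_pos (mul_pos hp hq)]
  rw [abs_sub_comm]
  refine div_le_div₀ (norm_nonneg _) (abs_regNorm_sub_le hε p q) (by positivity) ?_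
  nlinarith [le_regNorm ε p, le_regNorm ε q]

/-- Strong monotonicity of `p ↦ p / |p|_ε` on bounded sets. -/
theorem regNormal_strongly_monotone {ε R : ℝ} (hε : 0 < ε) {p q : Space d} (hp : regNorm ε p ≤ R)
    (hq : regNorm ε q ≤ R) :
    ε ^ 2 / R ^ 3 * ‖p - q‖ ^ 2 ≤ inner ℝ (regNormal ε p - regNormal ε q) (p - q) := by
  set P := regNorm ε p with hP
  set Q := regNorm ε q with hQ
  have hP0 : 0 < P := regNorm_pos hε p
  have hQ0 : 0 < Q := regNorm_pos hε q
  have hR0 : 0 < R := hP0.trans_le hp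
  have hPs : P ^ 2 = ε ^ 2 + ‖p‖ ^ 2 := regNorm_sq ε p
  have hQs : Q ^ 2 = ε ^ 2 + ‖q‖ ^ 2 := regNorm_sq ε q
  set z : ℝ := inner ℝ p q with hz
  have hcs : z ^ 2 ≤ ‖p‖ ^ 2 * ‖q‖ ^ 2 := by
    have := abs_real_inner_le_norm p q
    rw [← mul_pow, ← sq_abs]
    gcongr
  have hN : ‖p - q‖ ^ 2 = ‖p‖ ^ 2 + ‖q‖ ^ 2 - 2 * z := by
    rw [norm_sub_sq_real]; ring
  have hI : inner ℝ (regNormal ε p - regNormal ε q) (p - q)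
      = (P + Q) * (P * Q - (z + ε ^ 2)) / (P * Q) := by
    simp only [regNormal, inner_sub_left, inner_sub_right, inner_smul_left, real_inner_self_eq_norm_sq,
      conj_trivial, ← hP, ← hQ]
    rw [real_inner_comm p q, ← hz]
    have e1 : ‖p‖ ^ 2 = P ^ 2 - ε ^ 2 := by linarith
    have e2 : ‖q‖ ^ 2 = Q ^ 2 - ε ^ 2 := by linarith
    rw [e1, e2]
    field_simp
    ring
  have hPQ : 0 < P * Q := mul_pos hP0 hQ0
  -- The right-hand side equals the left-hand side plus `‖p‖² ‖q‖² - z²`, which is nonnegative by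
  -- Cauchy–Schwarz. Dividing by the sum of the two squared quantities' roots, at most `2 P Q`,
  -- gives `hkey`.
  have hprod : ε ^ 2 * ‖p - q‖ ^ 2 ≤ (P * Q) ^ 2 - (z + ε ^ 2) ^ 2 := by
    rw [mul_pow, hPs, hQs, hN]
    nlinarith
  have hle : z + ε ^ 2 ≤ P * Q := by
    refine le_of_abs_le (abs_le_of_sq_le_sq ?_ hPQ.le)
    nlinarith [mul_nonneg (sq_nonneg ε) (sq_nonneg ‖p - q‖)]
  have hkey : ε ^ 2 * ‖p - q‖ ^ 2 / (2 * (P * Q)) ≤ P * Q - (z + ε ^ 2) := by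
    rw [div_le_iff₀ (by positivity)]
    nlinarith
  rw [hI]
  calc ε ^ 2 / R ^ 3 * ‖p - q‖ ^ 2
      = (2 / R) * (ε ^ 2 * ‖p - q‖ ^ 2 / (2 * R ^ 2)) := by field_simp
    _ ≤ ((P + Q) / (P * Q)) * (ε ^ 2 * ‖p - q‖ ^ 2 / (2 * (P * Q))) := by
        have h1 : 2 / R ≤ (P + Q) / (P * Q) := by
          rw [div_le_div_iff₀ hR0 hPQ]
          nlinarith
        have h2 : ε ^ 2 * ‖p - q‖ ^ 2 / (2 * R ^ 2) ≤ ε ^ 2 * ‖p - q‖ ^ 2 / (2 * (P * Q)) := by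
          refine div_le_div_of_nonneg_left (by positivity) (by positivity) ?_
          nlinarith
        exact mul_le_mul h1 h2 (by positivity) (by positivity)
    _ ≤ ((P + Q) / (P * Q)) * (P * Q - (z + ε ^ 2)) := by
        gcongr
    _ = _ := by ring

/-- Integration by parts for the regularised curvature. -/
theorem integral_regCurvature_mul {ε : ℝ} (hε : 0 < ε) {v h : Space d → ℝ} (hv : ContDiff ℝ 2 v)
    (hvp : IsPeriodic v) {K : NNReal} (hh : LipschitzWith K h) (hhp : IsPeriodic h) :
    ∫ x in cube d, -regCurvature ε v x * h x
      = - ∫ x in cube d, inner ℝ (regNormal ε (∇ v x)) (∇ h x) := by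
  have hν := contDiff_regNormal_gradient hε hv
  have hνp : ∀ i, IsPeriodic (fun x => (∇ v x) i / regNorm ε (∇ v x)) := fun i x k => by
    have := hvp.grad x k
    simp only at this ⊢
    rw [this]
  have hνc : ∀ i, Continuous (pderiv i (fun x => (∇ v x) i / regNorm ε (∇ v x))) := fun i =>
    (contDiff_pderiv (m := 0) (hν i) (by norm_num) i).continuous
  have e1 : ∀ x, -regCurvature ε v x * h x
      = ∑ i, pderiv i (fun y => (∇ v y) i / regNorm ε (∇ v y)) x * h x := fun x => by
    rw [regCurvature, neg_neg, Finset.sum_mul]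
  have e2 : ∀ x, inner ℝ (regNormal ε (∇ v x)) (∇ h x)
      = ∑ i, ((∇ v x) i / regNorm ε (∇ v x)) * (∇ h x) i := fun x => by
    rw [PiLp.inner_apply]
    exact Finset.sum_congr rfl fun i _ => by simp [regNormal_apply, mul_comm]
  have i1 : ∀ i, IntegrableOn
      (fun x => pderiv i (fun y => (∇ v y) i / regNorm ε (∇ v y)) x * h x) (cube d) := fun i =>
    Continuous.integrableOn_cube ((hνc i).mul hh.continuous)
  have i2 : ∀ i, IntegrableOn
      (fun x => ((∇ v x) i / regNorm ε (∇ v x)) * (∇ h x) i) (cube d) := fun i => by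
    have hm : Measurable (fun x => (∇ h x) i) := by
      have hc : Continuous (fun q : Space d => q i) := by fun_prop
      exact hc.measurable.comp (measurable_gradient h)
    exact Integrable.mul_bdd (c := (K : ℝ)) (Continuous.integrableOn_cube (hν i).continuous)
      hm.aestronglyMeasurable (Eventually.of_forall fun x =>
        (abs_apply_le_norm _ i).trans (norm_gradient_le_of_lipschitz hh x))
  simp_rw [e1, e2]
  rw [integral_finsetSum _ fun i _ => i1 i, integral_finsetSum _ fun i _ => i2 i,
    ← Finset.sum_neg_distrib]
  refine Finset.sum_congr rfl fun i _ => ?_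
  obtain ⟨K', hK'⟩ := (hνp i).exists_lipschitzWith (hν i)
  have := integral_gradient_mul_cube hK' hh (hνp i) hhp i
  simp_rw [gradient_apply_eq_pderiv] at this ⊢
  exact this

/-- The speed `-H_ε + f_ε` of the regularised flow relative to `|∇v|_ε`. -/
noncomputable def speed (ε : ℝ) (φ ψ v : Space d → ℝ) (x : Space d) : ℝ :=
  -regCurvature ε v x + force ε φ ψ x (v x)

theorem continuous_regCurvature {ε : ℝ} (hε : 0 < ε) {v : Space d → ℝ} (hv : ContDiff ℝ 2 v) :
    Continuous (regCurvature ε v) :=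
  (continuous_finsetSum _ fun i _ => (contDiff_pderiv (m := 0)
    (contDiff_regNormal_gradient hε hv i) (by norm_num) i).continuous).neg

theorem continuous_force {ε : ℝ} {φ ψ v : Space d → ℝ} (hφ : Continuous φ) (hψ : Continuous ψ)
    (hv : Continuous v) : Continuous (fun x => force ε φ ψ x (v x)) := by
  unfold force; fun_prop

theorem continuous_speed {ε : ℝ} (hε : 0 < ε) {φ ψ v : Space d → ℝ} (hφ : Continuous φ)
    (hψ : Continuous ψ) (hv : ContDiff ℝ 2 v) : Continuous (speed ε φ ψ v) :=
  (continuous_regCurvature hε hv).neg.add (continuous_force hφ hψ hv.continuous)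

theorem continuous_regNormal {ε : ℝ} (hε : 0 < ε) {v : Space d → ℝ} (hv : ContDiff ℝ 1 v) :
    Continuous (fun x => regNormal ε (∇ v x)) :=
  (((continuous_regNorm ε).comp (continuous_gradient hv)).inv₀
    fun _ => (regNorm_pos hε _).ne').smul (continuous_gradient hv)

/-- The operator `v ↦ -speed v` is accretive, with a quantitative gradient term. -/
theorem integral_speed_sub_mul_le {ε R : ℝ} (hε : 0 < ε) {φ ψ v w : Space d → ℝ}
    (hφ : Continuous φ) (hψ : Continuous ψ) (hv : ContDiff ℝ 2 v) (hw : ContDiff ℝ 2 w)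
    (hvp : IsPeriodic v) (hwp : IsPeriodic w) (hvR : ∀ x, regNorm ε (∇ v x) ≤ R)
    (hwR : ∀ x, regNorm ε (∇ w x) ≤ R) {β : ℝ → ℝ} (hβ : ContDiff ℝ 1 β) (hβm : Monotone β)
    (hβ0 : β 0 = 0) :
    ∫ x in cube d, (speed ε φ ψ v x - speed ε φ ψ w x) * β (v x - w x)
      ≤ - ∫ x in cube d, ε ^ 2 / R ^ 3 * (deriv β (v x - w x) * ‖∇ v x - ∇ w x‖ ^ 2) := by
  have hv1 : ContDiff ℝ 1 v := hv.of_le (by norm_num)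
  have hw1 : ContDiff ℝ 1 w := hw.of_le (by norm_num)
  set h : Space d → ℝ := fun x => β (v x - w x) with hh
  have hhs : ContDiff ℝ 1 h := hβ.comp (hv1.sub hw1)
  have hhp : IsPeriodic h := fun x k => by simp only [hh, hvp x k, hwp x k]
  obtain ⟨K, hK⟩ := hhp.exists_lipschitzWith hhs
  have hgrad : ∀ x, ∇ h x = deriv β (v x - w x) • (∇ v x - ∇ w x) := fun x => by
    have hvx := hv1.differentiable one_ne_zero x
    have hwx := hw1.differentiable one_ne_zero x
    have h1 : HasFDerivAt h (deriv β (v x - w x) • (fderiv ℝ v x - fderiv ℝ w x)) x :=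
      HasDerivAt.comp_hasFDerivAt x (hβ.differentiable one_ne_zero _).hasDerivAt
        (hvx.hasFDerivAt.sub hwx.hasFDerivAt)
    ext i
    rw [gradient_apply_eq_pderiv, pderiv, h1.fderiv]
    simp [gradient_apply_eq_pderiv, pderiv]
  have c1 := continuous_regCurvature hε hv
  have c2 := continuous_regCurvature hε hw
  have f1 := continuous_force (ε := ε) hφ hψ hv.continuous
  have f2 := continuous_force (ε := ε) hφ hψ hw.continuous
  have n1 := continuous_regNormal hε hv1
  have n2 := continuous_regNormal hε hw1
  have g1 := continuous_gradient hv1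
  have g2 := continuous_gradient hw1
  have hc := hhs.continuous
  have gh := continuous_gradient hhs
  have hβ' : Continuous (fun x => deriv β (v x - w x)) :=
    (hβ.continuous_deriv le_rfl).comp (hv.continuous.sub hw.continuous)
  have e1 : ∀ x, (speed ε φ ψ v x - speed ε φ ψ w x) * β (v x - w x)
      = -regCurvature ε v x * h x - -regCurvature ε w x * h x
        + (force ε φ ψ x (v x) - force ε φ ψ x (w x)) * h x := fun x => by
    simp only [speed, hh]; ring
  simp_rw [e1]
  have i1 : IntegrableOn (fun x => -regCurvature ε v x * h x) (cube d) :=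
    (c1.neg.mul hc).integrableOn_cube
  have i2 : IntegrableOn (fun x => -regCurvature ε w x * h x) (cube d) :=
    (c2.neg.mul hc).integrableOn_cube
  have i3 : IntegrableOn (fun x => (force ε φ ψ x (v x) - force ε φ ψ x (w x)) * h x) (cube d) :=
    ((f1.sub f2).mul hc).integrableOn_cube
  have i4 : IntegrableOn (fun x => -regCurvature ε v x * h x - -regCurvature ε w x * h x)
      (cube d) := i1.sub i2
  rw [integral_add i4 i3, integral_sub i1 i2,
    integral_regCurvature_mul hε hv hvp hK hhp, integral_regCurvature_mul hε hw hwp hK hhp]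
  have hforce : ∫ x in cube d, (force ε φ ψ x (v x) - force ε φ ψ x (w x)) * h x ≤ 0 := by
    refine integral_nonpos fun x => ?_
    simp only [Pi.zero_apply, hh]
    rcases le_total (v x) (w x) with hx | hx
    · have a1 : β (v x - w x) ≤ 0 := hβ0 ▸ hβm (by linarith : v x - w x ≤ 0)
      have a2 := force_le_force hε (φ := φ) (ψ := ψ) (x := x) (y := x) (s := w x) (r := v x)
        (by linarith) (by linarith)
      nlinarith
    · have a1 : 0 ≤ β (v x - w x) := hβ0 ▸ hβm (by linarith : 0 ≤ v x - w x)
      have a2 := force_le_force hε (φ := φ) (ψ := ψ) (x := x) (y := x) (s := v x) (r := w x)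
        (by linarith) (by linarith)
      nlinarith
  have hmono : ∫ x in cube d, ε ^ 2 / R ^ 3 * (deriv β (v x - w x) * ‖∇ v x - ∇ w x‖ ^ 2)
      ≤ (∫ x in cube d, inner ℝ (regNormal ε (∇ v x)) (∇ h x))
        - ∫ x in cube d, inner ℝ (regNormal ε (∇ w x)) (∇ h x) := by
    rw [← integral_sub (n1.inner gh).integrableOn_cube (n2.inner gh).integrableOn_cube]
    refine integral_mono (Continuous.integrableOn_cube ?_)
      ((n1.inner gh).sub (n2.inner gh)).integrableOn_cube fun x => ?_
    · exact continuous_const.mul (hβ'.mul ((g1.sub g2).norm.pow 2))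
    · simp only
      rw [← inner_sub_left, hgrad, inner_smul_right]
      have a1 := regNormal_strongly_monotone hε (hvR x) (hwR x)
      have a2 : 0 ≤ deriv β (v x - w x) := hβm.deriv_nonneg
      nlinarith
  linarith

/-- Accretivity in `L²`, controlling the weights `1 / |∇v|_ε`. -/
theorem integral_speed_sub_mul_sub_le {ε R : ℝ} (hε : 0 < ε) {φ ψ v w : Space d → ℝ}
    (hφ : Continuous φ) (hψ : Continuous ψ) (hv : ContDiff ℝ 2 v) (hw : ContDiff ℝ 2 w)
    (hvp : IsPeriodic v) (hwp : IsPeriodic w) (hR : 0 < R) (hvR : ∀ x, regNorm ε (∇ v x) ≤ R)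
    (hwR : ∀ x, regNorm ε (∇ w x) ≤ R) :
    ∫ x in cube d, (speed ε φ ψ v x - speed ε φ ψ w x) * (v x - w x)
      ≤ - (ε ^ 6 / R ^ 3
        * ∫ x in cube d, ((regNorm ε (∇ v x))⁻¹ - (regNorm ε (∇ w x))⁻¹) ^ 2) := by
  have h := integral_speed_sub_mul_le hε hφ hψ hv hw hvp hwp hvR hwR (β := fun s => s) contDiff_id
    monotone_id rfl
  refine h.trans (neg_le_neg ?_)
  rw [← integral_const_mul]
  have g1 := continuous_gradient (hv.of_le (m := 1) (by norm_num))
  have g2 := continuous_gradient (hw.of_le (m := 1) (by norm_num))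
  have a1 : Continuous (fun x => (regNorm ε (∇ v x))⁻¹) :=
    ((continuous_regNorm ε).comp g1).inv₀ fun x => (regNorm_pos hε _).ne'
  have a2 : Continuous (fun x => (regNorm ε (∇ w x))⁻¹) :=
    ((continuous_regNorm ε).comp g2).inv₀ fun x => (regNorm_pos hε _).ne'
  simp only [deriv_id'', one_mul]
  refine integral_mono (continuous_const.mul ((a1.sub a2).pow 2)).integrableOn_cube
    (continuous_const.mul ((g1.sub g2).norm.pow 2)).integrableOn_cube fun x => ?_
  simp only
  -- Source of `ε ^ 6`: the factor `ε²` of strong monotonicity times `ε⁴` from the squared Lipschitz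
  -- constant `1 / ε²` of the weight.
  have h1 := abs_inv_regNorm_sub_le hε (∇ v x) (∇ w x)
  have h2 : ((regNorm ε (∇ v x))⁻¹ - (regNorm ε (∇ w x))⁻¹) ^ 2
      ≤ (‖∇ v x - ∇ w x‖ / ε ^ 2) ^ 2 := by
    rw [← sq_abs]; gcongr
  calc ε ^ 6 / R ^ 3 * ((regNorm ε (∇ v x))⁻¹ - (regNorm ε (∇ w x))⁻¹) ^ 2
      ≤ ε ^ 6 / R ^ 3 * (‖∇ v x - ∇ w x‖ / ε ^ 2) ^ 2 := by gcongr
    _ = _ := by field_simp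

/-- The equation in the form `A V = speed`, which makes accretivity of the operator a statement
about weighted velocities. -/
theorem IsClassicalSolution.deriv_eq_regNorm_mul_speed {ε : ℝ} {φ ψ g : Space d → ℝ}
    {u : Space d → ℝ → ℝ} (hu : IsClassicalSolution ε φ ψ g u) (hε : 0 < ε) (x : Space d) {t : ℝ}
    (ht : 0 < t) : (regNorm ε (∇ (fun y => u y t) x))⁻¹ * deriv (u x) t
      = speed ε φ ψ (fun y => u y t) x := by
  rw [hu.equation x t ht, ← regNorm_mul_regCurvature hε (hu.contDiff_space t ht), ← mul_add,
    inv_mul_cancel_left₀ (regNorm_pos hε _).ne', speed]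

/-! ### Integrals over space-time slabs -/

/-- Lebesgue measure on `[0,1)^d × (a,b]`. -/
noncomputable def slab (d : ℕ) (a b : ℝ) : Measure (Space d × ℝ) :=
  (volume.restrict (cube d)).prod (volume.restrict (Ioc a b))

instance isFiniteMeasure_slab (a b : ℝ) : IsFiniteMeasure (slab d a b) := by
  unfold slab; infer_instance

theorem slab_real_univ {a b : ℝ} (hab : a ≤ b) : (slab d a b).real univ = b - a := by
  rw [slab, ← univ_prod_univ, measureReal_prod_prod]
  simp [hab]

theorem integrable_slab {f : Space d × ℝ → ℝ} (hf : Continuous f) (a b : ℝ) :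
    Integrable f (slab d a b) := by
  rw [slab, Measure.prod_restrict]
  exact (hf.continuousOn.integrableOn_compact (isCompact_closure_cube.prod (isCompact_Icc (a := a)
    (b := b)))).mono_set (prod_mono subset_closure Ioc_subset_Icc_self)

theorem integral_slab {f : Space d × ℝ → ℝ} (hf : Continuous f) (a b : ℝ) :
    ∫ p, f p ∂slab d a b = ∫ t in Ioc a b, ∫ x in cube d, f (x, t) :=
  integral_prod_symm f (integrable_slab hf a b)

theorem integrableOn_slice_integral {f : Space d × ℝ → ℝ} (hf : Continuous f) (a b : ℝ) :
    IntegrableOn (fun t => ∫ x in cube d, f (x, t)) (Ioc a b) :=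
  (integrable_slab hf a b).integral_prod_right

theorem integral_slab_deriv {P P' : Space d × ℝ → ℝ} (hP : Continuous P) (hP' : Continuous P')
    {a b : ℝ} (hab : a ≤ b)
    (hd : ∀ x t, t ∈ Ioo a b → HasDerivAt (fun s => P (x, s)) (P' (x, t)) t) :
    ∫ p, P' p ∂slab d a b = (∫ x in cube d, P (x, b)) - ∫ x in cube d, P (x, a) := by
  have hs : ∀ t, Continuous (fun x => P (x, t)) := fun t => by fun_prop
  rw [← integral_sub (hs b).integrableOn_cube (hs a).integrableOn_cube, slab,
    integral_prod _ (integrable_slab hP' a b)]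
  refine integral_congr_ae (Eventually.of_forall fun x => ?_)
  simp only
  rw [← intervalIntegral.integral_of_le hab]
  refine intervalIntegral.integral_eq_sub_of_hasDerivAt_of_le hab
    (by fun_prop : Continuous fun s => P (x, s)).continuousOn (fun t ht => hd x t ht) ?_
  exact (by fun_prop : Continuous fun s => P' (x, s)).intervalIntegrable _ _

/-! ### Flows with a weight -/

/-- `∂_t U = V`, and `-A V` is an accretive function of `U`, strongly so with respect to `A`. -/
structure WeightedFlow (t₁ C Λ c : ℝ) (U V A : Space d × ℝ → ℝ) : Prop where
  C_nonneg : 0 ≤ C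
  Λ_nonneg : 0 ≤ Λ
  c_pos : 0 < c
  continuous_U : Continuous U
  continuous_V : Continuous V
  continuous_A : Continuous A
  hasDerivAt : ∀ x t, t₁ < t → HasDerivAt (fun s => U (x, s)) (V (x, t)) t
  lipschitz : ∀ x t s, |U (x, s) - U (x, t)| ≤ C * |s - t|
  abs_V_le : ∀ p, |V p| ≤ C
  A_nonneg : ∀ p, 0 ≤ A p
  A_le : ∀ p, A p ≤ Λ
  accretive : ∀ (s t : ℝ) (β : ℝ → ℝ), ContDiff ℝ 1 β → Monotone β → β 0 = 0 →
    ∫ x in cube d, (A (x, s) * V (x, s) - A (x, t) * V (x, t)) * β (U (x, s) - U (x, t)) ≤ 0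
  strong : ∀ s t : ℝ,
    ∫ x in cube d, (A (x, s) * V (x, s) - A (x, t) * V (x, t)) * (U (x, s) - U (x, t))
      ≤ - (c * ∫ x in cube d, (A (x, s) - A (x, t)) ^ 2)

/-- The mean of `A` over `[t, t + r]`. -/
noncomputable def timeMean (r : ℝ) (A : Space d × ℝ → ℝ) (p : Space d × ℝ) : ℝ :=
  r⁻¹ * ∫ s in p.2..(p.2 + r), A (p.1, s)

theorem continuous_timeMean (r : ℝ) {A : Space d × ℝ → ℝ} (hA : Continuous A) :
    Continuous (timeMean r A) := by
  have h1 : Continuous (Function.uncurry fun (p : Space d × ℝ) (s : ℝ) => A (p.1, s)) := by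
    unfold Function.uncurry; fun_prop
  have h2 := intervalIntegral.continuous_parametric_intervalIntegral_of_continuous (a₀ := 0)
    (μ := volume) h1 (s := fun p => p.2 + r) (by fun_prop)
  have h3 := intervalIntegral.continuous_parametric_intervalIntegral_of_continuous (a₀ := 0)
    (μ := volume) h1 (s := fun p => p.2) (by fun_prop)
  have h4 : timeMean r A = fun p => r⁻¹ * ((∫ s in (0 : ℝ)..(p.2 + r), A (p.1, s))
      - ∫ s in (0 : ℝ)..p.2, A (p.1, s)) := by
    funext p
    have hi : ∀ a b, IntervalIntegrable (fun s => A (p.1, s)) volume a b := fun a b =>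
      (by fun_prop : Continuous fun s => A (p.1, s)).intervalIntegrable _ _
    rw [timeMean, intervalIntegral.integral_interval_sub_left (hi _ _) (hi _ _)]
  rw [h4]
  exact continuous_const.mul (h2.sub h3)

theorem hasDerivAt_timeMean (r : ℝ) {A : Space d × ℝ → ℝ} (hA : Continuous A) (x : Space d)
    (t : ℝ) : HasDerivAt (fun s => timeMean r A (x, s)) (r⁻¹ * (A (x, t + r) - A (x, t))) t := by
  have hc : Continuous fun s => A (x, s) := by fun_prop
  have h1 : ∀ s, HasDerivAt (fun s => ∫ τ in (0 : ℝ)..s, A (x, τ)) (A (x, s)) s := fun s =>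
    intervalIntegral.integral_hasDerivAt_right (hc.intervalIntegrable _ _)
      hc.stronglyMeasurable.stronglyMeasurableAtFilter hc.continuousAt
  have h2 : HasDerivAt (fun s => ∫ τ in (0 : ℝ)..(s + r), A (x, τ)) (A (x, t + r)) t :=
    HasDerivAt.comp_add_const t r (h1 (t + r))
  refine ((h2.fun_sub (h1 t)).const_mul r⁻¹).congr_of_eventuallyEq (Eventually.of_forall fun s => ?_)
  simp only [timeMean]
  rw [intervalIntegral.integral_interval_sub_left (hc.intervalIntegrable _ _)
    (hc.intervalIntegrable _ _)]

theorem timeMean_eq {r : ℝ} (A : Space d × ℝ → ℝ) (p : Space d × ℝ) :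
    timeMean r A p = r⁻¹ * ∫ θ in (0 : ℝ)..r, A (p.1, p.2 + θ) := by
  rw [timeMean, intervalIntegral.integral_comp_add_left (fun s => A (p.1, s)), add_zero]

theorem timeMean_nonneg {r : ℝ} (hr : 0 < r) {A : Space d × ℝ → ℝ} (h : ∀ p, 0 ≤ A p)
    (p : Space d × ℝ) : 0 ≤ timeMean r A p := by
  rw [timeMean_eq]
  exact mul_nonneg (inv_nonneg.2 hr.le) (intervalIntegral.integral_nonneg hr.le fun θ _ => h _)

theorem timeMean_le {r Λ : ℝ} (hr : 0 < r) {A : Space d × ℝ → ℝ} (hA : Continuous A)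
    (h : ∀ p, A p ≤ Λ) (p : Space d × ℝ) : timeMean r A p ≤ Λ := by
  rw [timeMean_eq, inv_mul_le_iff₀ hr]
  have h1 : Continuous fun θ => A (p.1, p.2 + θ) := by fun_prop
  have := intervalIntegral.integral_mono_on hr.le (h1.intervalIntegrable 0 r)
    (intervalIntegrable_const (c := Λ) (μ := volume)) fun θ _ => h (p.1, p.2 + θ)
  simpa using this

/-- The mean square oscillation of `A` on `[t, t + r]` relative to the right end point. -/
noncomputable def meanOscSq (r : ℝ) (A : Space d × ℝ → ℝ) (p : Space d × ℝ) : ℝ :=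
  r⁻¹ * ∫ θ in (0 : ℝ)..r, (A (p.1, p.2 + θ) - A (p.1, p.2 + r)) ^ 2

theorem continuous_meanOscSq (r : ℝ) {A : Space d × ℝ → ℝ} (hA : Continuous A) :
    Continuous (meanOscSq r A) := by
  refine continuous_const.mul ?_
  refine intervalIntegral.continuous_parametric_intervalIntegral_of_continuous' (μ := volume) ?_ 0 r
  unfold Function.uncurry
  fun_prop

theorem abs_mul_le_young {y k m : ℝ} (hm : 0 < m) : |y| * k ≤ m * y ^ 2 + k ^ 2 / (4 * m) := by
  have h4 : k ^ 2 / (4 * m) = m * (k / (2 * m)) ^ 2 := by field_simp; norm_num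
  have h5 : |y| * k = m * (2 * |y| * (k / (2 * m))) := by field_simp
  rw [h4, h5, ← sq_abs y]
  nlinarith [mul_nonneg hm.le (sq_nonneg (|y| - k / (2 * m)))]

/-- Young's inequality for the deviation from the time mean. -/
theorem abs_timeMean_sub_mul_le {r : ℝ} (hr : 0 < r) {A : Space d × ℝ → ℝ} (hA : Continuous A)
    (p : Space d × ℝ) {k m : ℝ} (hm : 0 < m) (hk : 0 ≤ k) :
    |timeMean r A p - A (p.1, p.2 + r)| * k ≤ m * meanOscSq r A p + k ^ 2 / (4 * m) := by
  have h1 : Continuous fun θ => A (p.1, p.2 + θ) - A (p.1, p.2 + r) := by fun_prop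
  have e1 : timeMean r A p - A (p.1, p.2 + r)
      = r⁻¹ * ∫ θ in (0 : ℝ)..r, (A (p.1, p.2 + θ) - A (p.1, p.2 + r)) := by
    rw [timeMean_eq, intervalIntegral.integral_sub
      ((by fun_prop : Continuous fun θ => A (p.1, p.2 + θ)).intervalIntegrable _ _)
      intervalIntegrable_const]
    simp only [intervalIntegral.integral_const, smul_eq_mul, sub_zero]
    field_simp
  have h2 : |∫ θ in (0 : ℝ)..r, (A (p.1, p.2 + θ) - A (p.1, p.2 + r))|
      ≤ ∫ θ in (0 : ℝ)..r, |A (p.1, p.2 + θ) - A (p.1, p.2 + r)| :=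
    intervalIntegral.abs_integral_le_integral_abs hr.le
  have h3 : (∫ θ in (0 : ℝ)..r, |A (p.1, p.2 + θ) - A (p.1, p.2 + r)|) * k
      ≤ ∫ θ in (0 : ℝ)..r, (m * (A (p.1, p.2 + θ) - A (p.1, p.2 + r)) ^ 2 + k ^ 2 / (4 * m)) := by
    rw [← intervalIntegral.integral_mul_const]
    refine intervalIntegral.integral_mono_on hr.le ((h1.abs.mul_const k).intervalIntegrable _ _)
      (((h1.pow 2).const_mul m).add continuous_const |>.intervalIntegrable _ _) fun θ _ => ?_
    exact abs_mul_le_young hm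
  rw [intervalIntegral.integral_add ((by fun_prop : Continuous fun θ =>
      m * (A (p.1, p.2 + θ) - A (p.1, p.2 + r)) ^ 2).intervalIntegrable _ _)
    intervalIntegrable_const, intervalIntegral.integral_const_mul] at h3
  simp only [intervalIntegral.integral_const, smul_eq_mul, sub_zero] at h3
  rw [e1, abs_mul, abs_of_pos (inv_pos.2 hr), meanOscSq, mul_assoc, inv_mul_le_iff₀ hr]
  have h6 := mul_le_mul_of_nonneg_right h2 hk
  have h7 : r * (m * (r⁻¹ * ∫ θ in (0 : ℝ)..r, (A (p.1, p.2 + θ) - A (p.1, p.2 + r)) ^ 2)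
      + k ^ 2 / (4 * m)) = m * (∫ θ in (0 : ℝ)..r, (A (p.1, p.2 + θ) - A (p.1, p.2 + r)) ^ 2)
      + r * (k ^ 2 / (4 * m)) := by
    field_simp
  rw [h7]
  linarith

/-! ### Time regularity of the weight -/

/-- The squared `L²` norm of the time increment of `A` over the slab. -/
noncomputable def timeOsc (a b : ℝ) (A : Space d × ℝ → ℝ) (r : ℝ) : ℝ :=
  ∫ p, (A (p.1, p.2 + r) - A p) ^ 2 ∂slab d a b

namespace WeightedFlow

variable {t₁ T C Λ c r : ℝ} {U V A : Space d × ℝ → ℝ}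

theorem abs_weighted_sub_le (h : WeightedFlow t₁ C Λ c U V A) (p q : Space d × ℝ) :
    |A p * V p - A q * V q| ≤ 2 * (Λ * C) := by
  have key : ∀ p, |A p * V p| ≤ Λ * C := fun p => by
    rw [abs_mul, abs_of_nonneg (h.A_nonneg p)]
    exact mul_le_mul (h.A_le p) (h.abs_V_le p) (abs_nonneg _) h.Λ_nonneg
  have := abs_sub (A p * V p) (A q * V q)
  linarith [key p, key q]

theorem abs_A_sub_le (h : WeightedFlow t₁ C Λ c U V A) (p q : Space d × ℝ) : |A p - A q| ≤ Λ :=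
  abs_le.2 ⟨by linarith [h.A_nonneg p, h.A_le q], by linarith [h.A_nonneg q, h.A_le p]⟩

/-- Strong accretivity against the Lipschitz bound on `U`. The result is only linear in `|s - t|`;
it serves on time strips of length `r`, where it contributes `r²`. -/
theorem slice_osc_le (h : WeightedFlow t₁ C Λ c U V A) (s t : ℝ) :
    ∫ x in cube d, (A (x, s) - A (x, t)) ^ 2 ≤ 2 * Λ * C ^ 2 * |s - t| / c := by
  have h1 := h.strong s t
  have h2 : |∫ x in cube d, (A (x, s) * V (x, s) - A (x, t) * V (x, t)) * (U (x, s) - U (x, t))|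
      ≤ 2 * (Λ * C) * (C * |s - t|) := by
    have := norm_integral_le_of_norm_le_const (μ := volume.restrict (cube d))
      (C := 2 * (Λ * C) * (C * |s - t|))
      (f := fun x => (A (x, s) * V (x, s) - A (x, t) * V (x, t)) * (U (x, s) - U (x, t)))
      (Eventually.of_forall fun x => by
        rw [norm_mul]
        exact mul_le_mul (h.abs_weighted_sub_le _ _) (h.lipschitz x t s) (norm_nonneg _)
          (by have := h.C_nonneg; have := h.Λ_nonneg; positivity))
    simpa using this
  rw [le_div_iff₀ h.c_pos]
  have := (abs_le.1 h2).1
  nlinarith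

/-- The shifted time window leaves `[t₁, T]` only in a strip of length `θ ≤ r` beyond `T`, where
`slice_osc_le` applies. -/
theorem integral_shift_le (h : WeightedFlow t₁ C Λ c U V A) (hT : t₁ ≤ T) {θ : ℝ} (hθ : 0 ≤ θ)
    (hθr : θ ≤ r) :
    ∫ p, (A (p.1, p.2 + θ) - A (p.1, p.2 + r)) ^ 2 ∂slab d t₁ T
      ≤ timeOsc t₁ T A (r - θ) + 2 * Λ * C ^ 2 * r ^ 2 / c := by
  have hA := h.continuous_A
  set n : ℝ → ℝ := fun t => ∫ x in cube d, (A (x, t + (r - θ)) - A (x, t)) ^ 2 with hn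
  have hcont : Continuous fun p : Space d × ℝ => (A (p.1, p.2 + (r - θ)) - A p) ^ 2 := by fun_prop
  have hint : ∀ a b, IntervalIntegrable n volume a b := fun a b =>
    ⟨integrableOn_slice_integral hcont a b, integrableOn_slice_integral hcont b a⟩
  have hn0 : ∀ t, 0 ≤ n t := fun t => integral_nonneg fun x => sq_nonneg _
  have hnle : ∀ t, n t ≤ 2 * Λ * C ^ 2 * r / c := fun t => by
    refine (h.slice_osc_le _ _).trans ?_
    have : |t + (r - θ) - t| ≤ r := by
      rw [add_sub_cancel_left, abs_of_nonneg (by linarith)]; linarith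
    have h1 := h.c_pos; have h2 := h.Λ_nonneg
    gcongr
  have e1 : ∫ p, (A (p.1, p.2 + θ) - A (p.1, p.2 + r)) ^ 2 ∂slab d t₁ T
      = ∫ t in t₁..T, n (t + θ) := by
    rw [integral_slab (by fun_prop), intervalIntegral.integral_of_le hT]
    refine integral_congr_ae (Eventually.of_forall fun t => ?_)
    simp only [hn]
    refine integral_congr_ae (Eventually.of_forall fun x => ?_)
    simp only
    rw [show t + θ + (r - θ) = t + r by ring]
    ring
  have e2 : timeOsc t₁ T A (r - θ) = ∫ t in t₁..T, n t := by
    rw [timeOsc, integral_slab hcont, intervalIntegral.integral_of_le hT]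
  rw [e1, e2, intervalIntegral.integral_comp_add_right]
  have h1 := intervalIntegral.integral_add_adjacent_intervals (hint t₁ (t₁ + θ))
    (hint (t₁ + θ) (T + θ))
  have h2 := intervalIntegral.integral_add_adjacent_intervals (hint t₁ T) (hint T (T + θ))
  have h3 : 0 ≤ ∫ t in t₁..(t₁ + θ), n t :=
    intervalIntegral.integral_nonneg (by linarith) fun t _ => hn0 t
  have h4 : ∫ t in T..(T + θ), n t ≤ 2 * Λ * C ^ 2 * r ^ 2 / c := by
    have := intervalIntegral.integral_mono_on (by linarith : T ≤ T + θ) (hint T (T + θ))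
      (intervalIntegrable_const (c := 2 * Λ * C ^ 2 * r / c) (μ := volume)) fun t _ => hnle t
    rw [intervalIntegral.integral_const, add_sub_cancel_left, smul_eq_mul] at this
    refine this.trans ?_
    have h5 : 0 ≤ 2 * Λ * C ^ 2 * r / c := (hn0 0).trans (hnle 0)
    calc θ * (2 * Λ * C ^ 2 * r / c) ≤ r * (2 * Λ * C ^ 2 * r / c) := by gcongr
      _ = _ := by ring
  linarith

theorem integral_meanOscSq_le (h : WeightedFlow t₁ C Λ c U V A) (hT : t₁ ≤ T) (hr : 0 < r) {S : ℝ}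
    (hS : ∀ ρ ∈ Icc 0 r, timeOsc t₁ T A ρ ≤ S) :
    ∫ p, meanOscSq r A p ∂slab d t₁ T ≤ S + 2 * Λ * C ^ 2 * r ^ 2 / c := by
  have hA := h.continuous_A
  unfold meanOscSq
  rw [integral_const_mul, inv_mul_le_iff₀ hr]
  simp_rw [intervalIntegral.integral_of_le hr.le]
  have hint : Integrable (Function.uncurry fun (p : Space d × ℝ) (θ : ℝ) =>
      (A (p.1, p.2 + θ) - A (p.1, p.2 + r)) ^ 2)
      ((slab d t₁ T).prod (volume.restrict (Ioc 0 r))) := by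
    refine Integrable.of_bound (C := Λ ^ 2) ?_ (Eventually.of_forall fun q => ?_)
    · refine Continuous.aestronglyMeasurable ?_
      unfold Function.uncurry; fun_prop
    · simp only [Function.uncurry, norm_pow, Real.norm_eq_abs]
      have := h.abs_A_sub_le (q.1.1, q.1.2 + q.2) (q.1.1, q.1.2 + r)
      gcongr
  rw [integral_integral_swap hint]
  have := setIntegral_mono_on (μ := volume) (s := Ioc 0 r) hint.integral_prod_right
    (integrableOn_const (C := S + 2 * Λ * C ^ 2 * r ^ 2 / c) (by simp)) measurableSet_Ioc
    (fun θ hθ => (h.integral_shift_le hT hθ.1.le hθ.2).trans (add_le_add_left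
      (hS (r - θ) ⟨by linarith [hθ.2], by linarith [hθ.1]⟩) _))
  refine this.trans (le_of_eq ?_)
  simp [hr.le]

theorem hasDerivAt_increment (h : WeightedFlow t₁ C Λ c U V A) (hr : 0 < r) (x : Space d) {t : ℝ}
    (ht : t₁ < t) :
    HasDerivAt (fun s => U (x, s + r) - U (x, s)) (V (x, t + r) - V (x, t)) t :=
  (HasDerivAt.comp_add_const t r (h.hasDerivAt x (t + r) (by linarith))).fun_sub (h.hasDerivAt x t ht)

/-- The energy is `∫ b D² / 2`, where `D` is the increment of `U` over time `r` and `b` the time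
mean of `A`. Unlike `A`, this mean is differentiable in time, with derivative the increment of `A`
divided by `r`. The derivative of the energy is an accretive term, controlled by `-c` times the
oscillation of `A`, plus errors linear in oscillations of `A` with coefficients of order `r`;
Young's inequality absorbs these. -/
theorem energy_estimate (h : WeightedFlow t₁ C Λ c U V A) (hT : t₁ ≤ T) (hr : 0 < r) :
    c * timeOsc t₁ T A r ≤ Λ * C ^ 2 * r ^ 2 / 2
      + (c / 4 * timeOsc t₁ T A r + c / 4 * ∫ p, meanOscSq r A p ∂slab d t₁ T
        + 2 * ((2 * C ^ 2 * r) ^ 2 / c) * (T - t₁)) := by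
  have hA := h.continuous_A
  have hU := h.continuous_U
  have hV := h.continuous_V
  have hb := continuous_timeMean r hA
  have hc := h.c_pos
  have hC := h.C_nonneg
  have hmo := continuous_meanOscSq r hA
  set b := timeMean r A with hbdef
  set D : Space d × ℝ → ℝ := fun p => U (p.1, p.2 + r) - U p with hD
  set Δ : Space d × ℝ → ℝ := fun p => A (p.1, p.2 + r) - A p with hΔ
  set W : Space d × ℝ → ℝ := fun p => V (p.1, p.2 + r) - V p with hW
  set G : Space d × ℝ → ℝ := fun p =>
    (A (p.1, p.2 + r) * V (p.1, p.2 + r) - A p * V p) * D p with hG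
  set E : Space d × ℝ → ℝ := fun p => Δ p * (r⁻¹ * D p ^ 2 / 2)
    + (b p - A (p.1, p.2 + r)) * (W p * D p) - Δ p * (V p * D p) with hE
  have hDc : Continuous D := by fun_prop
  have hΔc : Continuous Δ := by fun_prop
  have hWc : Continuous W := by fun_prop
  have hGc : Continuous G := by fun_prop
  have hEc : Continuous E := by fun_prop
  have hDle : ∀ p, |D p| ≤ C * r := fun p => by
    have := h.lipschitz p.1 p.2 (p.2 + r)
    rwa [add_sub_cancel_left, abs_of_pos hr] at this
  -- Writing `b W D = A(t + r) W D + (b - A(t + r)) W D` and completing the first term to the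
  -- increment of `A V` isolates `G`; everything else is `E`.
  have hFTC := integral_slab_deriv (P := fun p => b p * (D p ^ 2 / 2)) (P' := fun p => G p + E p)
    (by fun_prop) (by fun_prop) hT (fun x t ht => by
      have h1 := hasDerivAt_timeMean r hA x t
      have h2 := (((h.hasDerivAt_increment hr x ht.1).fun_pow 2).div_const 2)
      refine (h1.fun_mul h2).congr_deriv ?_
      simp only [hG, hE, hD, hΔ, hW, hbdef]
      push_cast
      ring)
  rw [integral_add (integrable_slab hGc _ _) (integrable_slab hEc _ _)] at hFTC
  have hGle : ∫ p, G p ∂slab d t₁ T ≤ - (c * timeOsc t₁ T A r) := by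
    have hosc : Continuous fun p : Space d × ℝ => (A (p.1, p.2 + r) - A p) ^ 2 := by fun_prop
    rw [timeOsc, integral_slab hGc, integral_slab hosc, ← integral_const_mul, ← integral_neg]
    refine setIntegral_mono_on (integrableOn_slice_integral hGc _ _)
      ((integrableOn_slice_integral hosc _ _).const_mul c).neg measurableSet_Ioc fun t _ => ?_
    exact h.strong (t + r) t
  have hEle : ∫ p, E p ∂slab d t₁ T ≤ c / 4 * timeOsc t₁ T A r
      + c / 4 * ∫ p, meanOscSq r A p ∂slab d t₁ T
        + 2 * ((2 * C ^ 2 * r) ^ 2 / c) * (T - t₁) := by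
    have hpt : ∀ p, E p ≤ c / 4 * Δ p ^ 2 + c / 4 * meanOscSq r A p
        + 2 * ((2 * C ^ 2 * r) ^ 2 / c) := fun p => by
      have y1 := abs_mul_le_young (y := Δ p) (k := 2 * C ^ 2 * r) (m := c / 4) (by positivity)
      have y2 := abs_timeMean_sub_mul_le hr hA p (k := 2 * C ^ 2 * r) (m := c / 4) (by positivity)
        (by positivity)
      rw [show 4 * (c / 4) = c by ring] at y1 y2
      have hVle := h.abs_V_le p
      have hWle : |W p| ≤ 2 * C := by
        have := abs_sub (V (p.1, p.2 + r)) (V p)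
        linarith [h.abs_V_le (p.1, p.2 + r)]
      have hD2 : r⁻¹ * D p ^ 2 / 2 ≤ C ^ 2 * r / 2 := by
        have : D p ^ 2 ≤ (C * r) ^ 2 := by rw [← sq_abs]; gcongr; exact hDle p
        calc r⁻¹ * D p ^ 2 / 2 ≤ r⁻¹ * (C * r) ^ 2 / 2 := by gcongr
          _ = _ := by field_simp
      have hVD : |V p * D p| ≤ C ^ 2 * r := by
        rw [abs_mul]
        calc |V p| * |D p| ≤ C * (C * r) := by gcongr; exact hDle p
          _ = _ := by ring
      have hWD : |W p * D p| ≤ 2 * C ^ 2 * r := by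
        rw [abs_mul]
        calc |W p| * |D p| ≤ 2 * C * (C * r) := by gcongr; exact hDle p
          _ = _ := by ring
      have z1 : Δ p * (r⁻¹ * D p ^ 2 / 2) ≤ |Δ p| * (C ^ 2 * r / 2) :=
        (mul_le_mul_of_nonneg_right (le_abs_self _) (by positivity)).trans
          (mul_le_mul_of_nonneg_left hD2 (abs_nonneg _))
      have z2 : -(Δ p * (V p * D p)) ≤ |Δ p| * (C ^ 2 * r) := by
        refine (neg_le_abs _).trans ?_
        rw [abs_mul]
        exact mul_le_mul_of_nonneg_left hVD (abs_nonneg _)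
      have z3 : (b p - A (p.1, p.2 + r)) * (W p * D p)
          ≤ |b p - A (p.1, p.2 + r)| * (2 * C ^ 2 * r) := by
        refine (le_abs_self _).trans ?_
        rw [abs_mul]
        exact mul_le_mul_of_nonneg_left hWD (abs_nonneg _)
      have z4 : 0 ≤ |Δ p| * (C ^ 2 * r / 2) := by positivity
      have z5 : |Δ p| * (2 * C ^ 2 * r)
          = |Δ p| * (C ^ 2 * r / 2) + |Δ p| * (C ^ 2 * r) + |Δ p| * (C ^ 2 * r / 2) := by ring
      simp only [hE]
      linarith
    have hi1 : Integrable (fun p => c / 4 * Δ p ^ 2) (slab d t₁ T) :=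
      integrable_slab (by fun_prop) _ _
    have hi2 : Integrable (fun p => c / 4 * meanOscSq r A p) (slab d t₁ T) :=
      integrable_slab (by fun_prop) _ _
    have := integral_mono (integrable_slab hEc t₁ T)
      (integrable_slab (by fun_prop : Continuous fun p => c / 4 * Δ p ^ 2 + c / 4 * meanOscSq r A p
        + 2 * ((2 * C ^ 2 * r) ^ 2 / c)) t₁ T) hpt
    refine this.trans (le_of_eq ?_)
    have hi3 : Integrable (fun p => c / 4 * Δ p ^ 2 + c / 4 * meanOscSq r A p) (slab d t₁ T) :=
      hi1.add hi2
    rw [integral_add hi3 (integrable_const _), integral_add hi1 hi2, integral_const_mul,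
      integral_const_mul, integral_const, slab_real_univ hT, smul_eq_mul, timeOsc]
    ring
  have hPT : 0 ≤ ∫ x in cube d, b (x, T) * (D (x, T) ^ 2 / 2) :=
    integral_nonneg fun x => mul_nonneg (timeMean_nonneg hr h.A_nonneg _) (by positivity)
  have hP0 : ∫ x in cube d, b (x, t₁) * (D (x, t₁) ^ 2 / 2) ≤ Λ * C ^ 2 * r ^ 2 / 2 := by
    have hc1 : Continuous fun x => b (x, t₁) * (D (x, t₁) ^ 2 / 2) := by fun_prop
    have := integral_mono (μ := volume.restrict (cube d)) hc1.integrableOn_cube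
      (integrable_const (Λ * C ^ 2 * r ^ 2 / 2)) (fun x => by
        have h1 := timeMean_le hr hA h.A_le (x, t₁)
        have h2 : D (x, t₁) ^ 2 ≤ (C * r) ^ 2 := by rw [← sq_abs]; gcongr; exact hDle _
        have h3 := h.Λ_nonneg
        calc b (x, t₁) * (D (x, t₁) ^ 2 / 2) ≤ Λ * ((C * r) ^ 2 / 2) := by gcongr
          _ = _ := by ring)
    simpa using this
  linarith

/-- The weight has a square integrable time derivative, in the sense of difference quotients. -/
theorem timeOsc_le (h : WeightedFlow t₁ C Λ c U V A) (hT : t₁ ≤ T) (hr : 0 ≤ r) :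
    timeOsc t₁ T A r ≤ 2 * (Λ * C ^ 2 + 8 * C ^ 4 * (T - t₁) / c) / c * r ^ 2 := by
  have hc := h.c_pos
  -- Finiteness of the supremum, from the crude bound on `A`, is what permits absorbing it below.
  have hbdd : BddAbove (timeOsc t₁ T A '' Icc 0 r) := by
    refine ⟨Λ ^ 2 * (T - t₁), ?_⟩
    rintro _ ⟨ρ, -, rfl⟩
    have := norm_integral_le_of_norm_le_const (μ := slab d t₁ T) (C := Λ ^ 2)
      (f := fun p : Space d × ℝ => (A (p.1, p.2 + ρ) - A p) ^ 2) (Eventually.of_forall fun p => by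
        rw [norm_pow, Real.norm_eq_abs]
        have := h.abs_A_sub_le (p.1, p.2 + ρ) p
        gcongr)
    rw [slab_real_univ hT] at this
    exact (le_abs_self _).trans this
  set S := sSup (timeOsc t₁ T A '' Icc 0 r) with hS
  have hSle : ∀ ρ ∈ Icc 0 r, timeOsc t₁ T A ρ ≤ S := fun ρ hρ =>
    le_csSup hbdd (mem_image_of_mem _ hρ)
  set k : ℝ := Λ * C ^ 2 + 8 * C ^ 4 * (T - t₁) / c with hk
  have hk0 : 0 ≤ k := by
    have := h.Λ_nonneg; have := h.C_nonneg; have := sub_nonneg.2 hT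
    positivity
  have hS0 : 0 ≤ S := by
    refine le_trans ?_ (hSle 0 ⟨le_rfl, hr⟩)
    exact integral_nonneg fun p => sq_nonneg _
  -- The mean oscillation at scale `ρ` involves all smaller scales, so the estimate is taken for the
  -- supremum over scales. It reappears with factor `1/3` and is absorbed.
  have hmain : S ≤ (4 / 3) * (k * r ^ 2 / c + S / 4) := by
    refine csSup_le ((nonempty_Icc.2 hr).image _) ?_
    rintro _ ⟨ρ, hρ, rfl⟩
    rcases hρ.1.eq_or_lt with h0 | hρ0
    · rw [← h0]
      have : timeOsc t₁ T A 0 = 0 := by simp [timeOsc]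
      rw [this]; positivity
    · have h1 := h.energy_estimate hT hρ0
      have h2 := h.integral_meanOscSq_le hT hρ0 (S := S) fun ρ' hρ' =>
        hSle ρ' ⟨hρ'.1, hρ'.2.trans hρ.2⟩
      have h3 : k * ρ ^ 2 ≤ k * r ^ 2 := by gcongr; exact hρ.2
      have h4 : c / 4 * ∫ p, meanOscSq ρ A p ∂slab d t₁ T
          ≤ c / 4 * (S + 2 * Λ * C ^ 2 * ρ ^ 2 / c) := by gcongr
      have h5 : Λ * C ^ 2 * ρ ^ 2 / 2 + c / 4 * (2 * Λ * C ^ 2 * ρ ^ 2 / c)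
          + 2 * ((2 * C ^ 2 * ρ) ^ 2 / c) * (T - t₁) = k * ρ ^ 2 := by
        rw [hk]; field_simp; ring
      have h6 : 3 / 4 * (c * timeOsc t₁ T A ρ) ≤ k * r ^ 2 + c * (S / 4) := by linarith
      have h7 : c * timeOsc t₁ T A ρ ≤ c * ((4 / 3) * (k * r ^ 2 / c + S / 4)) := by
        have : c * ((4 / 3) * (k * r ^ 2 / c + S / 4)) = 4 / 3 * (k * r ^ 2 + c * (S / 4)) := by
          field_simp
        rw [this]; linarith
      exact le_of_mul_le_mul_left h7 hc
  refine (hSle r ⟨hr, le_rfl⟩).trans ?_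
  have : 2 * k / c * r ^ 2 = 2 * (k * r ^ 2 / c) := by ring
  rw [this]
  linarith

end WeightedFlow

/-! ### Smooth approximation of the absolute value -/

/-- `√(λ² + q²) - λ`. -/
noncomputable def smoothAbs (l q : ℝ) : ℝ := √(l ^ 2 + q ^ 2) - l

/-- The derivative of `smoothAbs`. -/
noncomputable def smoothSign (l q : ℝ) : ℝ := q / √(l ^ 2 + q ^ 2)

section

variable {l : ℝ}

theorem sqrt_add_sq_pos (hl : 0 < l) (q : ℝ) : 0 < √(l ^ 2 + q ^ 2) :=
  Real.sqrt_pos.2 (by positivity)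

theorem hasDerivAt_smoothAbs (hl : 0 < l) (q : ℝ) :
    HasDerivAt (smoothAbs l) (smoothSign l q) q := by
  have h1 : HasDerivAt (fun q : ℝ => l ^ 2 + q ^ 2) (2 * q) q := by
    simpa using (hasDerivAt_pow 2 q).const_add (l ^ 2)
  refine ((h1.sqrt (by positivity)).sub_const l).congr_deriv ?_
  rw [smoothSign, mul_div_mul_left _ _ two_ne_zero]

theorem contDiff_smoothSign (hl : 0 < l) : ContDiff ℝ 1 (smoothSign l) := by
  unfold smoothSign
  exact contDiff_id.div ((contDiff_const.add (contDiff_id.pow 2)).sqrt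
    fun x => by simp only [id]; positivity) fun x => (sqrt_add_sq_pos hl x).ne'

theorem continuous_smoothAbs (l : ℝ) : Continuous (smoothAbs l) := by
  unfold smoothAbs; fun_prop

theorem smoothSign_zero (l : ℝ) : smoothSign l 0 = 0 := by simp [smoothSign]

theorem smoothSign_mono (hl : 0 < l) : Monotone (smoothSign l) := by
  refine monotone_of_deriv_nonneg ((contDiff_smoothSign hl).differentiable one_ne_zero) fun q => ?_
  have h1 : HasDerivAt (fun q : ℝ => l ^ 2 + q ^ 2) (2 * q) q := by
    simpa using (hasDerivAt_pow 2 q).const_add (l ^ 2)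
  have h2 := h1.sqrt (by positivity)
  have h0 := sqrt_add_sq_pos hl q
  have h3 : HasDerivAt (smoothSign l) _ q := (hasDerivAt_id' q).div h2 h0.ne'
  rw [h3.deriv]
  refine div_nonneg ?_ (sq_nonneg _)
  have hs : √(l ^ 2 + q ^ 2) ^ 2 = l ^ 2 + q ^ 2 := Real.sq_sqrt (by positivity)
  rw [one_mul, mul_div_mul_left _ _ two_ne_zero, sub_nonneg, ← mul_div_assoc, div_le_iff₀ h0]
  nlinarith [sq_nonneg l]

theorem abs_smoothSign_le (hl : 0 < l) (q : ℝ) : |smoothSign l q| ≤ 1 := by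
  rw [smoothSign, abs_div, abs_of_pos (sqrt_add_sq_pos hl q), div_le_one (sqrt_add_sq_pos hl q)]
  exact Real.abs_le_sqrt (by nlinarith [sq_nonneg l])

theorem abs_sub_le_smoothAbs (l q : ℝ) : |q| - l ≤ smoothAbs l q := by
  unfold smoothAbs
  linarith [Real.abs_le_sqrt (by nlinarith [sq_nonneg l] : q ^ 2 ≤ l ^ 2 + q ^ 2)]

theorem smoothAbs_le_abs (hl : 0 < l) (q : ℝ) : smoothAbs l q ≤ |q| := by
  unfold smoothAbs
  have : √(l ^ 2 + q ^ 2) ≤ l + |q| :=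
    Real.sqrt_le_iff.2 ⟨by positivity, by nlinarith [sq_abs q, abs_nonneg q]⟩
  linarith

theorem smoothAbs_nonneg (l q : ℝ) : 0 ≤ smoothAbs l q := by
  unfold smoothAbs
  linarith [Real.le_sqrt_of_sq_le (by nlinarith [sq_nonneg q] : l ^ 2 ≤ l ^ 2 + q ^ 2)]

/-- For the exact absolute value the difference is `sign q · (q - v)`; the smoothing adds at most
`l`. -/
theorem abs_smoothAbs_sub_le (hl : 0 < l) (q v : ℝ) :
    |smoothAbs l q - smoothSign l q * v| ≤ l + |q - v| := by
  have h0 := sqrt_add_sq_pos hl q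
  have hs : √(l ^ 2 + q ^ 2) ^ 2 = l ^ 2 + q ^ 2 := Real.sq_sqrt (by positivity)
  have hls : l ≤ √(l ^ 2 + q ^ 2) := Real.le_sqrt_of_sq_le (by nlinarith [sq_nonneg q])
  have e1 : smoothAbs l q - smoothSign l q * q = l ^ 2 / √(l ^ 2 + q ^ 2) - l := by
    rw [smoothAbs, smoothSign]
    field_simp
    linarith
  have h1 : |smoothAbs l q - smoothSign l q * q| ≤ l := by
    rw [e1]
    have a1 : 0 ≤ l ^ 2 / √(l ^ 2 + q ^ 2) := by positivity
    have a2 : l ^ 2 / √(l ^ 2 + q ^ 2) ≤ l := by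
      rw [div_le_iff₀ h0]; nlinarith
    exact abs_le.2 ⟨by linarith, by linarith⟩
  have h2 : |smoothSign l q * (q - v)| ≤ |q - v| := by
    rw [abs_mul]
    exact mul_le_of_le_one_left (abs_nonneg _) (abs_smoothSign_le hl q)
  calc |smoothAbs l q - smoothSign l q * v|
      = |(smoothAbs l q - smoothSign l q * q) + smoothSign l q * (q - v)| := by congr 1; ring
    _ ≤ _ := (abs_add_le _ _).trans (add_le_add h1 h2)

end

/-! ### Almost monotonicity of the weighted `L¹` norm of the velocity -/

/-- The error in `integral_smoothAbs_le`: the deviation of the difference quotients. -/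
noncomputable def quotientError (s : ℝ) (U V : Space d × ℝ → ℝ) (p : Space d × ℝ) : ℝ :=
  (s⁻¹ * (U (p.1, p.2 + s) - U p) - V p) ^ 2 + (V (p.1, p.2 + s) - V p) ^ 2

namespace WeightedFlow

variable {t₁ T C Λ c s l : ℝ} {U V A : Space d × ℝ → ℝ}

/-- Almost monotonicity of the discrete version of `∫ A |V|`. The main term has a sign by
accretivity. In the errors, one Young inequality with weight `l` leaves `l` times a constant, by
`timeOsc_le`, and `1 / l` times an error that vanishes as `s → 0`; hence `s` must go to zero before
`l`. -/
theorem integral_smoothAbs_le (h : WeightedFlow t₁ C Λ c U V A) (hT : t₁ ≤ T) (hs : 0 < s)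
    (hl : 0 < l) :
    ∫ x in cube d, timeMean s A (x, T) * smoothAbs l (s⁻¹ * (U (x, T + s) - U (x, T)))
      ≤ (∫ x in cube d, timeMean s A (x, t₁) * smoothAbs l (s⁻¹ * (U (x, t₁ + s) - U (x, t₁))))
        + l * (4 * (Λ * C ^ 2 + 8 * C ^ 4 * (T - t₁) / c) / c + 2 * Λ * C ^ 2 / c + (T - t₁))
        + 1 / l * ∫ p, quotientError s U V p ∂slab d t₁ T := by
  have hA := h.continuous_A
  have hU := h.continuous_U
  have hV := h.continuous_V
  have hb := continuous_timeMean s hA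
  have hmo := continuous_meanOscSq s hA
  have hsa := continuous_smoothAbs l
  have hss := (contDiff_smoothSign hl).continuous
  set b := timeMean s A with hbdef
  set q : Space d × ℝ → ℝ := fun p => s⁻¹ * (U (p.1, p.2 + s) - U p) with hq
  set Δ : Space d × ℝ → ℝ := fun p => A (p.1, p.2 + s) - A p with hΔ
  set W : Space d × ℝ → ℝ := fun p => V (p.1, p.2 + s) - V p with hW
  set G : Space d × ℝ → ℝ := fun p => s⁻¹ *
    ((A (p.1, p.2 + s) * V (p.1, p.2 + s) - A p * V p) * smoothSign l (q p)) with hG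
  set E : Space d × ℝ → ℝ := fun p => s⁻¹ * (Δ p * (smoothAbs l (q p) - smoothSign l (q p) * V p)
    + (b p - A (p.1, p.2 + s)) * (W p * smoothSign l (q p))) with hE
  have hqc : Continuous q := by fun_prop
  have hΔc : Continuous Δ := by fun_prop
  have hWc : Continuous W := by fun_prop
  have hGc : Continuous G := by fun_prop
  have hEc : Continuous E := by fun_prop
  have hRc : Continuous (quotientError s U V) := by
    unfold quotientError; fun_prop
  have hFTC := integral_slab_deriv (P := fun p => b p * smoothAbs l (q p))
    (P' := fun p => G p + E p) (by fun_prop) (by fun_prop) hT (fun x t ht => by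
      have h1 := hasDerivAt_timeMean s hA x t
      have h2 : HasDerivAt (fun τ => smoothAbs l (q (x, τ))) _ t :=
        HasDerivAt.comp (h₂ := smoothAbs l) (h := fun τ => q (x, τ)) t
          (hasDerivAt_smoothAbs hl (q (x, t))) ((h.hasDerivAt_increment hs x ht.1).const_mul s⁻¹)
      refine (h1.fun_mul h2).congr_deriv ?_
      simp only [hG, hE, hΔ, hW, hbdef]
      ring)
  rw [integral_add (integrable_slab hGc _ _) (integrable_slab hEc _ _)] at hFTC
  have hGle : ∫ p, G p ∂slab d t₁ T ≤ 0 := by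
    rw [integral_slab hGc]
    refine setIntegral_nonpos measurableSet_Ioc fun t _ => ?_
    simp only [hG]
    rw [integral_const_mul]
    refine mul_nonpos_of_nonneg_of_nonpos (inv_nonneg.2 hs.le) ?_
    -- Scaling the argument inside the monotone function expresses the sign of the difference
    -- quotient through the increment of `U`.
    exact h.accretive (t + s) t (fun y => smoothSign l (s⁻¹ * y))
      ((contDiff_smoothSign hl).comp (contDiff_const.mul contDiff_id))
      (fun y z hyz => smoothSign_mono hl (mul_le_mul_of_nonneg_left hyz (inv_nonneg.2 hs.le)))
      (by simp [smoothSign_zero])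
  have hpt : ∀ p, E p ≤ l * (s⁻¹ ^ 2 * Δ p ^ 2) + l * (s⁻¹ ^ 2 * meanOscSq s A p)
      + 1 / l * quotientError s U V p + l := fun p => by
    have y1 := abs_mul_le_young (y := s⁻¹ * Δ p) (k := l + |q p - V p|) hl
    have y2 := abs_timeMean_sub_mul_le hs hA p (k := s⁻¹ * |W p|) (m := l * s⁻¹ ^ 2)
      (by positivity) (by positivity)
    have z1 : s⁻¹ * (Δ p * (smoothAbs l (q p) - smoothSign l (q p) * V p))
        ≤ |s⁻¹ * Δ p| * (l + |q p - V p|) := by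
      rw [← mul_assoc]
      refine (le_abs_self _).trans ?_
      rw [abs_mul]
      exact mul_le_mul_of_nonneg_left (abs_smoothAbs_sub_le hl _ _) (abs_nonneg _)
    have z2 : s⁻¹ * ((b p - A (p.1, p.2 + s)) * (W p * smoothSign l (q p)))
        ≤ |b p - A (p.1, p.2 + s)| * (s⁻¹ * |W p|) := by
      refine (le_abs_self _).trans ?_
      rw [abs_mul, abs_mul, abs_mul, abs_of_pos (inv_pos.2 hs)]
      have := mul_le_of_le_one_right (abs_nonneg (W p)) (abs_smoothSign_le hl (q p))
      calc s⁻¹ * (|b p - A (p.1, p.2 + s)| * (|W p| * |smoothSign l (q p)|))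
          ≤ s⁻¹ * (|b p - A (p.1, p.2 + s)| * |W p|) := by gcongr
        _ = _ := by ring
    have e1 : (s⁻¹ * |W p|) ^ 2 / (4 * (l * s⁻¹ ^ 2)) = 1 / l * (W p ^ 2 / 4) := by
      rw [mul_pow, sq_abs]; field_simp
    have e2 : (l + |q p - V p|) ^ 2 / (4 * l) ≤ l / 2 + 1 / l * ((q p - V p) ^ 2 / 2) := by
      rw [div_le_iff₀ (by positivity), ← sq_abs (q p - V p)]
      field_simp
      nlinarith [sq_nonneg (l - |q p - V p|)]
    have e3 : quotientError s U V p = (q p - V p) ^ 2 + W p ^ 2 := rfl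
    have e4 : 1 / l * ((q p - V p) ^ 2 / 2) + 1 / l * (W p ^ 2 / 4)
        ≤ 1 / l * quotientError s U V p := by
      rw [e3, ← mul_add]
      refine mul_le_mul_of_nonneg_left ?_ (by positivity)
      nlinarith [sq_nonneg (q p - V p), sq_nonneg (W p)]
    rw [mul_pow] at y1
    rw [e1] at y2
    simp only [hE]
    rw [mul_add]
    linarith
  have hosc := h.timeOsc_le hT hs.le
  have hmos := h.integral_meanOscSq_le hT hs
    (S := 2 * (Λ * C ^ 2 + 8 * C ^ 4 * (T - t₁) / c) / c * s ^ 2) fun ρ hρ => by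
      refine (h.timeOsc_le hT hρ.1).trans ?_
      have := h.Λ_nonneg; have := h.C_nonneg; have := sub_nonneg.2 hT; have := h.c_pos
      have := hρ.1
      gcongr
      exact hρ.2
  set k : ℝ := (Λ * C ^ 2 + 8 * C ^ 4 * (T - t₁) / c) with hk
  have hEle : ∫ p, E p ∂slab d t₁ T ≤ l * (4 * k / c + 2 * Λ * C ^ 2 / c + (T - t₁))
        + 1 / l * ∫ p, quotientError s U V p ∂slab d t₁ T := by
    have i1 : Integrable (fun p => l * (s⁻¹ ^ 2 * Δ p ^ 2)) (slab d t₁ T) :=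
      integrable_slab (by fun_prop) _ _
    have i2 : Integrable (fun p => l * (s⁻¹ ^ 2 * meanOscSq s A p)) (slab d t₁ T) :=
      integrable_slab (by fun_prop) _ _
    have i3 : Integrable (fun p => 1 / l * quotientError s U V p) (slab d t₁ T) :=
      integrable_slab (by fun_prop) _ _
    have i12 : Integrable (fun p => l * (s⁻¹ ^ 2 * Δ p ^ 2) + l * (s⁻¹ ^ 2 * meanOscSq s A p))
      (slab d t₁ T) := i1.add i2
    have i123 : Integrable (fun p => l * (s⁻¹ ^ 2 * Δ p ^ 2) + l * (s⁻¹ ^ 2 * meanOscSq s A p)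
      + 1 / l * quotientError s U V p) (slab d t₁ T) := i12.add i3
    have hint := integral_mono (integrable_slab hEc t₁ T) (i123.add (integrable_const l)) hpt
    refine hint.trans ?_
    simp only [Pi.add_apply]
    rw [integral_add i123 (integrable_const l), integral_add i12 i3, integral_add i1 i2,
      integral_const_mul, integral_const_mul, integral_const_mul, integral_const_mul,
      integral_const_mul, integral_const, slab_real_univ hT, smul_eq_mul]
    have o1 : s⁻¹ ^ 2 * ∫ p, Δ p ^ 2 ∂slab d t₁ T ≤ 2 * k / c := by
      calc s⁻¹ ^ 2 * ∫ p, Δ p ^ 2 ∂slab d t₁ T ≤ s⁻¹ ^ 2 * (2 * k / c * s ^ 2) := by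
            gcongr; exact hosc
        _ = _ := by field_simp
    have o2 : s⁻¹ ^ 2 * ∫ p, meanOscSq s A p ∂slab d t₁ T ≤ 2 * k / c + 2 * Λ * C ^ 2 / c := by
      calc s⁻¹ ^ 2 * ∫ p, meanOscSq s A p ∂slab d t₁ T
          ≤ s⁻¹ ^ 2 * (2 * k / c * s ^ 2 + 2 * Λ * C ^ 2 * s ^ 2 / c) := by
            gcongr
        _ = _ := by field_simp
    have o3 := mul_le_mul_of_nonneg_left o1 hl.le
    have o4 := mul_le_mul_of_nonneg_left o2 hl.le
    have o5 : l * (4 * k / c + 2 * Λ * C ^ 2 / c + (T - t₁))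
        = l * (2 * k / c) + l * (2 * k / c + 2 * Λ * C ^ 2 / c) + (T - t₁) * l := by ring
    rw [o5]
    linarith
  linarith

end WeightedFlow

/-! ### The velocity near the initial time -/

/-- The stationary profile `g`, with weight `α` and `F` in place of `A V`, is comparable with the
flow, which stays within distance `C t` of `g`. -/
structure IsInitialProfile (C Λ c : ℝ) (U V A : Space d × ℝ → ℝ) (t₁ : ℝ)
    (g α F : Space d → ℝ) : Prop where
  continuous_g : Continuous g
  continuous_α : Continuous α
  continuous_F : Continuous F
  α_nonneg : ∀ x, 0 ≤ α x
  α_le : ∀ x, α x ≤ Λ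
  abs_sub_profile_le : ∀ x t, t₁ ≤ t → |U (x, t) - g x| ≤ C * t
  accretive : ∀ (t : ℝ) (β : ℝ → ℝ), ContDiff ℝ 1 β → Monotone β → β 0 = 0 →
    ∫ x in cube d, (A (x, t) * V (x, t) - F x) * β (U (x, t) - g x) ≤ 0
  strong : ∀ t : ℝ, ∫ x in cube d, (A (x, t) * V (x, t) - F x) * (U (x, t) - g x)
      ≤ - (c * ∫ x in cube d, (A (x, t) - α x) ^ 2)

namespace IsInitialProfile

variable {t₁ C Λ c s η : ℝ} {U V A : Space d × ℝ → ℝ} {g α F : Space d → ℝ}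

/-- A bound for the `L¹` distance of the weights. -/
noncomputable def modulus (C Λ c I η t : ℝ) : ℝ := η + (Λ * C + I) * C * t / c / (4 * η)

theorem modulus_mono {I t t' : ℝ} (hC : 0 ≤ C) (hΛ : 0 ≤ Λ) (hc : 0 < c) (hη : 0 < η) (hI : 0 ≤ I)
    (h : t ≤ t') : modulus C Λ c I η t ≤ modulus C Λ c I η t' := by
  unfold modulus
  gcongr

/-- Strong accretivity gives an `L²` bound of order `t` for the squared difference of the weights,
and `|y| ≤ η + y² / (4 η)` turns it into an `L¹` bound. -/
theorem integral_abs_weight_sub_le (h : WeightedFlow t₁ C Λ c U V A)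
    (hi : IsInitialProfile C Λ c U V A t₁ g α F) (hη : 0 < η) {t : ℝ} (ht : t₁ ≤ t) :
    ∫ x in cube d, |A (x, t) - α x| ≤ modulus C Λ c (∫ x in cube d, |F x|) η t := by
  have hA := h.continuous_A
  have hV := h.continuous_V
  have hU := h.continuous_U
  have hg := hi.continuous_g
  have hα := hi.continuous_α
  have hF := hi.continuous_F
  have hc := h.c_pos
  have h1 := hi.strong t
  have h2 : |∫ x in cube d, (A (x, t) * V (x, t) - F x) * (U (x, t) - g x)|
      ≤ ∫ x in cube d, (Λ * C + |F x|) * (C * t) := by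
    have hcR : Continuous fun x => (Λ * C + |F x|) * (C * t) := by fun_prop
    rw [← Real.norm_eq_abs]
    refine norm_integral_le_of_norm_le hcR.integrableOn_cube (Eventually.of_forall fun x => ?_)
    rw [norm_mul]
    refine mul_le_mul ?_ (hi.abs_sub_profile_le x t ht) (norm_nonneg _)
      (by have := h.C_nonneg; have := h.Λ_nonneg; positivity)
    refine (norm_sub_le (A (x, t) * V (x, t)) (F x)).trans (add_le_add ?_ le_rfl)
    rw [norm_mul, Real.norm_of_nonneg (h.A_nonneg _)]
    exact mul_le_mul (h.A_le _) (h.abs_V_le _) (norm_nonneg _) h.Λ_nonneg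
  have hFi : IntegrableOn (fun x => |F x|) (cube d) := hF.abs.integrableOn_cube
  rw [integral_mul_const, integral_add (integrable_const _) hFi] at h2
  simp only [integral_const, probReal_univ, smul_eq_mul, one_mul] at h2
  have h3 : ∫ x in cube d, (A (x, t) - α x) ^ 2
      ≤ (Λ * C + ∫ x in cube d, |F x|) * C * t / c := by
    rw [le_div_iff₀ hc]
    have := (abs_le.1 h2).1
    nlinarith
  have hcA : Continuous fun x => A (x, t) - α x := by fun_prop
  have hm : 0 < 1 / (4 * η) := by positivity
  have h4 := integral_mono (μ := volume.restrict (cube d)) hcA.abs.integrableOn_cube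
    ((integrable_const η).add ((hcA.pow 2).integrableOn_cube.const_mul (1 / (4 * η)))) (fun x => by
      have := abs_mul_le_young (y := A (x, t) - α x) (k := 1) hm
      have e : (1 : ℝ) ^ 2 / (4 * (1 / (4 * η))) = η := by field_simp
      rw [e] at this
      simp only [Pi.add_apply, Pi.pow_apply]
      linarith)
  refine h4.trans ?_
  simp only [Pi.add_apply, Pi.pow_apply]
  rw [integral_add (integrable_const _)
    ((by fun_prop : Continuous fun x => 1 / (4 * η) * (A (x, t) - α x) ^ 2).integrableOn_cube),
    integral_const_mul, modulus]
  simp only [integral_const, probReal_univ, smul_eq_mul, one_mul]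
  have := mul_le_mul_of_nonneg_left h3 hm.le
  have e : (Λ * C + ∫ x in cube d, |F x|) * C * t / c / (4 * η)
      = 1 / (4 * η) * ((Λ * C + ∫ x in cube d, |F x|) * C * t / c) := by ring
  rw [e]
  linarith

theorem integral_abs_timeMean_sub_le (h : WeightedFlow t₁ C Λ c U V A)
    (hi : IsInitialProfile C Λ c U V A t₁ g α F) (hη : 0 < η) (hs : 0 < s) :
    ∫ x in cube d, |timeMean s A (x, t₁) - α x|
      ≤ modulus C Λ c (∫ x in cube d, |F x|) η (t₁ + s) := by
  have hA := h.continuous_A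
  have hα := hi.continuous_α
  have hI : 0 ≤ ∫ x in cube d, |F x| := integral_nonneg fun x => abs_nonneg _
  have hcont : Continuous fun p : Space d × ℝ => |A p - α p.1| := by fun_prop
  have hle : t₁ ≤ t₁ + s := by linarith
  have hpt : ∀ x, |timeMean s A (x, t₁) - α x| ≤ s⁻¹ * ∫ t in Ioc t₁ (t₁ + s), |A (x, t) - α x| := by
    intro x
    have hcx : Continuous fun t => A (x, t) := by fun_prop
    have e1 : timeMean s A (x, t₁) - α x = s⁻¹ * ∫ t in t₁..(t₁ + s), (A (x, t) - α x) := by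
      rw [intervalIntegral.integral_sub (hcx.intervalIntegrable _ _) intervalIntegrable_const,
        timeMean]
      simp only [intervalIntegral.integral_const, smul_eq_mul, add_sub_cancel_left]
      field_simp
    rw [e1, abs_mul, abs_of_pos (inv_pos.2 hs), ← intervalIntegral.integral_of_le hle]
    gcongr
    exact intervalIntegral.abs_integral_le_integral_abs hle
  have hb := continuous_timeMean s hA
  have hint : IntegrableOn (fun x => ∫ t in Ioc t₁ (t₁ + s), |A (x, t) - α x|) (cube d) :=
    (integrable_slab hcont t₁ (t₁ + s)).integral_prod_left
  have h1 := integral_mono (μ := volume.restrict (cube d))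
    (by fun_prop : Continuous fun x => |timeMean s A (x, t₁) - α x|).integrableOn_cube
    (hint.const_mul s⁻¹) hpt
  refine h1.trans ?_
  rw [integral_const_mul, inv_mul_le_iff₀ hs]
  have e2 : ∫ x in cube d, ∫ t in Ioc t₁ (t₁ + s), |A (x, t) - α x|
      = ∫ p, |A p - α p.1| ∂slab d t₁ (t₁ + s) :=
    (integral_prod _ (integrable_slab hcont t₁ (t₁ + s))).symm
  rw [e2, integral_slab hcont]
  have h2 := setIntegral_mono_on (μ := volume) (s := Ioc t₁ (t₁ + s))
    (integrableOn_slice_integral hcont t₁ (t₁ + s))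
    (integrableOn_const (C := modulus C Λ c (∫ x in cube d, |F x|) η (t₁ + s)) (by simp))
    measurableSet_Ioc (fun t ht => (integral_abs_weight_sub_le h hi hη ht.1.le).trans
      (modulus_mono h.C_nonneg h.Λ_nonneg h.c_pos hη hI ht.2))
  refine h2.trans (le_of_eq ?_)
  simp [hs.le]

/-- With `σ` the sign of `U - g`, write `α V σ = (A V - F) σ + F σ - (A - α) V σ`. The first term
has nonpositive integral, the second gives the initial `L¹` norm, and the third is controlled by the
distance of the weights. -/
theorem integral_weight_mul_abs_sub_le (h : WeightedFlow t₁ C Λ c U V A)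
    (hi : IsInitialProfile C Λ c U V A t₁ g α F) (hη : 0 < η) (ht₁ : 0 < t₁) {t : ℝ} (ht : t₁ ≤ t) :
    ∫ x in cube d, α x * |U (x, t) - g x| ≤ Λ * t₁ + Λ * (C * t₁)
      + t * ((∫ x in cube d, |F x|) + C * modulus C Λ c (∫ x in cube d, |F x|) η t) := by
  have hA := h.continuous_A
  have hV := h.continuous_V
  have hU := h.continuous_U
  have hg := hi.continuous_g
  have hα := hi.continuous_α
  have hF := hi.continuous_F
  have hsa := continuous_smoothAbs t₁
  have hss := (contDiff_smoothSign ht₁).continuous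
  set I := ∫ x in cube d, |F x| with hIdef
  have hI : 0 ≤ I := integral_nonneg fun x => abs_nonneg _
  set m := modulus C Λ c I η t with hm
  set P : Space d × ℝ → ℝ := fun p => α p.1 * (smoothSign t₁ (U p - g p.1) * V p) with hP
  have hPc : Continuous P := by fun_prop
  -- The starting time doubles as smoothing parameter, so all smoothing and starting errors are of
  -- order `t₁`.
  have hFTC := integral_slab_deriv (P := fun p => α p.1 * smoothAbs t₁ (U p - g p.1)) (P' := P)
    (by fun_prop) hPc ht (fun x τ hτ => by
      have h1 : HasDerivAt (fun τ => smoothAbs t₁ (U (x, τ) - g x))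
          (smoothSign t₁ (U (x, τ) - g x) * V (x, τ)) τ :=
        HasDerivAt.comp (h₂ := smoothAbs t₁) (h := fun τ => U (x, τ) - g x) τ
          (hasDerivAt_smoothAbs ht₁ _) ((h.hasDerivAt x τ hτ.1).sub_const (g x))
      exact h1.const_mul (α x))
  have hslice : ∀ τ ∈ Ioc t₁ t, ∫ x in cube d, P (x, τ) ≤ I + C * m := fun τ hτ => by
    have e1 : ∀ x, P (x, τ) = (A (x, τ) * V (x, τ) - F x) * smoothSign t₁ (U (x, τ) - g x)
        + (F x * smoothSign t₁ (U (x, τ) - g x)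
        - (A (x, τ) - α x) * (V (x, τ) * smoothSign t₁ (U (x, τ) - g x))) := fun x => by
      simp only [hP]; ring
    have i1 : IntegrableOn (fun x => (A (x, τ) * V (x, τ) - F x)
        * smoothSign t₁ (U (x, τ) - g x)) (cube d) :=
      Continuous.integrableOn_cube (by fun_prop)
    have i2 : IntegrableOn (fun x => F x * smoothSign t₁ (U (x, τ) - g x)
        - (A (x, τ) - α x) * (V (x, τ) * smoothSign t₁ (U (x, τ) - g x))) (cube d) :=
      Continuous.integrableOn_cube (by fun_prop)
    have i3 : IntegrableOn (fun x => |F x|) (cube d) := hF.abs.integrableOn_cube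
    have i4 : IntegrableOn (fun x => C * |A (x, τ) - α x|) (cube d) :=
      Continuous.integrableOn_cube (by fun_prop)
    simp_rw [e1]
    rw [integral_add i1 i2]
    have h1 := hi.accretive τ (smoothSign t₁) (contDiff_smoothSign ht₁) (smoothSign_mono ht₁)
      (smoothSign_zero t₁)
    have h2 := integral_mono i2 (i3.add i4) (fun x => by
      have s1 := abs_smoothSign_le ht₁ (U (x, τ) - g x)
      have a1 : F x * smoothSign t₁ (U (x, τ) - g x) ≤ |F x| := by
        refine (le_abs_self _).trans ?_
        rw [abs_mul]
        exact mul_le_of_le_one_right (abs_nonneg _) s1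
      have a2 : -((A (x, τ) - α x) * (V (x, τ) * smoothSign t₁ (U (x, τ) - g x)))
          ≤ C * |A (x, τ) - α x| := by
        refine (neg_le_abs _).trans ?_
        rw [abs_mul, abs_mul, mul_comm C]
        refine mul_le_mul_of_nonneg_left ?_ (abs_nonneg _)
        exact (mul_le_of_le_one_right (abs_nonneg _) s1).trans (h.abs_V_le _)
      simp only [Pi.add_apply]
      linarith)
    simp only [Pi.add_apply] at h2
    rw [integral_add i3 i4, integral_const_mul] at h2
    have h3 := mul_le_mul_of_nonneg_left ((integral_abs_weight_sub_le h hi hη hτ.1.le).trans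
      (modulus_mono h.C_nonneg h.Λ_nonneg h.c_pos hη hI hτ.2)) h.C_nonneg
    linarith
  have hm0 : 0 ≤ I + C * m := by
    have : 0 ≤ m := by
      have := h.C_nonneg; have := h.Λ_nonneg; have := h.c_pos; have := ht₁.le.trans ht
      rw [hm, modulus]; positivity
    have := h.C_nonneg
    positivity
  have hint : ∫ p, P p ∂slab d t₁ t ≤ t * (I + C * m) := by
    rw [integral_slab hPc]
    have := setIntegral_mono_on (μ := volume) (integrableOn_slice_integral hPc t₁ t)
      (integrableOn_const (C := I + C * m) (by simp)) measurableSet_Ioc hslice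
    refine this.trans ?_
    simp only [integral_const, measureReal_restrict_apply_univ, Real.volume_real_Ioc_of_le ht,
      smul_eq_mul]
    exact mul_le_mul_of_nonneg_right (by linarith) hm0
  have hstart : ∫ x in cube d, α x * smoothAbs t₁ (U (x, t₁) - g x) ≤ Λ * (C * t₁) := by
    have := integral_mono (μ := volume.restrict (cube d))
      (by fun_prop : Continuous fun x => α x * smoothAbs t₁ (U (x, t₁) - g x)).integrableOn_cube
      (integrable_const (Λ * (C * t₁))) (fun x =>
        mul_le_mul (hi.α_le x) ((smoothAbs_le_abs ht₁ _).trans (hi.abs_sub_profile_le x t₁ le_rfl))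
          (smoothAbs_nonneg _ _) h.Λ_nonneg)
    simpa using this
  have hend : ∫ x in cube d, α x * |U (x, t) - g x|
      ≤ (∫ x in cube d, α x * smoothAbs t₁ (U (x, t) - g x)) + Λ * t₁ := by
    have i1 : IntegrableOn (fun x => α x * smoothAbs t₁ (U (x, t) - g x)) (cube d) :=
      Continuous.integrableOn_cube (by fun_prop)
    have := integral_mono (μ := volume.restrict (cube d))
      (by fun_prop : Continuous fun x => α x * |U (x, t) - g x|).integrableOn_cube
      (i1.add (integrable_const (Λ * t₁))) (fun x => by
        have a1 := abs_sub_le_smoothAbs t₁ (U (x, t) - g x)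
        have a2 := mul_le_mul_of_nonneg_left a1 (hi.α_nonneg x)
        have a3 := mul_le_mul_of_nonneg_right (hi.α_le x) ht₁.le
        simp only [Pi.add_apply]
        linarith)
    simp only [Pi.add_apply] at this
    rw [integral_add i1 (integrable_const _)] at this
    simpa using this
  linarith

/-- Triangle inequality through `g`, then replacement of `α` by the time mean. When this is divided
by `s` with `t₁ = s²`, the terms in `t₁` disappear as `s → 0`. -/
theorem integral_timeMean_mul_abs_le (h : WeightedFlow t₁ C Λ c U V A)
    (hi : IsInitialProfile C Λ c U V A t₁ g α F) (hη : 0 < η) (ht₁ : 0 < t₁) (hs : 0 < s) :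
    ∫ x in cube d, timeMean s A (x, t₁) * |U (x, t₁ + s) - U (x, t₁)| ≤ Λ * t₁ + 2 * (Λ * (C * t₁))
      + (t₁ + s) * ((∫ x in cube d, |F x|) + C * modulus C Λ c (∫ x in cube d, |F x|) η (t₁ + s))
      + C * s * modulus C Λ c (∫ x in cube d, |F x|) η (t₁ + s) := by
  have hA := h.continuous_A
  have hU := h.continuous_U
  have hg := hi.continuous_g
  have hα := hi.continuous_α
  have hb := continuous_timeMean s hA
  have h1 := integral_weight_mul_abs_sub_le h hi hη ht₁ (t := t₁ + s) (by linarith)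
  have h2 := mul_le_mul_of_nonneg_left (integral_abs_timeMean_sub_le h hi hη hs)
    (mul_nonneg h.C_nonneg hs.le)
  have i1 : IntegrableOn (fun x => α x * |U (x, t₁ + s) - g x|) (cube d) :=
    Continuous.integrableOn_cube (by fun_prop)
  have i2 : IntegrableOn (fun x => C * s * |timeMean s A (x, t₁) - α x|) (cube d) :=
    Continuous.integrableOn_cube (by fun_prop)
  have i12 : IntegrableOn (fun x => α x * |U (x, t₁ + s) - g x|
    + C * s * |timeMean s A (x, t₁) - α x|) (cube d) := i1.add i2
  have h3 := integral_mono (μ := volume.restrict (cube d)) (by fun_prop : Continuous fun x =>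
      timeMean s A (x, t₁) * |U (x, t₁ + s) - U (x, t₁)|).integrableOn_cube
    (i12.add (integrable_const (Λ * (C * t₁)))) (fun x => by
      have a1 := h.lipschitz x t₁ (t₁ + s)
      rw [add_sub_cancel_left, abs_of_pos hs] at a1
      have a2 : |U (x, t₁ + s) - U (x, t₁)| ≤ |U (x, t₁ + s) - g x| + C * t₁ := by
        have := abs_sub_le (U (x, t₁ + s)) (g x) (U (x, t₁))
        rw [abs_sub_comm (g x)] at this
        linarith [hi.abs_sub_profile_le x t₁ le_rfl]
      have a3 : (timeMean s A (x, t₁) - α x) * |U (x, t₁ + s) - U (x, t₁)|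
          ≤ |timeMean s A (x, t₁) - α x| * (C * s) :=
        mul_le_mul (le_abs_self _) a1 (abs_nonneg _) (abs_nonneg _)
      have a4 := mul_le_mul_of_nonneg_left a2 (hi.α_nonneg x)
      have a5 := mul_le_mul_of_nonneg_right (hi.α_le x) (mul_nonneg h.C_nonneg ht₁.le)
      simp only [Pi.add_apply]
      linarith)
  simp only [Pi.add_apply] at h3
  rw [integral_add i12 (integrable_const _), integral_add i1 i2, integral_const_mul] at h3
  simp only [integral_const, probReal_univ, smul_eq_mul, one_mul] at h3
  linarith

end IsInitialProfile

/-! ### The `L¹` bound for the speed of classical solutions -/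

/-- The time derivative as a function on space-time. -/
noncomputable def velocity (u : Space d → ℝ → ℝ) (p : Space d × ℝ) : ℝ := deriv (u p.1) p.2

/-- The weight `1 / |∇u|_ε` as a function on space-time. -/
noncomputable def gradWeight (ε : ℝ) (u : Space d → ℝ → ℝ) (p : Space d × ℝ) : ℝ :=
  (regNorm ε (∇ (fun y => u y p.2) p.1))⁻¹

/-- Stopping the time variable from below at `t₁`. -/
noncomputable def clampTime (t₁ : ℝ) (p : Space d × ℝ) : Space d × ℝ := (p.1, max p.2 t₁)

theorem continuous_clampTime (t₁ : ℝ) : Continuous (clampTime (d := d) t₁) := by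
  unfold clampTime; fun_prop

theorem clampTime_of_le {t₁ t : ℝ} (x : Space d) (h : t₁ ≤ t) : clampTime t₁ (x, t) = (x, t) := by
  simp [clampTime, h]

theorem gradWeight_nonneg {ε : ℝ} (hε : 0 < ε) (u : Space d → ℝ → ℝ) (p : Space d × ℝ) :
    0 ≤ gradWeight ε u p := (inv_pos.2 (regNorm_pos hε _)).le

theorem gradWeight_le {ε : ℝ} (hε : 0 < ε) (u : Space d → ℝ → ℝ) (p : Space d × ℝ) :
    gradWeight ε u p ≤ ε⁻¹ := inv_anti₀ hε (le_regNorm ε _)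

theorem norm_gradient_le_of_forall {f : Space d → ℝ} {L : ℝ} (hL : 0 ≤ L)
    (h : ∀ x y, |f x - f y| ≤ L * ‖x - y‖) (x : Space d) : ‖∇ f x‖ ≤ L := by
  have hf : LipschitzWith L.toNNReal f := LipschitzWith.of_dist_le_mul fun x y => by
    rw [Real.coe_toNNReal _ hL, Real.dist_eq, dist_eq_norm]
    exact h x y
  have := norm_gradient_le_of_lipschitz hf x
  rwa [Real.coe_toNNReal _ hL] at this

section

variable {ε L C M : ℝ} {φ ψ g : Space d → ℝ} {u : Space d → ℝ → ℝ}

theorem IsClassicalSolution.regNorm_gradient_le (hu : IsClassicalSolution ε φ ψ g u)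
    (hB : UniformBounds φ ψ g L C M) (hε : 0 < ε) {t : ℝ} (ht : 0 ≤ t) (x : Space d) :
    regNorm ε (∇ (fun y => u y t) x) ≤ ε + L := by
  have := norm_gradient_le_of_forall hB.L_nonneg (fun x y => hu.lipschitz_space hB hε x y t ht) x
  linarith [regNorm_le_add hε.le (∇ (fun y => u y t) x)]

theorem IsClassicalSolution.abs_velocity_le (hu : IsClassicalSolution ε φ ψ g u)
    (hB : UniformBounds φ ψ g L C M) (hε : 0 < ε) (hg : ContDiff ℝ 2 g) (hgper : IsPeriodic g)
    (hφg : ∀ x, φ x ≤ g x) (hgψ : ∀ x, g x ≤ ψ x) {p : Space d × ℝ} (hp : 0 < p.2) :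
    |velocity u p| ≤ C := by
  rw [velocity, ← Real.norm_eq_abs]
  refine norm_deriv_le_of_lip' hB.C_nonneg ?_
  filter_upwards [lt_mem_nhds hp] with s hs
  exact hu.lipschitz_time hB hε hg hgper hφg hgψ p.1 s p.2 hs.le hp.le

theorem IsClassicalSolution.continuousOn_gradWeight (hu : IsClassicalSolution ε φ ψ g u)
    (hε : 0 < ε) : ContinuousOn (gradWeight ε u) (univ ×ˢ Ioi 0) := by
  have h : ContinuousOn (fun p : Space d × ℝ => fun i => (∇ (fun y => u y p.2) p.1) i)
      (univ ×ˢ Ioi 0) := by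
    refine continuousOn_pi.2 fun i => ?_
    simp_rw [gradient_apply_eq_pderiv]
    exact hu.continuousOn_pderiv i
  have h2 : ContinuousOn (fun p : Space d × ℝ => ∇ (fun y => u y p.2) p.1) (univ ×ˢ Ioi 0) :=
    (PiLp.continuous_toLp 2 _).comp_continuousOn h
  exact ((continuous_regNorm ε).comp_continuousOn h2).inv₀ fun p _ => (regNorm_pos hε _).ne'

theorem ContinuousOn.comp_clampTime {f : Space d × ℝ → ℝ} (hf : ContinuousOn f (univ ×ˢ Ioi 0))
    {t₁ : ℝ} (ht₁ : 0 < t₁) : Continuous (fun p => f (clampTime t₁ p)) :=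
  hf.comp_continuous (continuous_clampTime t₁)
    fun _ => ⟨mem_univ _, ht₁.trans_le (le_max_right _ _)⟩

/-- Clamping time at `t₁` gives functions continuous on all of space-time, although the derivatives
are controlled only for positive times. The accretivity constant comes from `|∇u|_ε ≤ ε + L`, the
bound on the weight from `|∇u|_ε ≥ ε`. -/
theorem IsClassicalSolution.weightedFlow (hu : IsClassicalSolution ε φ ψ g u)
    (hB : UniformBounds φ ψ g L C M) (hε : 0 < ε) (hφ : Continuous φ) (hψ : Continuous ψ)
    (hg : ContDiff ℝ 2 g) (hgper : IsPeriodic g)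
    (hφg : ∀ x, φ x ≤ g x) (hgψ : ∀ x, g x ≤ ψ x) {t₁ : ℝ} (ht₁ : 0 < t₁) :
    WeightedFlow t₁ C ε⁻¹ (ε ^ 6 / (ε + L) ^ 3) (fun p => u (clampTime t₁ p).1 (clampTime t₁ p).2)
      (fun p => velocity u (clampTime t₁ p)) (fun p => gradWeight ε u (clampTime t₁ p)) where
  C_nonneg := hB.C_nonneg
  Λ_nonneg := (inv_pos.2 hε).le
  c_pos := by have := hB.L_nonneg; positivity
  continuous_U := ContinuousOn.comp_clampTime (f := fun p => u p.1 p.2)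
    (hu.continuousOn.mono (prod_mono_right Ioi_subset_Ici_self)) ht₁
  continuous_V := ContinuousOn.comp_clampTime (f := velocity u) hu.continuousOn_deriv ht₁
  continuous_A := ContinuousOn.comp_clampTime (hu.continuousOn_gradWeight hε) ht₁
  hasDerivAt x t ht := by
    rw [clampTime_of_le x ht.le]
    refine (hu.differentiableAt_time x t (ht₁.trans ht)).hasDerivAt.congr_of_eventuallyEq ?_
    filter_upwards [lt_mem_nhds ht] with s hs
    rw [clampTime_of_le x hs.le]
  lipschitz x t s := by
    refine (hu.lipschitz_time hB hε hg hgper hφg hgψ x _ _ (ht₁.le.trans (le_max_right _ _))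
      (ht₁.le.trans (le_max_right _ _))).trans ?_
    exact mul_le_mul_of_nonneg_left (abs_max_sub_max_le_abs _ _ _) hB.C_nonneg
  abs_V_le p := hu.abs_velocity_le hB hε hg hgper hφg hgψ (ht₁.trans_le (le_max_right _ _))
  A_nonneg p := gradWeight_nonneg hε u _
  A_le p := gradWeight_le hε u _
  accretive s t β h1 h2 h3 := by
    have hs : 0 < max s t₁ := ht₁.trans_le (le_max_right _ _)
    have ht : 0 < max t t₁ := ht₁.trans_le (le_max_right _ _)
    simp only [velocity, gradWeight, clampTime, hu.deriv_eq_regNorm_mul_speed hε _ hs,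
      hu.deriv_eq_regNorm_mul_speed hε _ ht]
    refine (integral_speed_sub_mul_le hε hφ hψ (hu.contDiff_space _ hs) (hu.contDiff_space _ ht)
      (hu.periodic _ hs.le) (hu.periodic _ ht.le) (hu.regNorm_gradient_le hB hε hs.le)
      (hu.regNorm_gradient_le hB hε ht.le) h1 h2 h3).trans ?_
    refine neg_nonpos.2 (integral_nonneg fun x => ?_)
    have := hB.L_nonneg
    exact mul_nonneg (by positivity) (mul_nonneg h2.deriv_nonneg (sq_nonneg _))
  strong s t := by
    have hs : 0 < max s t₁ := ht₁.trans_le (le_max_right _ _)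
    have ht : 0 < max t t₁ := ht₁.trans_le (le_max_right _ _)
    simp only [velocity, gradWeight, clampTime, hu.deriv_eq_regNorm_mul_speed hε _ hs,
      hu.deriv_eq_regNorm_mul_speed hε _ ht]
    exact integral_speed_sub_mul_sub_le hε hφ hψ (hu.contDiff_space _ hs)
      (hu.contDiff_space _ ht) (hu.periodic _ hs.le) (hu.periodic _ ht.le)
      (by have := hB.L_nonneg; positivity) (hu.regNorm_gradient_le hB hε hs.le)
      (hu.regNorm_gradient_le hB hε ht.le)

theorem IsClassicalSolution.isInitialProfile (hu : IsClassicalSolution ε φ ψ g u)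
    (hB : UniformBounds φ ψ g L C M) (hε : 0 < ε) (hφ : Continuous φ) (hψ : Continuous ψ)
    (hg : ContDiff ℝ 2 g) (hgper : IsPeriodic g)
    (hφg : ∀ x, φ x ≤ g x) (hgψ : ∀ x, g x ≤ ψ x) {t₁ : ℝ} (ht₁ : 0 < t₁) :
    IsInitialProfile C ε⁻¹ (ε ^ 6 / (ε + L) ^ 3)
      (fun p => u (clampTime t₁ p).1 (clampTime t₁ p).2)
      (fun p => velocity u (clampTime t₁ p)) (fun p => gradWeight ε u (clampTime t₁ p)) t₁
      g (fun x => (regNorm ε (∇ g x))⁻¹) (speed ε φ ψ g) := by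
  have hgR : ∀ x, regNorm ε (∇ g x) ≤ ε + L := fun x => by
    have := norm_gradient_le_of_forall hB.L_nonneg hB.lip_initial x
    linarith [regNorm_le_add hε.le (∇ g x)]
  refine ⟨hg.continuous, ?_, continuous_speed hε hφ hψ hg,
    fun x => (inv_pos.2 (regNorm_pos hε _)).le, fun x => inv_anti₀ hε (le_regNorm ε _),
    fun x t ht => ?_, fun t β h1 h2 h3 => ?_, fun t => ?_⟩
  · exact ((continuous_regNorm ε).comp (continuous_gradient (hg.of_le (by norm_num)))).inv₀
      fun x => (regNorm_pos hε _).ne'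
  · rw [clampTime_of_le x ht]
    exact hu.abs_sub_initial_le hB hε hg hgper hφg hgψ x t (ht₁.le.trans ht)
  · have ht : 0 < max t t₁ := ht₁.trans_le (le_max_right _ _)
    simp only [velocity, gradWeight, clampTime, hu.deriv_eq_regNorm_mul_speed hε _ ht]
    refine (integral_speed_sub_mul_le hε hφ hψ (hu.contDiff_space _ ht) hg
      (hu.periodic _ ht.le) hgper (hu.regNorm_gradient_le hB hε ht.le) hgR h1 h2 h3).trans ?_
    refine neg_nonpos.2 (integral_nonneg fun x => ?_)
    have := hB.L_nonneg
    exact mul_nonneg (by positivity) (mul_nonneg h2.deriv_nonneg (sq_nonneg _))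
  · have ht : 0 < max t t₁ := ht₁.trans_le (le_max_right _ _)
    simp only [velocity, gradWeight, clampTime, hu.deriv_eq_regNorm_mul_speed hε _ ht]
    exact integral_speed_sub_mul_sub_le hε hφ hψ (hu.contDiff_space _ ht) hg
      (hu.periodic _ ht.le) hgper (by have := hB.L_nonneg; positivity)
      (hu.regNorm_gradient_le hB hε ht.le) hgR

theorem timeMean_clampTime {s t₁ t : ℝ} (hs : 0 < s) (ht : t₁ ≤ t) (A : Space d × ℝ → ℝ)
    (x : Space d) : timeMean s (fun p => A (clampTime t₁ p)) (x, t) = timeMean s A (x, t) := by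
  unfold timeMean
  congr 1
  refine intervalIntegral.integral_congr fun τ hτ => ?_
  simp only at hτ ⊢
  rw [uIcc_of_le (by linarith)] at hτ
  rw [clampTime_of_le x (ht.trans hτ.1)]

theorem tendsto_timeMean {A : Space d × ℝ → ℝ} (hA : Continuous A) (x : Space d) (t : ℝ) :
    Tendsto (fun s => timeMean s A (x, t)) (𝓝[>] 0) (𝓝 (A (x, t))) := by
  have hc : Continuous fun s => A (x, s) := by fun_prop
  have h1 : HasDerivAt (fun s => ∫ τ in t..s, A (x, τ)) (A (x, t)) t :=
    intervalIntegral.integral_hasDerivAt_right (hc.intervalIntegrable _ _)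
      hc.stronglyMeasurable.stronglyMeasurableAtFilter hc.continuousAt
  have := h1.tendsto_slope_zero_right
  simpa [timeMean] using this

/-- The difference quotient errors of a classical solution tend to zero. -/
theorem IsClassicalSolution.tendsto_quotientError (hu : IsClassicalSolution ε φ ψ g u)
    (hB : UniformBounds φ ψ g L C M) (hε : 0 < ε)
    (hg : ContDiff ℝ 2 g) (hgper : IsPeriodic g)
    (hφg : ∀ x, φ x ≤ g x) (hgψ : ∀ x, g x ≤ ψ x) (T : ℝ) :
    (∀ s, 0 < s → Integrable (quotientError s (fun p => u p.1 p.2) (velocity u)) (slab d 0 T)) ∧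
    Tendsto (fun s => ∫ p, quotientError s (fun p => u p.1 p.2) (velocity u) p ∂slab d 0 T)
      (𝓝[>] 0) (𝓝 0) := by
  have hslab : slab d 0 T = volume.restrict (cube d ×ˢ Ioc 0 T) := by
    rw [slab, Measure.prod_restrict, Measure.volume_eq_prod]
  have hmS : MeasurableSet (cube d ×ˢ Ioc (0 : ℝ) T) := measurableSet_cube.prod measurableSet_Ioc
  have hpos : ∀ᵐ p ∂slab d 0 T, 0 < p.2 := by
    rw [hslab]
    filter_upwards [ae_restrict_mem hmS] with p hp using hp.2.1
  have hmeas : ∀ s, 0 < s → AEStronglyMeasurable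
      (quotientError s (fun p => u p.1 p.2) (velocity u)) (slab d 0 T) := fun s hs => by
    have hU : ContinuousOn (fun p : Space d × ℝ => u p.1 p.2) (univ ×ˢ Ioi 0) :=
      hu.continuousOn.mono (prod_mono_right Ioi_subset_Ici_self)
    have hV : ContinuousOn (velocity u) (univ ×ˢ Ioi 0) := hu.continuousOn_deriv
    have hsh : ∀ {f : Space d × ℝ → ℝ}, ContinuousOn f (univ ×ˢ Ioi 0) →
        ContinuousOn (fun p => f (p.1, p.2 + s)) (univ ×ˢ Ioi 0) := fun hf =>
      hf.comp (by fun_prop : Continuous fun p : Space d × ℝ => (p.1, p.2 + s)).continuousOn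
        fun p hp => ⟨mem_univ _, by have := hp.2; simp only [mem_Ioi] at this ⊢; linarith⟩
    have hcont : ContinuousOn (quotientError s (fun p => u p.1 p.2) (velocity u))
        (univ ×ˢ Ioi 0) :=
      (((continuousOn_const.mul ((hsh hU).sub hU)).sub hV).pow 2).add
        (((hsh hV).sub hV).pow 2)
    rw [hslab]
    exact (hcont.mono (prod_mono (subset_univ _) fun t ht => ht.1)).aestronglyMeasurable hmS
  have hbound : ∀ s, 0 < s → ∀ᵐ p ∂slab d 0 T,
      ‖quotientError s (fun p => u p.1 p.2) (velocity u) p‖ ≤ 8 * C ^ 2 := fun s hs => by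
    filter_upwards [hpos] with p hp
    have hq : |s⁻¹ * (u p.1 (p.2 + s) - u p.1 p.2)| ≤ C := by
      have := hu.lipschitz_time hB hε hg hgper hφg hgψ p.1 (p.2 + s) p.2 (by linarith) hp.le
      rw [add_sub_cancel_left, abs_of_pos hs] at this
      rw [abs_mul, abs_of_pos (inv_pos.2 hs), inv_mul_le_iff₀ hs, mul_comm]
      exact this
    have hv := hu.abs_velocity_le hB hε hg hgper hφg hgψ hp
    have hw := hu.abs_velocity_le hB hε hg hgper hφg hgψ (p := (p.1, p.2 + s))
      (by simp only; linarith)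
    rw [Real.norm_of_nonneg (by unfold quotientError; positivity), quotientError]
    have a1 : |s⁻¹ * (u p.1 (p.2 + s) - u p.1 p.2) - velocity u p| ≤ 2 * C :=
      (abs_sub _ _).trans (by linarith)
    have a2 : |velocity u (p.1, p.2 + s) - velocity u p| ≤ 2 * C :=
      (abs_sub _ _).trans (by linarith)
    rw [← sq_abs, ← sq_abs (velocity u (p.1, p.2 + s) - velocity u p)]
    have b1 : |s⁻¹ * (u p.1 (p.2 + s) - u p.1 p.2) - velocity u p| ^ 2 ≤ (2 * C) ^ 2 := by gcongr
    have b2 : |velocity u (p.1, p.2 + s) - velocity u p| ^ 2 ≤ (2 * C) ^ 2 := by gcongr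
    nlinarith
  refine ⟨fun s hs => Integrable.of_bound (hmeas s hs) _ (hbound s hs), ?_⟩
  suffices h : Tendsto
      (fun s => ∫ p, quotientError s (fun p => u p.1 p.2) (velocity u) p ∂slab d 0 T)
      (𝓝[>] 0) (𝓝 (∫ _p : Space d × ℝ, (0 : ℝ) ∂slab d 0 T)) by
    rwa [integral_zero] at h
  refine tendsto_integral_filter_of_dominated_convergence (fun _ => 8 * C ^ 2)
    (eventually_mem_nhdsWithin.mono fun s hs => hmeas s hs)
    (eventually_mem_nhdsWithin.mono fun s hs => hbound s hs) (integrable_const _) ?_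
  filter_upwards [hpos] with p hp
  have hd := (hu.differentiableAt_time p.1 p.2 hp).hasDerivAt.tendsto_slope_zero_right
  have hc : ContinuousAt (velocity u) p := hu.continuousOn_deriv.continuousAt
    ((isOpen_univ.prod isOpen_Ioi).mem_nhds ⟨mem_univ _, hp⟩)
  have hv : Tendsto (fun s => velocity u (p.1, p.2 + s)) (𝓝[>] 0) (𝓝 (velocity u p)) := by
    refine hc.tendsto.comp (Tendsto.mono_left ?_ nhdsWithin_le_nhds)
    have : Continuous fun s : ℝ => ((p.1, p.2 + s) : Space d × ℝ) := by fun_prop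
    simpa using this.tendsto 0
  have h1 := ((hd.sub_const (deriv (u p.1) p.2)).pow 2).add ((hv.sub_const (velocity u p)).pow 2)
  simpa [quotientError, velocity] using h1

/-- The speed of a classical solution is bounded in `L¹` by its initial value. -/
theorem IsClassicalSolution.integral_abs_speed_le (hu : IsClassicalSolution ε φ ψ g u)
    (hB : UniformBounds φ ψ g L C M) (hε : 0 < ε) (hφ : Continuous φ) (hψ : Continuous ψ)
    (hg : ContDiff ℝ 2 g) (hgper : IsPeriodic g)
    (hφg : ∀ x, φ x ≤ g x) (hgψ : ∀ x, g x ≤ ψ x) {t : ℝ} (ht : 0 < t) :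
    ∫ x in cube d, |speed ε φ ψ (fun y => u y t) x| ≤ ∫ x in cube d, |speed ε φ ψ g x| := by
  set I := ∫ x in cube d, |speed ε φ ψ g x| with hI
  set c : ℝ := ε ^ 6 / (ε + L) ^ 3 with hc
  have hc0 : 0 < c := by have := hB.L_nonneg; positivity
  have hC := hB.C_nonneg
  have hΛ : 0 < ε⁻¹ := inv_pos.2 hε
  set k : ℝ := 4 * (ε⁻¹ * C ^ 2 + 8 * C ^ 4 * t / c) / c + 2 * ε⁻¹ * C ^ 2 / c + t with hk
  have hft := hu.weightedFlow hB hε hφ hψ hg hgper hφg hgψ ht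
  have hAt : Continuous (fun x : Space d => gradWeight ε u (x, t)) := by
    have := hft.continuous_A.comp (by fun_prop : Continuous fun x : Space d => ((x, t) : Space d × ℝ))
    simpa [Function.comp_def, clampTime] using this
  have hVt : Continuous (fun x : Space d => velocity u (x, t)) := by
    have := hft.continuous_V.comp (by fun_prop : Continuous fun x : Space d => ((x, t) : Space d × ℝ))
    simpa [Function.comp_def, clampTime] using this
  have hUt : ∀ τ, 0 < τ → Continuous (fun x => u x τ) := fun τ hτ =>
    (hu.contDiff_space τ hτ).continuous
  obtain ⟨hRint, hRlim⟩ := hu.tendsto_quotientError hB hε hg hgper hφg hgψ t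
  -- Order of limits: `s → 0` with starting time `s²` at fixed `l`, which eliminates the initial
  -- layer and the quotient errors; then `l → 0` below.
  have main : ∀ l, 0 < l → ∫ x in cube d, gradWeight ε u (x, t) * smoothAbs l (velocity u (x, t))
      ≤ I + 2 * C * l + l * k := by
    intro l hl
    -- The same `l` serves as the parameter `η`; the modulus tends to `l`, not to zero, which
    -- explains the term `2 * C * l`.
    set m : ℝ → ℝ := fun s => IsInitialProfile.modulus C ε⁻¹ c I l (s ^ 2 + s) with hm
    have hmc : Continuous m := by
      simp only [hm, IsInitialProfile.modulus]; fun_prop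
    have hm0 : m 0 = l := by simp [hm, IsInitialProfile.modulus]
    have hlhs : Tendsto (fun s => ∫ x in cube d, timeMean s (gradWeight ε u) (x, t)
        * smoothAbs l (s⁻¹ * (u x (t + s) - u x t))) (𝓝[>] 0)
        (𝓝 (∫ x in cube d, gradWeight ε u (x, t) * smoothAbs l (velocity u (x, t)))) := by
      refine tendsto_integral_filter_of_dominated_convergence (fun _ => ε⁻¹ * C)
        (eventually_mem_nhdsWithin.mono fun s hs => ?_)
        (eventually_mem_nhdsWithin.mono fun s hs => Eventually.of_forall fun x => ?_)
        (integrable_const _) (Eventually.of_forall fun x => ?_)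
      · have hs' : 0 < s := hs
        have h1 : Continuous fun x : Space d => timeMean s (gradWeight ε u) (x, t) := by
          simp_rw [← timeMean_clampTime hs' le_rfl (gradWeight ε u)]
          exact (continuous_timeMean s hft.continuous_A).comp (by fun_prop)
        have h2 := hUt (t + s) (by linarith)
        have h3 := hUt t ht
        have h4 := continuous_smoothAbs l
        exact (by fun_prop : Continuous fun x => timeMean s (gradWeight ε u) (x, t)
          * smoothAbs l (s⁻¹ * (u x (t + s) - u x t))).aestronglyMeasurable
      · have hs' : 0 < s := hs
        rw [← timeMean_clampTime hs' le_rfl (gradWeight ε u), norm_mul,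
          Real.norm_of_nonneg (timeMean_nonneg hs' hft.A_nonneg _),
          Real.norm_of_nonneg (smoothAbs_nonneg _ _)]
        refine mul_le_mul (timeMean_le hs' hft.continuous_A hft.A_le _)
          ((smoothAbs_le_abs hl _).trans ?_) (smoothAbs_nonneg _ _) hΛ.le
        have := hu.lipschitz_time hB hε hg hgper hφg hgψ x (t + s) t (by linarith) ht.le
        rw [add_sub_cancel_left, abs_of_pos hs'] at this
        rw [abs_mul, abs_of_pos (inv_pos.2 hs'), inv_mul_le_iff₀ hs', mul_comm]
        exact this
      · have h1 : Tendsto (fun s => timeMean s (gradWeight ε u) (x, t)) (𝓝[>] 0)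
            (𝓝 (gradWeight ε u (x, t))) := by
          have h2 := tendsto_timeMean hft.continuous_A x t
          rw [clampTime_of_le x le_rfl] at h2
          refine h2.congr' (eventually_mem_nhdsWithin.mono fun s hs => ?_)
          exact timeMean_clampTime hs le_rfl _ x
        have h3 := (hu.differentiableAt_time x t ht).hasDerivAt.tendsto_slope_zero_right
        exact h1.mul (((continuous_smoothAbs l).tendsto _).comp h3)
    have hrhs : Tendsto (fun s => ε⁻¹ * s + 2 * (ε⁻¹ * (C * s)) + (s + 1) * (I + C * m s) + C * m s
        + l * k + 1 / l * ∫ p, quotientError s (fun p => u p.1 p.2) (velocity u) p ∂slab d 0 t)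
        (𝓝[>] 0) (𝓝 (I + 2 * C * l + l * k)) := by
      have h1 : Continuous fun s => ε⁻¹ * s + 2 * (ε⁻¹ * (C * s)) + (s + 1) * (I + C * m s)
        + C * m s + l * k := by fun_prop
      have h2 := ((h1.tendsto 0).mono_left nhdsWithin_le_nhds).add (hRlim.const_mul (1 / l))
      convert h2 using 2
      rw [hm0]; ring
    refine le_of_tendsto_of_tendsto hlhs hrhs ?_
    have hsmall : ∀ᶠ s in 𝓝[>] (0 : ℝ), s ^ 2 < t := by
      have : Tendsto (fun s : ℝ => s ^ 2) (𝓝[>] 0) (𝓝 0) := by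
        have h1 : Continuous fun s : ℝ => s ^ 2 := by fun_prop
        simpa using (h1.tendsto 0).mono_left nhdsWithin_le_nhds
      exact this.eventually (gt_mem_nhds ht)
    filter_upwards [hsmall, eventually_mem_nhdsWithin] with s hst hs
    have hs' : 0 < s := hs
    have ht₁ : 0 < s ^ 2 := by positivity
    have hfl := hu.weightedFlow hB hε hφ hψ hg hgper hφg hgψ ht₁
    have hin := hu.isInitialProfile hB hε hφ hψ hg hgper hφg hgψ ht₁
    have e1 := hfl.integral_smoothAbs_le hst.le hs' hl
    have e2 := IsInitialProfile.integral_timeMean_mul_abs_le hfl hin hl ht₁ hs'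
    rw [← hc] at e1 e2
    simp only [clampTime_of_le _ hst.le, clampTime_of_le _ (hst.le.trans (by linarith : t ≤ t + s)),
      clampTime_of_le _ le_rfl, clampTime_of_le _ (by linarith : s ^ 2 ≤ s ^ 2 + s),
      timeMean_clampTime hs' hst.le, timeMean_clampTime hs' le_rfl] at e1 e2
    rw [← hI] at e2
    have e3 : ∫ x in cube d, timeMean s (gradWeight ε u) (x, s ^ 2)
          * smoothAbs l (s⁻¹ * (u x (s ^ 2 + s) - u x (s ^ 2)))
        ≤ s⁻¹ * ∫ x in cube d, timeMean s (gradWeight ε u) (x, s ^ 2)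
          * |u x (s ^ 2 + s) - u x (s ^ 2)| := by
      have hb : Continuous fun x : Space d => timeMean s (gradWeight ε u) (x, s ^ 2) := by
        simp_rw [← timeMean_clampTime hs' le_rfl (gradWeight ε u)]
        exact (continuous_timeMean s hfl.continuous_A).comp (by fun_prop)
      have h2 := hUt (s ^ 2 + s) (by linarith)
      have h3 := hUt (s ^ 2) ht₁
      have h4 := continuous_smoothAbs l
      rw [← integral_const_mul]
      refine integral_mono (by fun_prop : Continuous fun x => timeMean s (gradWeight ε u) (x, s ^ 2)
          * smoothAbs l (s⁻¹ * (u x (s ^ 2 + s) - u x (s ^ 2)))).integrableOn_cube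
        (by fun_prop : Continuous fun x => s⁻¹ * (timeMean s (gradWeight ε u) (x, s ^ 2)
          * |u x (s ^ 2 + s) - u x (s ^ 2)|)).integrableOn_cube fun x => ?_
      have h5 := smoothAbs_le_abs hl (s⁻¹ * (u x (s ^ 2 + s) - u x (s ^ 2)))
      rw [abs_mul, abs_of_pos (inv_pos.2 hs')] at h5
      have h6 := mul_le_mul_of_nonneg_left h5
        (timeMean_nonneg hs' (gradWeight_nonneg hε u) (x, s ^ 2))
      simp only
      linarith
    have e4 : s⁻¹ * ∫ x in cube d, timeMean s (gradWeight ε u) (x, s ^ 2)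
          * |u x (s ^ 2 + s) - u x (s ^ 2)|
        ≤ ε⁻¹ * s + 2 * (ε⁻¹ * (C * s)) + (s + 1) * (I + C * m s) + C * m s := by
      rw [inv_mul_le_iff₀ hs']
      refine e2.trans (le_of_eq ?_)
      simp only [hm]
      ring
    have e5 : l * (4 * (ε⁻¹ * C ^ 2 + 8 * C ^ 4 * (t - s ^ 2) / c) / c + 2 * ε⁻¹ * C ^ 2 / c
        + (t - s ^ 2)) ≤ l * k := by
      rw [hk]
      have : t - s ^ 2 ≤ t := by linarith
      gcongr
    have e6 : ∫ p, quotientError s (fun p => u (clampTime (s ^ 2) p).1 (clampTime (s ^ 2) p).2)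
          (fun p => velocity u (clampTime (s ^ 2) p)) p ∂slab d (s ^ 2) t
        ≤ ∫ p, quotientError s (fun p => u p.1 p.2) (velocity u) p ∂slab d 0 t := by
      have hslab : ∀ a, slab d a t = volume.restrict (cube d ×ˢ Ioc a t) := fun a => by
        rw [slab, Measure.prod_restrict, Measure.volume_eq_prod]
      have hint := hRint s hs'
      rw [hslab] at hint ⊢
      rw [hslab]
      refine le_trans (le_of_eq ?_) (setIntegral_mono_set hint (Eventually.of_forall fun p => ?_)
        (Eventually.of_forall (prod_mono_right (Ioc_subset_Ioc_left ht₁.le))))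
      · refine setIntegral_congr_fun (measurableSet_cube.prod measurableSet_Ioc) fun p hp => ?_
        have h1 : clampTime (s ^ 2) p = p := clampTime_of_le p.1 hp.2.1.le
        have h2 : clampTime (s ^ 2) (p.1, p.2 + s) = (p.1, p.2 + s) :=
          clampTime_of_le p.1 (by linarith [hp.2.1])
        simp only [quotientError, h1, h2]
      · simp only [Pi.zero_apply, quotientError]; positivity
    have e7 := mul_le_mul_of_nonneg_left e6 (by positivity : 0 ≤ 1 / l)
    linarith
  have hfin : ∀ l, 0 < l → ∫ x in cube d, |speed ε φ ψ (fun y => u y t) x|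
      ≤ I + l * (2 * C + k + ε⁻¹) := fun l hl => by
    have h4 := continuous_smoothAbs l
    have i1 : IntegrableOn (fun x => gradWeight ε u (x, t) * smoothAbs l (velocity u (x, t)))
        (cube d) := Continuous.integrableOn_cube (by fun_prop)
    have h1 := integral_mono (μ := volume.restrict (cube d))
      (continuous_speed hε hφ hψ (hu.contDiff_space t ht)).abs.integrableOn_cube
      (i1.add (integrable_const (ε⁻¹ * l))) (fun x => by
        have e1 : speed ε φ ψ (fun y => u y t) x = gradWeight ε u (x, t) * velocity u (x, t) :=
          (hu.deriv_eq_regNorm_mul_speed hε x ht).symm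
        simp only [Pi.add_apply]
        rw [e1, abs_mul, abs_of_nonneg (gradWeight_nonneg hε u _)]
        have a1 := mul_le_mul_of_nonneg_left (abs_sub_le_smoothAbs l (velocity u (x, t)))
          (gradWeight_nonneg hε u (x, t))
        have a2 := mul_le_mul_of_nonneg_right (gradWeight_le hε u (x, t)) hl.le
        linarith)
    simp only [Pi.add_apply] at h1
    rw [integral_add i1 (integrable_const _)] at h1
    simp only [integral_const, probReal_univ, smul_eq_mul, one_mul] at h1
    linarith [main l hl]
  refine le_of_tendsto_of_tendsto tendsto_const_nhds (?_ : Tendsto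
    (fun l => I + l * (2 * C + k + ε⁻¹)) (𝓝[>] 0) (𝓝 I))
    (eventually_mem_nhdsWithin.mono fun l hl => hfin l hl)
  have h1 : Continuous fun l => I + l * (2 * C + k + ε⁻¹) := by fun_prop
  simpa using (h1.tendsto 0).mono_left nhdsWithin_le_nhds

end

/-! ### Convergence of the energies -/

theorem limitEnergy_eq_of_lipschitz {φ ψ w : Space d → ℝ} {K : NNReal} (hw : LipschitzWith K w)
    (hwp : IsPeriodic w) (hob : ∀ x, φ x ≤ w x ∧ w x ≤ ψ x) :
    limitEnergy φ ψ w = ENNReal.ofReal (∫ x in cube d, ‖∇ w x‖) := by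
  rw [limitEnergy, if_pos hob, ofReal_integral_norm_eq_lintegral_enorm
    (isWeakGradient_gradient hw hwp).integrableOn]
  refine lintegral_congr_ae ?_
  filter_upwards [weakGradient_ae_eq hw hwp] with x hx
  rw [hx]

/-- Convexity of the penalty, which vanishes at the admissible value `r` and whose derivative is
minus the force. -/
theorem force_mul_sub_add_penalty_nonpos {ε : ℝ} (hε : 0 < ε) {φ ψ : Space d → ℝ} {x : Space d}
    {s r : ℝ} (h1 : φ x ≤ r) (h2 : r ≤ ψ x) :
    force ε φ ψ x s * (s - r) + penalty ε φ ψ x s ≤ 0 := by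
  unfold force penalty
  have key : ∀ y z : ℝ, y ≤ -z → 4 * (max y 0 ^ 3 * z) + max y 0 ^ 4 ≤ 0 := fun y z hyz => by
    rcases le_total y 0 with hy | hy
    · simp [max_eq_right hy]
    · rw [max_eq_left hy]
      have : 0 ≤ y ^ 3 := by positivity
      nlinarith
  have k1 := key (φ x - s) (s - r) (by linarith)
  have k2 := key (s - ψ x) (r - s) (by linarith)
  have hi : 0 ≤ 1 / ε := by positivity
  have e : (4 / ε * max (φ x - s) 0 ^ 3 - 4 / ε * max (s - ψ x) 0 ^ 3) * (s - r)
      + (1 / ε * max (φ x - s) 0 ^ 4 + 1 / ε * max (s - ψ x) 0 ^ 4)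
      = 1 / ε * ((4 * (max (φ x - s) 0 ^ 3 * (s - r)) + max (φ x - s) 0 ^ 4)
        + (4 * (max (s - ψ x) 0 ^ 3 * (r - s)) + max (s - ψ x) 0 ^ 4)) := by ring
  rw [e]
  exact mul_nonpos_of_nonneg_of_nonpos hi (by linarith)

/-- Convexity of `|·|_ε`. -/
theorem regNorm_le_add_inner {ε : ℝ} (hε : 0 < ε) (p q : Space d) :
    regNorm ε p ≤ regNorm ε q + inner ℝ (regNormal ε p) (p - q) := by
  have hP := regNorm_pos hε p
  have hQ := regNorm_pos hε q
  have hPs := regNorm_sq ε p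
  have hQs := regNorm_sq ε q
  rw [regNormal, inner_smul_left, conj_trivial, inner_sub_right, real_inner_self_eq_norm_sq]
  have hcs : inner ℝ p q ≤ regNorm ε p * regNorm ε q - ε ^ 2 := by
    have h1 := real_inner_le_norm p q
    have h2 : ‖p‖ * ‖q‖ + ε ^ 2 ≤ regNorm ε p * regNorm ε q := by
      refine le_of_abs_le (abs_le_of_sq_le_sq ?_ (by positivity))
      rw [mul_pow, hPs, hQs]
      nlinarith [mul_nonneg (sq_nonneg ε) (sq_nonneg (‖p‖ - ‖q‖))]
    linarith
  have h3 : regNorm ε p * (regNorm ε p - regNorm ε q) ≤ ‖p‖ ^ 2 - inner ℝ p q := by nlinarith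
  have h4 : regNorm ε p - regNorm ε q ≤ (regNorm ε p)⁻¹ * (‖p‖ ^ 2 - inner ℝ p q) := by
    rw [← div_eq_inv_mul, le_div_iff₀ hP]; linarith
  linarith

/-- The energy of a smooth function is controlled by that of any competitor that respects the
obstacles, up to the `L¹` norm of the speed times the uniform distance. -/
theorem regEnergy_le_of_speed {ε δ N : ℝ} (hε : 0 < ε) {φ ψ v w : Space d → ℝ} {K : NNReal}
    (hφ : Continuous φ) (hψ : Continuous ψ) (hv : ContDiff ℝ 2 v) (hvp : IsPeriodic v)
    (hw : LipschitzWith K w) (hwp : IsPeriodic w) (hob : ∀ x, φ x ≤ w x ∧ w x ≤ ψ x)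
    (hδ0 : 0 ≤ δ) (hδ : ∀ x, |v x - w x| ≤ δ) (hN : ∫ x in cube d, |speed ε φ ψ v x| ≤ N) :
    regEnergy ε φ ψ v ≤ ENNReal.ofReal ((∫ x in cube d, ‖∇ w x‖) + ε + δ * N) := by
  have hv1 : ContDiff ℝ 1 v := hv.of_le (by norm_num)
  obtain ⟨Kv, hKv⟩ := hvp.exists_lipschitzWith hv1
  have hgv := continuous_gradient hv1
  have hreg : Continuous fun x => regNorm ε (∇ v x) + penalty ε φ ψ x (v x) := by
    refine ((continuous_regNorm ε).comp hgv).add ?_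
    have := hv.continuous
    unfold penalty; fun_prop
  have e1 : regEnergy ε φ ψ v
      = ENNReal.ofReal (∫ x in cube d, (regNorm ε (∇ v x) + penalty ε φ ψ x (v x))) := by
    rw [ofReal_integral_eq_lintegral_ofReal hreg.integrableOn_cube
      (Eventually.of_forall fun x => add_nonneg (regNorm_pos hε _).le (penalty_nonneg hε φ ψ x _))]
    refine lintegral_congr_ae ?_
    filter_upwards [weakGradient_ae_eq hKv hvp] with x hx
    rw [hx]
  rw [e1]
  refine ENNReal.ofReal_le_ofReal ?_
  set h : Space d → ℝ := fun x => v x - w x with hh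
  have hhl : LipschitzWith (Kv + K) h := hKv.sub hw
  have hhp : IsPeriodic h := fun x k => by simp only [hh, hvp x k, hwp x k]
  have hIBP := integral_regCurvature_mul hε hv hvp hhl hhp
  have hsp := continuous_speed hε hφ hψ hv
  have hhc := hhl.continuous
  have hcu := continuous_regCurvature hε hv
  have hgw := (isWeakGradient_gradient hw hwp).integrableOn.norm
  have hinner : IntegrableOn (fun x => inner ℝ (regNormal ε (∇ v x)) (∇ h x)) (cube d) := by
    refine Integrable.of_bound (C := (Kv + K : NNReal)) ?_ (Eventually.of_forall fun x => ?_)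
    · exact (continuous_regNormal hε hv1).aestronglyMeasurable.inner
        (measurable_gradient h).aestronglyMeasurable
    · refine (norm_inner_le_norm _ _).trans ?_
      exact (mul_le_of_le_one_left (norm_nonneg _) (norm_regNormal_le hε _)).trans
        (norm_gradient_le_of_lipschitz hhl x)
  have hpen : Continuous fun x => penalty ε φ ψ x (v x) := by
    have := hv.continuous
    unfold penalty; fun_prop
  have hgrad : ∀ᵐ x ∂(volume.restrict (cube d)), ∇ h x = ∇ v x - ∇ w x := by
    refine ae_restrict_of_ae ?_
    filter_upwards [hw.ae_differentiableAt (μ := volume)] with x hx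
    ext i
    rw [gradient_apply_eq_pderiv, pderiv_sub (hv1.differentiable one_ne_zero x) hx]
    simp [gradient_apply_eq_pderiv]
  -- Convexity of `|·|_ε` at `∇v`, tested with the competitor's gradient; its linear term is
  -- integrated by parts next.
  have step1 : ∫ x in cube d, (regNorm ε (∇ v x) + penalty ε φ ψ x (v x))
      ≤ ∫ x in cube d, ((‖∇ w x‖ + ε) + (inner ℝ (regNormal ε (∇ v x)) (∇ h x)
        + penalty ε φ ψ x (v x))) := by
    refine integral_mono_ae hreg.integrableOn_cube
      ((hgw.add (integrable_const ε)).add (hinner.add hpen.integrableOn_cube)) ?_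
    filter_upwards [hgrad] with x hx
    have a1 := regNorm_le_add_inner hε (∇ v x) (∇ w x)
    have a2 := regNorm_le_add hε.le (∇ w x)
    rw [hx]
    linarith
  have i0 : IntegrableOn (fun x => ‖∇ w x‖ + ε) (cube d) := hgw.add (integrable_const ε)
  have i1 : IntegrableOn (fun x => inner ℝ (regNormal ε (∇ v x)) (∇ h x)
      + penalty ε φ ψ x (v x)) (cube d) := hinner.add hpen.integrableOn_cube
  rw [integral_add i0 i1, integral_add hgw (integrable_const ε),
    integral_add hinner hpen.integrableOn_cube] at step1
  simp only [integral_const, probReal_univ, smul_eq_mul, one_mul] at step1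
  -- The curvature is force minus speed. The force part cancels the penalty by convexity, leaving
  -- the pairing of the speed with `v - w`.
  have step2 : (∫ x in cube d, inner ℝ (regNormal ε (∇ v x)) (∇ h x))
      + ∫ x in cube d, penalty ε φ ψ x (v x) ≤ δ * N := by
    have e2 : ∫ x in cube d, inner ℝ (regNormal ε (∇ v x)) (∇ h x)
        = ∫ x in cube d, regCurvature ε v x * h x := by
      have : ∫ x in cube d, -regCurvature ε v x * h x
          = - ∫ x in cube d, regCurvature ε v x * h x := by
        rw [← integral_neg]
        exact integral_congr_ae (Eventually.of_forall fun x => by simp only; ring)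
      linarith
    have i2 : IntegrableOn (fun x => regCurvature ε v x * h x) (cube d) :=
      (hcu.mul hhc).integrableOn_cube
    have i3 : IntegrableOn (fun x => regCurvature ε v x * h x + penalty ε φ ψ x (v x)) (cube d) :=
      i2.add hpen.integrableOn_cube
    rw [e2, ← integral_add i2 hpen.integrableOn_cube]
    refine le_trans (integral_mono (g := fun x => δ * |speed ε φ ψ v x|) i3
      (continuous_const.mul hsp.abs).integrableOn_cube fun x => ?_) ?_
    · have a1 := force_mul_sub_add_penalty_nonpos hε (s := v x) (hob x).1 (hob x).2
      have a2 : -(speed ε φ ψ v x * h x) ≤ δ * |speed ε φ ψ v x| := by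
        refine (neg_le_abs _).trans ?_
        rw [abs_mul, mul_comm]
        exact mul_le_mul_of_nonneg_right (hδ x) (abs_nonneg _)
      have a3 : regCurvature ε v x * h x
          = force ε φ ψ x (v x) * (v x - w x) - speed ε φ ψ v x * h x := by
        simp only [speed, hh]; ring
      simp only
      rw [a3]
      linarith
    · rw [integral_const_mul]
      exact mul_le_mul_of_nonneg_left hN hδ0
  linarith

/-- The lower bound is the liminf inequality. For the upper bound the limit itself is the
competitor, and the uniform distance multiplies a bounded `L¹` norm. -/
theorem tendsto_regEnergy_of_speed {ε : ℕ → ℝ} (hε : ∀ k, 0 < ε k) (hε0 : Tendsto ε atTop (𝓝 0))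
    {φ ψ w : Space d → ℝ} {v : ℕ → Space d → ℝ} {K : NNReal} {N : ℝ}
    (hφ : Continuous φ) (hψ : Continuous ψ) (hφp : IsPeriodic φ) (hψp : IsPeriodic ψ)
    (hv : ∀ k, ContDiff ℝ 2 (v k)) (hvp : ∀ k, IsPeriodic (v k))
    (hw : LipschitzWith K w) (hwp : IsPeriodic w) (hob : ∀ x, φ x ≤ w x ∧ w x ≤ ψ x)
    (hlim : TendstoUniformly v w atTop)
    (hN : ∀ᶠ k in atTop, ∫ x in cube d, |speed (ε k) φ ψ (v k) x| ≤ N) :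
    Tendsto (fun k => regEnergy (ε k) φ ψ (v k)) atTop (𝓝 (limitEnergy φ ψ w)) := by
  have hmem : ∀ k, MemW1Infty (v k) := fun k => by
    obtain ⟨Kv, hKv⟩ := (hvp k).exists_lipschitzWith ((hv k).of_le (by norm_num))
    exact memW1Infty_of_lipschitz hKv (hvp k)
  refine tendsto_of_le_liminf_of_limsup_le (limitEnergy_le_liminf hε hε0 hφ hψ hφp hψp hmem
    (memW1Infty_of_lipschitz hw hwp) hlim) ?_
  rw [limitEnergy_eq_of_lipschitz hw hwp hob]
  have hη : ∀ η, 0 < η → limsup (fun k => regEnergy (ε k) φ ψ (v k)) atTop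
      ≤ ENNReal.ofReal ((∫ x in cube d, ‖∇ w x‖) + η + η * N) := fun η hη => by
    refine limsup_le_of_le (h := ?_)
    filter_upwards [hN, Metric.tendstoUniformly_iff.1 hlim η hη, hε0.eventually (gt_mem_nhds hη)]
      with k hk1 hk2 hk3
    refine (regEnergy_le_of_speed (hε k) hφ hψ (hv k) (hvp k) hw hwp hob hη.le (fun x => ?_)
      hk1).trans (ENNReal.ofReal_le_ofReal (by linarith))
    have := hk2 x
    rw [dist_comm, Real.dist_eq] at this
    exact this.le
  have hcont : Continuous fun η => ENNReal.ofReal ((∫ x in cube d, ‖∇ w x‖) + η + η * N) :=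
    ENNReal.continuous_ofReal.comp (by fun_prop)
  have ht := (hcont.tendsto 0).mono_left (nhdsWithin_le_nhds (s := Ioi 0))
  simp only [add_zero, zero_mul] at ht
  exact ge_of_tendsto ht (eventually_mem_nhdsWithin.mono fun η h => hη η h)

end ObstacleMCF

/-! ### Assembly of the main theorem. -/

theorem mainTheorem5 {d : ℕ} (hd : 1 ≤ d)
    (φ ψ g : EuclideanSpace ℝ (Fin d) → ℝ)
    (hφ : ContDiff ℝ 1 φ) (hψ : ContDiff ℝ 1 ψ) (hg : ContDiff ℝ 2 g)
    (hφper : IsPeriodic φ) (hψper : IsPeriodic ψ) (hgper : IsPeriodic g)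
    (hφψ : ∀ x, φ x < ψ x) (hφg : ∀ x, φ x ≤ g x) (hgψ : ∀ x, g x ≤ ψ x)
    (ε : ℕ → ℝ) (hε : ∀ k, 0 < ε k) (hε0 : Tendsto ε atTop (𝓝 0))
    (uε : ℕ → EuclideanSpace ℝ (Fin d) → ℝ → ℝ)
    (huε : ∀ k, IsClassicalSolution (ε k) φ ψ g (uε k)) :
    ∃ u : EuclideanSpace ℝ (Fin d) → ℝ → ℝ,
      -- `u` is the viscosity solution
      (IsViscositySolution φ ψ g u ∧
        ∀ v, IsViscositySolution φ ψ g v → ∀ x t, 0 ≤ t → v x t = u x t) ∧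
      -- the obstacle constraint
      (∀ x t, 0 ≤ t → φ x ≤ u x t ∧ u x t ≤ ψ x) ∧
      ∃ σ : ℕ → ℕ, StrictMono σ ∧
        -- convergence on `Ω × [0,T]`
        (∀ T : ℝ, 0 < T →
          (∃ G h, HasWeakDerivatives T u G h ∧
            WeakStarTendsto T (fun k p => ∇ (fun y => uε (σ k) y p.2) p.1) G) ∧
          TendstoUniformlyOn
            (fun k (p : EuclideanSpace ℝ (Fin d) × ℝ) => uε (σ k) p.1 p.2)
            (fun p => u p.1 p.2) atTop (univ ×ˢ Icc 0 T)) ∧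
        -- slices are in `W^{1,∞}`, so that their energy is meaningful
        (∀ t, 0 ≤ t → MemW1Infty (fun x => u x t)) ∧
        -- `E` is the `Γ`-limit of the energies
        GammaConverges (fun k => regEnergy (ε (σ k)) φ ψ) (limitEnergy φ ψ) ∧
        -- convergence of the energies at every time, under the bound
        -- `sup_{ε ∈ (0,1)} ∫ |-H_ε + f_ε| dx < ∞` at the initial time
        ((∃ C : ℝ, ∀ e ∈ Ioo (0 : ℝ) 1,
            ∫ x in cube d, |-regCurvature e g x + force e φ ψ x (g x)| ≤ C) →
          ∀ t, 0 ≤ t →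
            Tendsto (fun k => regEnergy (ε (σ k)) φ ψ (fun x => uε (σ k) x t)) atTop
              (𝓝 (limitEnergy φ ψ (fun x => u x t))) ∧
            IsRecoverySequence (fun k => regEnergy (ε (σ k)) φ ψ) (limitEnergy φ ψ)
              (fun k x => uε (σ k) x t) (fun x => u x t)) := by
  obtain ⟨L, C, M, hB⟩ := exists_uniformBounds hφ hψ hg hφper hψper hgper
  obtain ⟨σ, hσ, u, hflow, hsol, huniq, hunif⟩ := exists_limit_flow hB hg hgper hφ.continuous
    hψ.continuous hφψ hφg hgψ hε hε0 huε
  have hadm : IsAdmissible φ ψ u := hsol.1.1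
  have hL := hB.L_nonneg
  have hC := hB.C_nonneg
  have hεσ : ∀ k, 0 < ε (σ k) := fun k => hε _
  have hεσ0 : Tendsto (fun k => ε (σ k)) atTop (𝓝 0) := hε0.comp hσ.tendsto_atTop
  have hslice : ∀ t, 0 ≤ t → MemW1Infty (fun x => u x t) := fun t ht =>
    memW1Infty_of_lipschitz (hflow.lipschitz_slice hL t) (hadm.periodic t ht)
  have huslice : ∀ t, 0 ≤ t → TendstoUniformly (fun k x => uε (σ k) x t) (fun x => u x t) atTop := by
    intro t ht
    have h := hunif (t + 1) (by linarith)
    rw [Metric.tendstoUniformlyOn_iff] at h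
    rw [Metric.tendstoUniformly_iff]
    intro e he
    filter_upwards [h e he] with k hk x
    exact hk (x, t) ⟨mem_univ _, ht, by linarith⟩
  have hflowε : ∀ k, IsLipschitzFlow L C (fun x t => uε (σ k) x (max t 0)) := fun k =>
    isLipschitzFlow_extension hC ((huε (σ k)).lipschitz_space hB (hεσ k))
      ((huε (σ k)).lipschitz_time hB (hεσ k) hg hgper hφg hgψ)
  have hΓ := gammaConverges_regEnergy hεσ hεσ0 hφ.continuous hψ.continuous hφper hψper
  refine ⟨u, ⟨hsol, huniq⟩, hadm.obstacles, σ, hσ, fun T hT => ⟨⟨fun p => ∇ (fun y => u y p.2) p.1,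
    fun p => deriv (u p.1) p.2, ?_, ?_⟩, hunif T hT⟩, hslice, hΓ, ?_⟩
  · obtain ⟨M', hM'⟩ := hadm.bounded
    exact hasWeakDerivatives_of_lipschitz hL hC hflow hadm.periodic hM' T
  · exact weakStarTendsto_gradient hL hC hflowε hflow
      (fun k => (huε (σ k)).abs_le_bound hB (hεσ k) hφψ hφg hgψ)
      (fun x t ht => (huslice t ht).tendsto_at x) T
  · rintro ⟨N, hN⟩ t ht
    -- The initial bound is available only for parameters below `1`, which excludes finitely many
    -- indices.
    have hev : ∀ᶠ k in atTop, ε (σ k) < 1 := hεσ0.eventually (gt_mem_nhds one_pos)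
    have hNσ : ∀ᶠ k in atTop, ∫ x in cube d, |speed (ε (σ k)) φ ψ g x| ≤ N :=
      hev.mono fun k hk => hN _ ⟨hεσ k, hk⟩
    -- At time zero the slice is `g`, which is `C²` by hypothesis; spatial regularity of the
    -- solution is given for positive times only.
    have hdata : ∀ k, ContDiff ℝ 2 (fun x => uε (σ k) x t) ∧
        ∫ x in cube d, |speed (ε (σ k)) φ ψ (fun x => uε (σ k) x t) x|
          ≤ ∫ x in cube d, |speed (ε (σ k)) φ ψ g x| := fun k => by
      rcases ht.eq_or_lt with h0 | hpos
      · have : (fun x => uε (σ k) x t) = g := by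
          funext x
          rw [← h0, (huε (σ k)).initial x]
        rw [this]
        exact ⟨hg, le_rfl⟩
      · exact ⟨(huε (σ k)).contDiff_space t hpos, (huε (σ k)).integral_abs_speed_le hB (hεσ k)
          hφ.continuous hψ.continuous hg hgper hφg hgψ hpos⟩
    have hlim := tendsto_regEnergy_of_speed hεσ hεσ0 hφ.continuous hψ.continuous hφper hψper
      (fun k => (hdata k).1) (fun k => (huε (σ k)).periodic t ht) (hflow.lipschitz_slice hL t)
      (hadm.periodic t ht) (fun x => hadm.obstacles x t ht) (huslice t ht)
      (hNσ.mono fun k hk => (hdata k).2.trans hk)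
    refine ⟨hlim, fun k => ?_, huslice t ht, hlim.limsup_eq.le⟩
    obtain ⟨K, hK⟩ := ((huε (σ k)).periodic t ht).exists_lipschitzWith
      ((hdata k).1.of_le (by norm_num))
    exact memW1Infty_of_lipschitz hK ((huε (σ k)).periodic t ht)
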